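/- **Proposition (Hermiticity of the $H_j$ in the separated variables).** Let $n,M\ge 0$ be integers, $s_1,\dots,s_n\in\{0,\tfrac12,1,\tfrac32,\dots\}$, $\hbar>0$, $\omega\in\mathbb R$, $g\in\mathbb R\setminus\{0\}$, and let $\epsilon_1,\dots,\epsilon_n$ be pairwise distinct real numbers. Put $$a(z)=\frac{2z}{g^2}-\frac{\omega}{g^2}-\sum_j\frac{\hbar s_j}{z-\epsilon_j},\qquad H_j=\frac{\prod_k(\epsilon_j-\lambda_k)}{\prod_{k\ne j}(\epsilon_j-\epsilon_k)}\sum_i\frac{\prod_{k\ne j}(\lambda_i-\epsilon_k)}{\prod_{k\ne i}(\lambda_i-\lambda_k)}\Big(\frac{d^2}{d\lambda_i^2}+\frac2\hbar a(\lambda_i)\frac{d}{d\lambda_i}-\frac{4M}{\hbar g^2}\Big),$$ $$W=\prod_{i<j}(\lambda_i-\lambda_j),\qquad x_i=\frac{4}{\hbar g^2}\,\frac{\prod_j|\epsilon_i-\lambda_j|^2}{\prod_{k\ne i}(\epsilon_i-\epsilon_k)^2}.$$ Let $\mathcal V_M$ be the complex span of the functions $\prod_{i=1}^n\psi(\lambda_i)$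 on $\mathbb C^n$, with $\psi$ a complex polynomial of degree at most $M$, and for $x_1,\dots,x_n>0$ let $$\rho(x_1,\dots,x_n)=\int_0^\infty e^{-y}\,y^{M+n-\sum_i(s_i+1/2)}\prod_i\frac{J_{2s_i+1}(2\sqrt{yx_i})}{x_i^{s_i+1/2}}\,dy ,$$ where $J_\nu$ is the Bessel function. Consider the scalar product $$\langle f,h\rangle=\int_{\mathbb C^n}|W|^2\,\rho(x_1,\dots,x_n)\,\overline{f}\,h\;\prod_i d\lambda_i\,d\bar\lambda_i ,$$ understood as the limit, as $\delta\to0^+$, of the absolutely convergent integrals with the additional factor $e^{-\delta(x_1+\cdots+x_n)}$ in the integrand. Then: 1. $\langle f,h\rangle$ exists for all $f,h\in\mathcal V_M$. For every $j$ and all $f,h\in\mathcal V_M$, $\langle f,H_jh\rangle$ and $\langle H_jf,h\rangle$ exist and $\langle f,H_jh\rangle=\langle H_jf,h\rangle$, i.e. $H_j$ is Hermitian. The same equality holds for the ordinary Lebesgue integrals (without the extra factor) whenever both converge absolutely. 2. The power series $$\tilde\rho(x)=\sum_{p\ge0}(-1)^p\binom{M+n+p}{p}\,p!\sum_{q_1+\cdots+q_n=p}\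 \prod_{i}\frac{x_i^{q_i}}{q_i!\,(2s_i+1+q_i)!}$$ (summed over $p$) converges for all $x\in\mathbb R^n$; for $x_1,\dots,x_n>0$ the integral defining $\rho$ converges absolutely and $\rho=(M+n)!\,\tilde\rho$. 3. $\tilde\rho$ is smooth on $\mathbb R^n$ and satisfies there, for all $i,k$, $$\mathcal D_i\tilde\rho=\mathcal D_k\tilde\rho,\qquad \mathcal D_i\tilde\rho+\mathcal D_0\tilde\rho=0,$$ where $\mathcal D_k=x_k\partial_{x_k}^2+2(s_k+1)\partial_{x_k}$ and $\mathcal D_0=\sum_kx_k\partial_{x_k}+M+n+1$. 4. For $n=1$, $s_1=s$ with $2s\le M$, and $x>0$, $$\rho(x)=(-1)^{2s+1}\,\partial_x^{M+1}\big[e^{-x}x^{M-2s}\big]=(M-2s)!\;e^{-x}L^{(2s+1)}_{M-2s}(x),$$ where $L^{(2s+1)}_{M-2s}$ is the generalized Laguerre polynomial, of degree $M-2s$. -/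

import Mathlib

open MeasureTheory Filter Topology

namespace JCG

noncomputable section

/-! Conventions: there are `n` spins; the spin `s_i` is an integer or a half-integer, recorded by the
natural number `d i = 2 * s_i`.  `M` is the number of excitations, `hb` is Planck's constant, `ω` and
`g` are the frequency and the coupling constant, `ε i` are the (real) inhomogeneities. -/

/-- The `i`-th partial derivative of a function of `n` variables. -/
def pd {𝕜 : Type*} [NontriviallyNormedField 𝕜] {n : ℕ} (i : Fin n) (f : (Fin n → 𝕜) → 𝕜) :
    (Fin n → 𝕜) → 𝕜 :=
  fun x => deriv (fun t => f (Function.update x i t)) (x i)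

/-! ### The measure -/

/-- Bessel function of the first kind of integer order `k ≥ 0`. -/
def besselJ (k : ℕ) (x : ℝ) : ℝ :=
  ∑' p : ℕ, (-1 : ℝ) ^ p / ((p.factorial : ℝ) * ((p + k).factorial : ℝ)) * (x / 2) ^ (2 * p + k)

/-- The integrand `e^{-y} y^{M+n-∑(s_i+1/2)} ∏ J_{2s_i+1}(2√(y x_i)) / x_i^{s_i+1/2}`. -/
def rhoIntegrand {n : ℕ} (M : ℕ) (d : Fin n → ℕ) (x : Fin n → ℝ) (y : ℝ) : ℝ :=
  Real.exp (-y) * y ^ ((M : ℝ) + (n : ℝ) - ∑ i, ((d i : ℝ) / 2 + 1 / 2)) *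
    ∏ i, besselJ (d i + 1) (2 * Real.sqrt (y * x i)) / (x i) ^ ((d i : ℝ) / 2 + 1 / 2)

/-- The density `ρ(x_1, …, x_n)` as an integral of Bessel functions (for positive `x_i`). -/
def rho {n : ℕ} (M : ℕ) (d : Fin n → ℕ) (x : Fin n → ℝ) : ℝ :=
  ∫ y in Set.Ioi (0 : ℝ), rhoIntegrand M d x y

/-- The degree `p` homogeneous part of the power series of the density. -/
def rhoTerm {n : ℕ} (M : ℕ) (d : Fin n → ℕ) (x : Fin n → ℝ) (p : ℕ) : ℝ :=
  (-1 : ℝ) ^ p * ((M + n + p).choose p : ℝ) * (p.factorial : ℝ) *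
    ∑ q ∈ Finset.Nat.antidiagonalTuple n p,
      ∏ i, (x i) ^ (q i) / (((q i).factorial : ℝ) * ((d i + 1 + q i).factorial : ℝ))

/-- The power series of the density. -/
def rhoSeries {n : ℕ} (M : ℕ) (d : Fin n → ℕ) (x : Fin n → ℝ) : ℝ :=
  ∑' p : ℕ, rhoTerm M d x p

/-- `D_k = x_k ∂_k² + 2 (s_k + 1) ∂_k`. -/
def opD {n : ℕ} (d : Fin n → ℕ) (k : Fin n) (f : (Fin n → ℝ) → ℝ) (x : Fin n → ℝ) : ℝ :=
  x k * pd k (pd k f) x + 2 * ((d k : ℝ) / 2 + 1) * pd k f x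

/-- `D_0 = ∑_k x_k ∂_k + M + n + 1`. -/
def opD0 {n : ℕ} (M : ℕ) (f : (Fin n → ℝ) → ℝ) (x : Fin n → ℝ) : ℝ :=
  ∑ k, x k * pd k f x + ((M : ℝ) + (n : ℝ) + 1) * f x

/-- The generalized Laguerre polynomial `L_k^{(α)}`. -/
def laguerre (α k : ℕ) : Polynomial ℝ :=
  ∑ i ∈ Finset.range (k + 1),
    Polynomial.C ((-1 : ℝ) ^ i * ((k + α).choose (k - i) : ℝ) / (i.factorial : ℝ)) *
      Polynomial.X ^ i

/-! ### The Hamiltonians in the separated variables -/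

/-- `a(z) = 2z/g² - ω/g² - ∑_j ħ s_j / (z - ε_j)`. -/
def aFun {n : ℕ} (d : Fin n → ℕ) (hb g ω : ℝ) (ε : Fin n → ℝ) (z : ℂ) : ℂ :=
  2 * z / (g : ℂ) ^ 2 - (ω : ℂ) / (g : ℂ) ^ 2 -
    ∑ j, (hb : ℂ) * ((d j : ℂ) / 2) / (z - (ε j : ℂ))

/-- `V_i = d²/dλ_i² + (2/ħ) a(λ_i) d/dλ_i - 4M/(ħ g²)`. -/
def opV {n : ℕ} (M : ℕ) (d : Fin n → ℕ) (hb g ω : ℝ) (ε : Fin n → ℝ) (i : Fin n)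
    (f : (Fin n → ℂ) → ℂ) (lam : Fin n → ℂ) : ℂ :=
  pd i (pd i f) lam + 2 / (hb : ℂ) * aFun d hb g ω ε (lam i) * pd i f lam -
    4 * (M : ℂ) / ((hb : ℂ) * (g : ℂ) ^ 2) * f lam

/-- The Hamiltonian `H_j` (a differential operator whose coefficients are regular where the `λ_i` are
pairwise distinct and different from the `ε_k`, that is, off a null set). -/
def opH {n : ℕ} (M : ℕ) (d : Fin n → ℕ) (hb g ω : ℝ) (ε : Fin n → ℝ) (j : Fin n)
    (f : (Fin n → ℂ) → ℂ) (lam : Fin n → ℂ) : ℂ :=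
  (∏ k, ((ε j : ℂ) - lam k)) / (∏ k ∈ Finset.univ.erase j, ((ε j : ℂ) - (ε k : ℂ))) *
    ∑ i, (∏ k ∈ Finset.univ.erase j, (lam i - (ε k : ℂ))) /
      (∏ k ∈ Finset.univ.erase i, (lam i - lam k)) * opV M d hb g ω ε i f lam

/-! ### The scalar product -/

/-- The space of wave functions: the span of the products `∏_i ψ(λ_i)` with `ψ` a polynomial of
degree at most `M`. -/
def waveFunctions (n M : ℕ) : Submodule ℂ ((Fin n → ℂ) → ℂ) :=
  Submodule.span ℂ {f | ∃ ψ : Polynomial ℂ, ψ.natDegree ≤ M ∧ f = fun lam => ∏ i, ψ.eval (lam i)}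

/-- The Vandermonde product of the `λ_i - λ_j` over the pairs `i < j`. -/
def vandermondeW {n : ℕ} (lam : Fin n → ℂ) : ℂ :=
  ∏ i, ∏ j ∈ Finset.Ioi i, (lam i - lam j)

/-- `x_i = (4 / (ħ g²)) ∏_j |ε_i - λ_j|² / ∏_{k ≠ i} (ε_i - ε_k)²`. -/
def xVar {n : ℕ} (hb g : ℝ) (ε : Fin n → ℝ) (lam : Fin n → ℂ) (i : Fin n) : ℝ :=
  4 / (hb * g ^ 2) *
    ((∏ j, ‖(ε i : ℂ) - lam j‖ ^ 2) / ∏ k ∈ Finset.univ.erase i, (ε i - ε k) ^ 2)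

/-- The integrand `|W|² ρ(x_1, …, x_n) conj(f) h` of the scalar product. -/
def innerIntegrand {n : ℕ} (M : ℕ) (d : Fin n → ℕ) (hb g : ℝ) (ε : Fin n → ℝ)
    (f h : (Fin n → ℂ) → ℂ) (lam : Fin n → ℂ) : ℂ :=
  ((‖vandermondeW lam‖ ^ 2 * rho M d (xVar hb g ε lam) : ℝ) : ℂ) *
    ((starRingEnd ℂ) (f lam) * h lam)

/-- The scalar product integral of `f` and `h` over `ℂⁿ` converges to `c`, as an improper integral
with the convergence factor `exp (-δ (x_1 + ⋯ + x_n))`, `δ → 0+`.  (When the integrand is Lebesgue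
integrable, `c` is its Lebesgue integral, by dominated convergence.) -/
def HasScalarProduct {n : ℕ} (M : ℕ) (d : Fin n → ℕ) (hb g : ℝ) (ε : Fin n → ℝ)
    (f h : (Fin n → ℂ) → ℂ) (c : ℂ) : Prop :=
  (∀ δ : ℝ, 0 < δ → Integrable (fun lam : Fin n → ℂ =>
      (Real.exp (-δ * ∑ i, xVar hb g ε lam i) : ℂ) * innerIntegrand M d hb g ε f h lam)) ∧
    Tendsto (fun δ : ℝ => ∫ lam : Fin n → ℂ,
      (Real.exp (-δ * ∑ i, xVar hb g ε lam i) : ℂ) * innerIntegrand M d hb g ε f h lam)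
      (𝓝[>] 0) (𝓝 c)

end

end JCG

namespace JCG

/-! ### Entire power series in one variable -/

/-! Write c = 4/(ħg²) and d_k = 2s_k. The theorem rests on a change of variables from λ to the
residues z_k = ∏_l (ε_k - λ_l) / ∏_{l≠k} (ε_k - ε_l) of the rational function ∏(t - λ_l) / ∏(t -
ε_l), called `zVar`. Off a null set the map is n! to one, and its complex Jacobian has modulus
|W(λ)|/|W(ε)|, so |W|² dλ becomes a constant times Lebesgue measure in z (`integral_comp_zVar`).
Moreover x_k = c|z_k|², and ∏(λ_i - μ) is affine in z, so every wave function is a polynomial in z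
of total degree at most M (`exists_eval_zVar_of_mem_waveFunctions`).

In these variables H_j is a polynomial differential operator (`opH_eval_zVar`): the sum of a
lowering operator z_j∂_j² - d_j∂_j, a raising operator c z_j(∑ z_k∂_k - M), a real multiple of
z_j∂_j, and exchange terms with coefficients 1/(ε_j - ε_k). It preserves the polynomials of degree
at most M (`hamZ_mem`).

The density is ∫ e^{-y} y^{M+n} ∏ G_{d_i+1}(y x_i) dy with the entire functions G_k(x) = x^{-k/2}
J_k(2√x). It depends only on the |z_i|, so distinct monomials are orthogonal. For fixed y the
z-integral factorises, and rescaling by y leaves Laplace transforms of x^α G_k at δ/y. These tend to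
α!/(k-1-α)! if α < k and to 0 otherwise (`tendsto_laplaceG`); dominated convergence in y then gives
z^α a square norm proportional to `monomialWeight`. Two recursions for these weights say that
lowering and raising are mutually adjoint and that the exchange terms are symmetric (`isAdj_hamZ`).
That is Hermiticity.

For the power series, the G's are expanded and integrated termwise (`integral_besselG_prod`). Its
coefficients obey a first-order recursion in each index whose right-hand side does not depend on the
index (`laplaceCoeff_add_single`); this is the system of differential equations. For one spin the
coefficients are compared with those of a derivative of e^{-x} x^{M-2s}, and the Leibniz rule
produces the Laguerre polynomial. -/

/-- The coefficient sequence `c` defines an everywhere convergent power series. -/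
def EntireCoeff (c : ℕ → ℝ) : Prop := ∀ R : ℝ, 0 ≤ R → Summable fun p => |c p| * R ^ p

/-- The sum of the power series with coefficients `c`. -/
noncomputable def powerSum (c : ℕ → ℝ) (x : ℝ) : ℝ := ∑' p, c p * x ^ p

/-- The coefficients of the derivative of a power series. -/
def derivCoeff (c : ℕ → ℝ) (p : ℕ) : ℝ := ((p : ℝ) + 1) * c (p + 1)

theorem EntireCoeff.summable {c : ℕ → ℝ} (hc : EntireCoeff c) (x : ℝ) :
    Summable fun p => c p * x ^ p := by
  refine Summable.of_norm ?_
  simpa [abs_mul, abs_pow] using hc |x| (abs_nonneg x)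

theorem natCast_add_one_le_two_pow (p : ℕ) : (p : ℝ) + 1 ≤ 2 ^ p := by
  exact_mod_cast Nat.lt_two_pow_self

/-- The factor p + 1 is at most 2^p, so enlarging the radius absorbs it. -/
theorem EntireCoeff.derivCoeff {c : ℕ → ℝ} (hc : EntireCoeff c) : EntireCoeff (derivCoeff c) := by
  intro R hR
  have h := (summable_nat_add_iff (f := fun p => |c p| * (2 * (R + 1)) ^ p) 1).2
    (hc _ (by positivity))
  refine Summable.of_nonneg_of_le (fun p => by positivity) (fun p => ?_) h
  rw [JCG.derivCoeff, abs_mul, abs_of_nonneg (by positivity : (0 : ℝ) ≤ (p : ℝ) + 1), mul_pow]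
  have h1 := natCast_add_one_le_two_pow p
  have h2 : R ^ p ≤ (R + 1) ^ (p + 1) :=
    (pow_le_pow_left₀ hR (by linarith) p).trans (pow_le_pow_right₀ (by linarith) (by omega))
  have h3 : (2 : ℝ) ^ p ≤ 2 ^ (p + 1) := pow_le_pow_right₀ (by norm_num) (by omega)
  calc ((p : ℝ) + 1) * |c (p + 1)| * R ^ p = |c (p + 1)| * (((p : ℝ) + 1) * R ^ p) := by ring
    _ ≤ |c (p + 1)| * (2 ^ (p + 1) * (R + 1) ^ (p + 1)) := by gcongr; linarith

theorem hasDerivAt_powerSum {c : ℕ → ℝ} (hc : EntireCoeff c) (x : ℝ) :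
    HasDerivAt (powerSum c) (powerSum (derivCoeff c) x) x := by
  set R := |x| + 1 with hR
  have hR0 : 0 ≤ R := by positivity
  have hu : Summable fun p : ℕ => |c p| * ((p : ℝ) * R ^ (p - 1)) := by
    refine (summable_nat_add_iff 1).1 ?_
    refine (hc.derivCoeff R hR0).congr fun p => ?_
    rw [derivCoeff, abs_mul, abs_of_nonneg (by positivity : (0 : ℝ) ≤ (p : ℝ) + 1)]
    push_cast
    ring
  have key := hasDerivAt_tsum_of_isPreconnected (𝕜 := ℝ) (F := ℝ)
    (g := fun p x => c p * x ^ p)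
    (g' := fun p x => c p * ((p : ℝ) * x ^ (p - 1))) (t := Metric.ball 0 R) (y₀ := 0) (y := x)
    hu Metric.isOpen_ball (convex_ball (0 : ℝ) R).isPreconnected
    (fun p y _ => (hasDerivAt_pow p y).const_mul (c p))
    (fun p y hy => by
      have hy' : |y| ≤ R := by
        have := mem_ball_zero_iff.1 hy
        rw [Real.norm_eq_abs] at this
        exact this.le
      rw [norm_mul, norm_mul, norm_pow]
      simp only [Real.norm_eq_abs, Nat.abs_cast]
      gcongr)
    (Metric.mem_ball_self (by positivity)) (hc.summable 0)
    (by rw [mem_ball_zero_iff, Real.norm_eq_abs]; linarith)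
  have h2 : ∑' p, c p * ((p : ℝ) * x ^ (p - 1)) = powerSum (derivCoeff c) x := by
    have hs : Summable fun p : ℕ => c p * ((p : ℝ) * x ^ (p - 1)) := by
      refine Summable.of_norm_bounded hu fun p => ?_
      rw [norm_mul, norm_mul, norm_pow]
      simp only [Real.norm_eq_abs, Nat.abs_cast]
      have : |x| ≤ R := by linarith
      gcongr
    rw [hs.tsum_eq_zero_add, powerSum]
    simp only [Nat.cast_zero, zero_mul, mul_zero, zero_add]
    refine tsum_congr fun p => ?_
    rw [derivCoeff]
    push_cast
    ring
  rw [← h2]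
  exact key

/-! ### The entire part of the Bessel function -/

/-- Coefficients of `x ^ (-k / 2) J_k (2 √x)`. -/
noncomputable def besselCoeff (k p : ℕ) : ℝ :=
  (-1 : ℝ) ^ p / ((p.factorial : ℝ) * ((p + k).factorial : ℝ))

/-- The entire function `x ^ (-k / 2) J_k (2 √x)`. -/
noncomputable def besselG (k : ℕ) : ℝ → ℝ := powerSum (besselCoeff k)

theorem abs_besselCoeff (k p : ℕ) :
    |besselCoeff k p| = 1 / ((p.factorial : ℝ) * ((p + k).factorial : ℝ)) := by
  rw [besselCoeff, abs_div, abs_pow, abs_neg, abs_one, one_pow, abs_of_nonneg (by positivity)]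

theorem entireCoeff_besselCoeff (k : ℕ) : EntireCoeff (besselCoeff k) := by
  intro R hR
  refine Summable.of_nonneg_of_le (fun p => by positivity) (fun p => ?_)
    (Real.summable_pow_div_factorial R)
  rw [abs_besselCoeff, div_mul_eq_mul_div, one_mul]
  have : (1 : ℝ) ≤ ((p + k).factorial : ℝ) := by exact_mod_cast Nat.factorial_pos _
  have h0 : (0 : ℝ) < (p.factorial : ℝ) := by positivity
  gcongr
  nlinarith

theorem hasDerivAt_besselG (k : ℕ) (x : ℝ) : HasDerivAt (besselG k) (-besselG (k + 1) x) x := by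
  have h := hasDerivAt_powerSum (entireCoeff_besselCoeff k) x
  have : powerSum (derivCoeff (besselCoeff k)) x = -besselG (k + 1) x := by
    rw [besselG, powerSum, powerSum, ← tsum_neg]
    refine tsum_congr fun p => ?_
    rw [derivCoeff, besselCoeff, besselCoeff, Nat.factorial_succ,
      show p + 1 + k = p + (k + 1) by ring]
    push_cast
    field_simp
    ring
  rwa [this] at h

theorem continuous_besselG (k : ℕ) : Continuous (besselG k) :=
  continuous_iff_continuousAt.2 fun x => (hasDerivAt_besselG k x).continuousAt

theorem besselG_zero (k : ℕ) : besselG k 0 = 1 / (k.factorial : ℝ) := by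
  rw [besselG, powerSum, tsum_eq_single 0 (fun p hp => by simp [hp])]
  simp [besselCoeff]

/-- This is J_k + J_{k+2} = (2(k+1)/t) J_{k+1}, rewritten for the entire parts. -/
theorem besselG_recurrence (k : ℕ) (x : ℝ) :
    x * besselG (k + 2) x = ((k : ℝ) + 1) * besselG (k + 1) x - besselG k x := by
  have h0 := (entireCoeff_besselCoeff k).summable x
  have h1 := (entireCoeff_besselCoeff (k + 1)).summable x
  rw [besselG, besselG, besselG, powerSum, powerSum, powerSum, ← tsum_mul_left, ← tsum_mul_left,
    ← (h1.mul_left _).tsum_sub h0, ((h1.mul_left _).sub h0).tsum_eq_zero_add]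
  have hz : ((k : ℝ) + 1) * (besselCoeff (k + 1) 0 * x ^ 0) - besselCoeff k 0 * x ^ 0 = 0 := by
    simp only [besselCoeff, zero_add, Nat.factorial_succ]
    push_cast
    field_simp
    ring
  rw [hz, zero_add]
  refine tsum_congr fun p => ?_
  have e1 : p + 1 + (k + 1) = (p + 1 + k) + 1 := by ring
  have e2 : p + (k + 2) = (p + 1 + k) + 1 := by ring
  simp only [besselCoeff, e1, e2, Nat.factorial_succ (p + 1 + k), Nat.factorial_succ p]
  push_cast
  field_simp
  ring

/-- The energy E = G_k² + t G_{k+1}² has derivative -(2k+1) G_{k+1}² by the recurrence, hence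
decreases from E(0) = 1/k!². Boundedness on the half-line is what makes every integral against an
exponential converge. -/
theorem abs_besselG_le (k : ℕ) {x : ℝ} (hx : 0 ≤ x) : |besselG k x| ≤ 1 / (k.factorial : ℝ) := by
  set E : ℝ → ℝ := fun t => besselG k t ^ 2 + t * besselG (k + 1) t ^ 2 with hE
  have hd : ∀ t, HasDerivAt E (-(2 * (k : ℝ) + 1) * besselG (k + 1) t ^ 2) t := by
    intro t
    have h1 := (hasDerivAt_besselG k t).pow 2
    have h2 := (hasDerivAt_id t).mul ((hasDerivAt_besselG (k + 1) t).pow 2)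
    refine (h1.add h2).congr_deriv ?_
    have := besselG_recurrence k t
    simp only [id, Pi.pow_apply, Nat.cast_ofNat, Nat.add_one_sub_one, pow_one, one_mul]
    linear_combination (-2) * besselG (k + 1) t * this
  have hanti : Antitone E := antitone_of_deriv_nonpos (fun t => (hd t).differentiableAt) fun t => by
    rw [(hd t).deriv]
    have : 0 ≤ (2 * (k : ℝ) + 1) * besselG (k + 1) t ^ 2 := by positivity
    linarith
  have h := hanti hx
  simp only [hE, zero_mul, add_zero, besselG_zero] at h
  refine abs_le_of_sq_le_sq ?_ (by positivity)
  nlinarith [mul_nonneg hx (sq_nonneg (besselG (k + 1) x))]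

theorem besselJ_two_mul_sqrt (k : ℕ) {t : ℝ} (ht : 0 ≤ t) :
    besselJ k (2 * Real.sqrt t) = Real.sqrt t ^ k * besselG k t := by
  rw [besselJ, besselG, powerSum, ← tsum_mul_left]
  refine tsum_congr fun p => ?_
  rw [mul_div_cancel_left₀ _ (two_ne_zero), pow_add, pow_mul, Real.sq_sqrt ht, besselCoeff]
  ring

theorem sqrt_pow_eq_rpow {t : ℝ} (ht : 0 ≤ t) (k : ℕ) :
    Real.sqrt t ^ (k + 1) = t ^ ((k : ℝ) / 2 + 1 / 2) := by
  rw [Real.sqrt_eq_rpow, ← Real.rpow_natCast, ← Real.rpow_mul ht]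
  congr 1
  push_cast
  ring

/-- The half-integer powers cancel: each Bessel factor contributes y^{s_i+1/2}, which restores the
integer exponent M + n, and its power of x_i is divided out. -/
theorem rhoIntegrand_eq {n : ℕ} (M : ℕ) (d : Fin n → ℕ) {x : Fin n → ℝ} (hx : ∀ i, 0 < x i)
    {y : ℝ} (hy : 0 < y) :
    rhoIntegrand M d x y =
      Real.exp (-y) * y ^ (M + n) * ∏ i, besselG (d i + 1) (y * x i) := by
  have h : ∀ i, besselJ (d i + 1) (2 * Real.sqrt (y * x i)) / (x i) ^ ((d i : ℝ) / 2 + 1 / 2) =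
      y ^ ((d i : ℝ) / 2 + 1 / 2) * besselG (d i + 1) (y * x i) := by
    intro i
    have hxi := hx i
    rw [besselJ_two_mul_sqrt _ (by positivity), sqrt_pow_eq_rpow (by positivity),
      Real.mul_rpow hy.le hxi.le]
    have : (x i) ^ ((d i : ℝ) / 2 + 1 / 2) ≠ 0 := (Real.rpow_pos_of_pos hxi _).ne'
    field_simp
  rw [rhoIntegrand, Finset.prod_congr rfl fun i _ => h i, Finset.prod_mul_distrib,
    ← Real.rpow_sum_of_pos hy, mul_assoc, ← mul_assoc (y ^ _), ← Real.rpow_add hy,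
    sub_add_cancel, mul_assoc]
  congr 2
  rw [← Real.rpow_natCast]
  push_cast
  rfl

/-! ### Entire power series in several variables -/

theorem hasSum_prod_pi {n : ℕ} (f : Fin n → ℕ → ℝ) (hf : ∀ i, Summable fun p => ‖f i p‖) :
    HasSum (fun q : Fin n → ℕ => ∏ i, f i (q i)) (∏ i, ∑' p, f i p) ∧
      Summable fun q : Fin n → ℕ => ‖∏ i, f i (q i)‖ := by
  induction n with
  | zero =>
    refine ⟨?_, (hasSum_fintype _).summable⟩
    simp
  | succ n ih =>
    obtain ⟨h1, h2⟩ := ih (fun i => f i.succ) fun i => hf i.succ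
    have hs := Summable.mul_norm (hf 0) h2
    have e : ∀ z : ℕ × (Fin n → ℕ), ∏ i, f i ((Fin.consEquiv fun _ => ℕ) z i) =
        f 0 z.1 * ∏ i, f i.succ (z.2 i) := by
      intro z
      simp [Fin.prod_univ_succ, Fin.consEquiv]
    constructor
    · rw [← (Fin.consEquiv fun _ => ℕ).hasSum_iff, Fin.prod_univ_succ]
      have h3 := (hf 0).of_norm.hasSum.mul h1 hs.of_norm
      rwa [← funext e] at h3
    · rw [← (Fin.consEquiv fun _ => ℕ).summable_iff]
      have h3 : Summable fun z : ℕ × (Fin n → ℕ) => ‖f 0 z.1 * ∏ i, f i.succ (z.2 i)‖ := hs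
      simp only [← e] at h3
      exact h3

/-- The coefficients `a` define an everywhere convergent power series in `n` variables. -/
def MEntire {n : ℕ} (a : (Fin n → ℕ) → ℝ) : Prop :=
  ∀ R : ℝ, 0 ≤ R → Summable fun q => |a q| * R ^ ∑ i, q i

/-- The sum of a power series in `n` variables. -/
noncomputable def mSum {n : ℕ} (a : (Fin n → ℕ) → ℝ) (x : Fin n → ℝ) : ℝ :=
  ∑' q, a q * ∏ i, x i ^ q i

/-- The coefficients of the `k`-th partial derivative. -/
def mShift {n : ℕ} (k : Fin n) (a : (Fin n → ℕ) → ℝ) (q : Fin n → ℕ) : ℝ :=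
  ((q k : ℝ) + 1) * a (q + Pi.single k 1)

theorem prod_pow_le_pow_sum {n : ℕ} {x : Fin n → ℝ} {R : ℝ} (hx : ∀ i, |x i| ≤ R)
    (q : Fin n → ℕ) : |∏ i, x i ^ q i| ≤ R ^ ∑ i, q i := by
  rw [Finset.abs_prod, ← Finset.prod_pow_eq_pow_sum]
  refine Finset.prod_le_prod (fun i _ => abs_nonneg _) fun i _ => ?_
  rw [abs_pow]
  exact pow_le_pow_left₀ (abs_nonneg _) (hx i) _

theorem MEntire.summable_abs {n : ℕ} {a : (Fin n → ℕ) → ℝ} (ha : MEntire a) (x : Fin n → ℝ) :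
    Summable fun q => |a q * ∏ i, x i ^ q i| := by
  refine Summable.of_nonneg_of_le (fun q => abs_nonneg _) (fun q => ?_)
    (ha (∑ i, |x i|) (Finset.sum_nonneg fun i _ => abs_nonneg _))
  rw [abs_mul]
  refine mul_le_mul_of_nonneg_left (prod_pow_le_pow_sum (fun i => ?_) q) (abs_nonneg _)
  exact Finset.single_le_sum (f := fun i => |x i|) (fun i _ => abs_nonneg _) (Finset.mem_univ i)

theorem MEntire.summable {n : ℕ} {a : (Fin n → ℕ) → ℝ} (ha : MEntire a) (x : Fin n → ℝ) :
    Summable fun q => a q * ∏ i, x i ^ q i :=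
  (ha.summable_abs x).of_abs

theorem sum_add_single {n : ℕ} (k : Fin n) (q : Fin n → ℕ) :
    ∑ i, (q + Pi.single k 1 : Fin n → ℕ) i = ∑ i, q i + 1 := by
  simp [Finset.sum_add_distrib]

theorem MEntire.shift {n : ℕ} {a : (Fin n → ℕ) → ℝ} (ha : MEntire a) (k : Fin n) :
    MEntire (mShift k a) := by
  intro R hR
  have h := (ha (2 * (R + 1)) (by positivity)).comp_injective
    (add_left_injective (Pi.single k 1 : Fin n → ℕ))
  refine Summable.of_nonneg_of_le (fun p => by positivity) (fun q => ?_) h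
  simp only [Function.comp_apply, sum_add_single, mShift]
  rw [abs_mul, abs_of_nonneg (by positivity : (0 : ℝ) ≤ (q k : ℝ) + 1), mul_pow]
  set m := ∑ i, q i with hm
  have hqm : q k ≤ m := Finset.single_le_sum (f := q) (fun i _ => Nat.zero_le _) (Finset.mem_univ k)
  have h1 := natCast_add_one_le_two_pow (q k)
  have h2 : R ^ m ≤ (R + 1) ^ (m + 1) :=
    (pow_le_pow_left₀ hR (by linarith) m).trans (pow_le_pow_right₀ (by linarith) (by omega))
  have h3 : (2 : ℝ) ^ (q k) ≤ 2 ^ (m + 1) := pow_le_pow_right₀ (by norm_num) (by omega)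
  calc ((q k : ℝ) + 1) * |a (q + Pi.single k 1)| * R ^ m
      = |a (q + Pi.single k 1)| * (((q k : ℝ) + 1) * R ^ m) := by ring
    _ ≤ |a (q + Pi.single k 1)| * (2 ^ (m + 1) * (R + 1) ^ (m + 1)) := by gcongr; linarith

theorem eq_zero_of_notMem_range_add_single {n : ℕ} (k : Fin n) {f : (Fin n → ℕ) → ℝ}
    (hf : ∀ q : Fin n → ℕ, q k = 0 → f q = 0) (q : Fin n → ℕ)
    (hq : q ∉ Set.range fun q : Fin n → ℕ => q + Pi.single k 1) : f q = 0 := by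
  by_contra h0
  have hk : q k ≠ 0 := fun h => h0 (hf q h)
  refine hq ⟨q - (Pi.single k 1 : Fin n → ℕ), ?_⟩
  funext i
  by_cases h : i = k
  · subst h
    simp
    omega
  · simp [h]

/-- The multi-indices missed by the shift are those with q_k = 0. This reindexes differentiated
series without truncated subtraction. -/
theorem tsum_shift {n : ℕ} (k : Fin n) {f : (Fin n → ℕ) → ℝ}
    (hf : ∀ q : Fin n → ℕ, q k = 0 → f q = 0) :
    ∑' q : Fin n → ℕ, f (q + Pi.single k 1) = ∑' q, f q :=
  (add_left_injective (Pi.single k 1 : Fin n → ℕ)).tsum_eq (f := f) fun q hq => by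
    by_contra h
    exact hq (eq_zero_of_notMem_range_add_single k hf q h)

theorem summable_of_shift {n : ℕ} (k : Fin n) {f : (Fin n → ℕ) → ℝ}
    (hf : ∀ q : Fin n → ℕ, q k = 0 → f q = 0)
    (h : Summable fun q : Fin n → ℕ => f (q + Pi.single k 1)) : Summable f :=
  ((add_left_injective (Pi.single k 1 : Fin n → ℕ)).summable_iff
    (eq_zero_of_notMem_range_add_single k hf)).1 h

theorem prod_pow_add_single {n : ℕ} (k : Fin n) (x : Fin n → ℝ) (q : Fin n → ℕ) :
    ∏ i, x i ^ (q + Pi.single k 1 : Fin n → ℕ) i = x k * ∏ i, x i ^ q i := by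
  simp only [Pi.add_apply, pow_add, Finset.prod_mul_distrib]
  rw [mul_comm, Finset.prod_eq_single k (fun b _ hb => by simp [hb]) (by simp)]
  simp

theorem mul_mSum_shift {n : ℕ} (k : Fin n) (a : (Fin n → ℕ) → ℝ) (x : Fin n → ℝ) :
    x k * mSum (mShift k a) x = mSum (fun q => (q k : ℝ) * a q) x := by
  rw [mSum, mSum, ← tsum_mul_left,
    ← tsum_shift k (f := fun q => (q k : ℝ) * a q * ∏ i, x i ^ q i) (fun q hq => by simp [hq])]
  refine tsum_congr fun q => ?_
  rw [prod_pow_add_single, mShift]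
  simp
  ring

/-- The derivative of the monomial `x ^ q`. -/
noncomputable def mDeriv {n : ℕ} (q : Fin n → ℕ) (x : Fin n → ℝ) : (Fin n → ℝ) →L[ℝ] ℝ :=
  ∑ k, ((∏ i ∈ Finset.univ.erase k, x i ^ q i) * ((q k : ℝ) * x k ^ (q k - 1))) •
    ContinuousLinearMap.proj k

theorem hasFDerivAt_monomial {n : ℕ} (q : Fin n → ℕ) (x : Fin n → ℝ) :
    HasFDerivAt (fun x : Fin n → ℝ => ∏ i, x i ^ q i) (mDeriv q x) x := by
  have h : ∀ k ∈ (Finset.univ : Finset (Fin n)), HasFDerivAt (fun x : Fin n → ℝ => x k ^ q k)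
      (((q k : ℝ) * x k ^ (q k - 1)) • (ContinuousLinearMap.proj k : (Fin n → ℝ) →L[ℝ] ℝ)) x := by
    intro k _
    exact (hasDerivAt_pow (q k) (x k)).comp_hasFDerivAt x (hasFDerivAt_apply k x)
  refine (HasFDerivAt.finsetProd h).congr_fderiv ?_
  rw [mDeriv]
  refine Finset.sum_congr rfl fun k _ => ?_
  rw [smul_smul]

theorem prod_erase_mul_le {n : ℕ} {x : Fin n → ℝ} {R : ℝ} (hR : 1 ≤ R) (hx : ∀ i, |x i| ≤ R)
    (k : Fin n) (q : Fin n → ℕ) :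
    |(∏ i ∈ Finset.univ.erase k, x i ^ q i) * ((q k : ℝ) * x k ^ (q k - 1))| ≤
      (2 * R) ^ ∑ i, q i := by
  rw [← Finset.prod_pow_eq_pow_sum, ← Finset.prod_erase_mul _ _ (Finset.mem_univ k), abs_mul,
    Finset.abs_prod]
  have h1 : ∀ i, |x i ^ q i| ≤ (2 * R) ^ q i := fun i => by
    rw [abs_pow]
    exact pow_le_pow_left₀ (abs_nonneg _) ((hx i).trans (by linarith)) _
  have h2 : |(q k : ℝ) * x k ^ (q k - 1)| ≤ (2 * R) ^ q k := by
    rw [abs_mul, abs_pow, Nat.abs_cast, mul_pow]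
    have h3 := natCast_add_one_le_two_pow (q k)
    have h4 : |x k| ^ (q k - 1) ≤ R ^ q k :=
      (pow_le_pow_left₀ (abs_nonneg _) (hx k) _).trans (pow_le_pow_right₀ hR (by omega))
    gcongr
    linarith
  exact mul_le_mul (Finset.prod_le_prod (fun i _ => abs_nonneg _) fun i _ => h1 i) h2
    (abs_nonneg _) (Finset.prod_nonneg fun i _ => by positivity)

theorem norm_mDeriv_le {n : ℕ} {x : Fin n → ℝ} {R : ℝ} (hR : 1 ≤ R) (hx : ∀ i, |x i| ≤ R)
    (q : Fin n → ℕ) : ‖mDeriv q x‖ ≤ n * (2 * R) ^ ∑ i, q i := by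
  refine (norm_sum_le _ _).trans ?_
  refine (Finset.sum_le_card_nsmul _ _ ((2 * R) ^ ∑ i, q i) fun k _ => ?_).trans (by simp)
  rw [norm_smul]
  refine (mul_le_of_le_one_right (norm_nonneg _) ?_).trans (prod_erase_mul_le hR hx k q)
  refine ContinuousLinearMap.opNorm_le_bound _ zero_le_one fun v => ?_
  rw [one_mul]
  exact norm_le_pi_norm v k

/-- The derivative is a finite combination of series of the same kind with constant functionals, so
smoothness follows by induction on the order. -/
theorem hasFDerivAt_mSum {n : ℕ} {a : (Fin n → ℕ) → ℝ} (ha : MEntire a) (x : Fin n → ℝ) :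
    HasFDerivAt (mSum a)
      (∑ k, mSum (mShift k a) x • (ContinuousLinearMap.proj k : (Fin n → ℝ) →L[ℝ] ℝ)) x := by
  set R := ‖x‖ + 1 with hR
  have hR1 : 1 ≤ R := by
    have := norm_nonneg x
    linarith
  have hbd : ∀ y : Fin n → ℝ, ‖y‖ ≤ R → ∀ i, |y i| ≤ R := fun y hy i =>
    (norm_le_pi_norm y i).trans hy
  have hu : Summable fun q : Fin n → ℕ => |a q| * ((n : ℝ) * (2 * R) ^ ∑ i, q i) := by
    refine ((ha (2 * R) (by positivity)).mul_left (n : ℝ)).congr fun q => by ring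
  have key := hasFDerivAt_tsum_of_isPreconnected (𝕜 := ℝ) (F := ℝ)
    (f := fun q (x : Fin n → ℝ) => a q * ∏ i, x i ^ q i)
    (f' := fun q x => a q • mDeriv q x) (s := Metric.ball 0 R) (x₀ := 0) (x := x)
    hu Metric.isOpen_ball (convex_ball (0 : Fin n → ℝ) R).isPreconnected
    (fun q y _ => (hasFDerivAt_monomial q y).const_mul (a q))
    (fun q y hy => by
      rw [norm_smul]
      exact mul_le_mul_of_nonneg_left
        (norm_mDeriv_le hR1 (hbd y (mem_ball_zero_iff.1 hy).le) q) (norm_nonneg _))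
    (Metric.mem_ball_self (by linarith)) (ha.summable 0)
    (by rw [mem_ball_zero_iff]; linarith)
  refine key.congr_fderiv ?_
  have hx : ∀ i, |x i| ≤ R := hbd x (by linarith)
  have hs : ∀ k, Summable fun q : Fin n → ℕ =>
      a q * ((∏ i ∈ Finset.univ.erase k, x i ^ q i) * ((q k : ℝ) * x k ^ (q k - 1))) := fun k => by
    refine Summable.of_norm_bounded (ha (2 * R) (by positivity)) fun q => ?_
    rw [norm_mul]
    exact mul_le_mul_of_nonneg_left (prod_erase_mul_le hR1 hx k q) (norm_nonneg _)
  have hk : ∀ k, ∑' q : Fin n → ℕ,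
      a q * ((∏ i ∈ Finset.univ.erase k, x i ^ q i) * ((q k : ℝ) * x k ^ (q k - 1))) =
        mSum (mShift k a) x := fun k => by
    rw [← tsum_shift k (fun q hq => by simp [hq]), mSum]
    refine tsum_congr fun q => ?_
    rw [mShift, ← Finset.prod_erase_mul _ _ (Finset.mem_univ k)]
    have : ∏ i ∈ Finset.univ.erase k, x i ^ (q + Pi.single k 1 : Fin n → ℕ) i =
        ∏ i ∈ Finset.univ.erase k, x i ^ q i :=
      Finset.prod_congr rfl fun i hi => by simp [(Finset.mem_erase.1 hi).1]
    rw [this]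
    simp
    ring
  have e : ∀ q, a q • mDeriv q x = ∑ k, (a q * ((∏ i ∈ Finset.univ.erase k, x i ^ q i) *
      ((q k : ℝ) * x k ^ (q k - 1)))) • (ContinuousLinearMap.proj k : (Fin n → ℝ) →L[ℝ] ℝ) := by
    intro q
    rw [mDeriv, Finset.smul_sum]
    exact Finset.sum_congr rfl fun k _ => smul_smul _ _ _
  rw [tsum_congr e]
  refine HasSum.tsum_eq (hasSum_sum fun k _ => ?_)
  rw [← hk k]
  exact (hs k).hasSum.smul_const _

theorem pd_mSum {n : ℕ} {a : (Fin n → ℕ) → ℝ} (ha : MEntire a) (k : Fin n) :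
    pd k (mSum a) = mSum (mShift k a) := by
  funext x
  have h1 : HasFDerivAt (mSum a) _ (Function.update x k (x k)) :=
    (Function.update_eq_self k x).symm ▸ hasFDerivAt_mSum ha x
  have h := h1.comp_hasDerivAt (x k) (hasDerivAt_update x k (x k))
  rw [pd]
  refine h.deriv.trans ?_
  simp only [_root_.sum_apply, _root_.smul_apply,
    ContinuousLinearMap.proj_apply, smul_eq_mul]
  rw [Finset.sum_eq_single k (fun b _ hb => by simp [hb]) (by simp)]
  simp

theorem contDiff_nat_mSum {n : ℕ} (m : ℕ) {a : (Fin n → ℕ) → ℝ} (ha : MEntire a) :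
    ContDiff ℝ m (mSum a) := by
  induction m generalizing a with
  | zero =>
    refine contDiff_zero.2 (continuous_iff_continuousAt.2 fun x => ?_)
    exact (hasFDerivAt_mSum ha x).continuousAt
  | succ m ih =>
    refine contDiff_succ_iff_hasFDerivAt (n := m) |>.2 ⟨_, ?_, fun x => hasFDerivAt_mSum ha x⟩
    exact ContDiff.sum fun k _ => (ih (ha.shift k)).smul contDiff_const

theorem contDiff_mSum {n : ℕ} {a : (Fin n → ℕ) → ℝ} (ha : MEntire a) :
    ContDiff ℝ (⊤ : ℕ∞) (mSum a) :=
  contDiff_infty.2 fun m => contDiff_nat_mSum m ha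

/-! ### The power series of the density -/

/-- The power series coefficients of `∫ e^{-y} y^N ∏ G(y x_i) dy`. -/
noncomputable def laplaceCoeff {n : ℕ} (N : ℕ) (d : Fin n → ℕ) (q : Fin n → ℕ) : ℝ :=
  ((N + ∑ i, q i).factorial : ℝ) * ∏ i, besselCoeff (d i + 1) (q i)

theorem factorial_add_le (a b : ℕ) :
    ((a + b).factorial : ℝ) ≤ 2 ^ (a + b) * ((a.factorial : ℝ) * (b.factorial : ℝ)) := by
  rw [← Nat.add_choose_mul_factorial_mul_factorial a b]
  push_cast
  rw [mul_assoc]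
  gcongr
  exact_mod_cast Nat.choose_le_two_pow _ _

/-- Iterating (a+b)! ≤ 2^{a+b} a! b! bounds the multinomial coefficient geometrically; the crude
base is harmless because a factorial remains in the denominators later. -/
theorem factorial_sum_le {n : ℕ} (q : Fin n → ℕ) (s : Finset (Fin n)) :
    ((∑ i ∈ s, q i).factorial : ℝ) ≤
      ∏ i ∈ s, ((2 : ℝ) ^ s.card) ^ q i * ((q i).factorial : ℝ) := by
  induction s using Finset.induction_on with
  | empty => simp
  | insert a s ha ih =>
    rw [Finset.sum_insert ha, Finset.prod_insert ha, Finset.card_insert_of_notMem ha]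
    refine (factorial_add_le _ _).trans ?_
    have h1 : ∏ i ∈ s, ((2 : ℝ) ^ (s.card + 1)) ^ q i * ((q i).factorial : ℝ) =
        2 ^ (∑ i ∈ s, q i) * ∏ i ∈ s, ((2 : ℝ) ^ s.card) ^ q i * ((q i).factorial : ℝ) := by
      rw [← Finset.prod_pow_eq_pow_sum, ← Finset.prod_mul_distrib]
      refine Finset.prod_congr rfl fun i _ => ?_
      rw [pow_succ, mul_pow]
      ring
    rw [h1, pow_add]
    have h2 : (2 : ℝ) ^ q a ≤ (2 ^ (s.card + 1)) ^ q a := by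
      rw [← pow_mul]
      exact pow_le_pow_right₀ (by norm_num) (Nat.le_mul_of_pos_left _ (by omega))
    calc (2 : ℝ) ^ q a * 2 ^ (∑ i ∈ s, q i) *
          (((q a).factorial : ℝ) * ((∑ i ∈ s, q i).factorial : ℝ))
        = (2 : ℝ) ^ q a * ((q a).factorial : ℝ) *
          (2 ^ (∑ i ∈ s, q i) * ((∑ i ∈ s, q i).factorial : ℝ)) := by ring
      _ ≤ _ := by gcongr

/-- The numerator (N+|q|)! costs one q_i! for each i and geometric factors, while every Bessel
coefficient supplies two; the series is dominated by a product of exponential series. -/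
theorem mEntire_laplaceCoeff {n : ℕ} (N : ℕ) (d : Fin n → ℕ) : MEntire (laplaceCoeff N d) := by
  intro R hR
  have hs := (hasSum_prod_pi (fun (_ : Fin n) p => (2 * 2 ^ n * R) ^ p / (p.factorial : ℝ))
    fun i => (Real.summable_pow_div_factorial _).norm).2.of_norm
  refine Summable.of_nonneg_of_le (fun q => by positivity) (fun q => ?_)
    (hs.mul_left (2 ^ N * (N.factorial : ℝ)))
  rw [laplaceCoeff, abs_mul, Nat.abs_cast, Finset.abs_prod]
  have h1 := factorial_add_le N (∑ i, q i)
  have h2 := factorial_sum_le q Finset.univ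
  rw [Finset.card_fin] at h2
  have h3 : ∏ i, |besselCoeff (d i + 1) (q i)| ≤
      ∏ i, (1 / ((q i).factorial : ℝ)) * (1 / ((q i).factorial : ℝ)) := by
    refine Finset.prod_le_prod (fun i _ => abs_nonneg _) fun i _ => ?_
    rw [abs_besselCoeff, one_div_mul_one_div]
    have : (q i).factorial ≤ (q i + (d i + 1)).factorial := Nat.factorial_le (by omega)
    gcongr
  calc ((N + ∑ i, q i).factorial : ℝ) * (∏ i, |besselCoeff (d i + 1) (q i)|) * R ^ ∑ i, q i
      ≤ 2 ^ (N + ∑ i, q i) * ((N.factorial : ℝ) *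
          ∏ i, (((2 : ℝ) ^ n) ^ q i * ((q i).factorial : ℝ))) *
        (∏ i, (1 / ((q i).factorial : ℝ)) * (1 / ((q i).factorial : ℝ))) * R ^ ∑ i, q i := by
        gcongr
        refine h1.trans ?_
        gcongr
    _ = 2 ^ N * (N.factorial : ℝ) * ∏ i, (2 * 2 ^ n * R) ^ q i / ((q i).factorial : ℝ) := by
        rw [pow_add, ← Finset.prod_pow_eq_pow_sum, ← Finset.prod_pow_eq_pow_sum]
        have : ∏ i, (2 * 2 ^ n * R) ^ q i / ((q i).factorial : ℝ) =
            (∏ i, (2 : ℝ) ^ q i) * (∏ i, (((2 : ℝ) ^ n) ^ q i * ((q i).factorial : ℝ))) *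
            (∏ i, (1 / ((q i).factorial : ℝ)) * (1 / ((q i).factorial : ℝ))) * ∏ i, R ^ q i := by
          rw [← Finset.prod_mul_distrib, ← Finset.prod_mul_distrib, ← Finset.prod_mul_distrib]
          refine Finset.prod_congr rfl fun i _ => ?_
          rw [mul_pow, mul_pow]
          field_simp
        rw [this]
        ring

theorem integrableOn_exp_neg_mul_pow (k : ℕ) {η : ℝ} (hη : 0 < η) :
    IntegrableOn (fun y : ℝ => Real.exp (-(η * y)) * y ^ k) (Set.Ioi 0) := by
  have h := integrableOn_rpow_mul_exp_neg_mul_rpow (p := 1) (s := k) (b := η)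
    (by have : (0 : ℝ) ≤ k := by positivity
        linarith) one_pos hη
  refine h.congr_fun (fun y _ => ?_) measurableSet_Ioi
  simp only [Real.rpow_natCast, Real.rpow_one]
  rw [neg_mul, mul_comm]

theorem integral_exp_neg_mul_pow (k : ℕ) :
    ∫ y in Set.Ioi (0 : ℝ), Real.exp (-y) * y ^ k = (k.factorial : ℝ) := by
  rw [← Real.Gamma_nat_eq_factorial, Real.Gamma_eq_integral (by positivity)]
  simp

theorem integrableOn_exp_neg_mul_pow' (k : ℕ) :
    IntegrableOn (fun y : ℝ => Real.exp (-y) * y ^ k) (Set.Ioi 0) := by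
  simpa using integrableOn_exp_neg_mul_pow k one_pos

/-- Expand the product and use ∫ e^{-y} y^{N+|q|} dy = (N+|q|)!. The L¹ norms of the terms are the
absolute values of the terms of an everywhere convergent series, which justifies the interchange for
every real x. -/
theorem integral_besselG_prod {n : ℕ} (N : ℕ) (d : Fin n → ℕ) (x : Fin n → ℝ) :
    ∫ y in Set.Ioi (0 : ℝ), Real.exp (-y) * y ^ N * ∏ i, besselG (d i + 1) (y * x i) =
      mSum (laplaceCoeff N d) x := by
  set F : (Fin n → ℕ) → ℝ → ℝ := fun q y =>
    (Real.exp (-y) * y ^ (N + ∑ i, q i)) * ∏ i, besselCoeff (d i + 1) (q i) * x i ^ q i with hF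
  have hI : ∀ q, Integrable (F q) (volume.restrict (Set.Ioi 0)) := fun q =>
    (integrableOn_exp_neg_mul_pow' _).mul_const _
  have hval : ∀ q, ∫ y in Set.Ioi (0 : ℝ), F q y = laplaceCoeff N d q * ∏ i, x i ^ q i :=
    fun q => by
    simp only [hF]
    rw [integral_mul_const, integral_exp_neg_mul_pow, laplaceCoeff, Finset.prod_mul_distrib]
    ring
  have hnorm : ∀ q, ∫ y in Set.Ioi (0 : ℝ), ‖F q y‖ = |laplaceCoeff N d q * ∏ i, x i ^ q i| :=
    fun q => by
    have : Set.EqOn (fun y => ‖F q y‖) (fun y => (Real.exp (-y) * y ^ (N + ∑ i, q i)) *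
        |∏ i, besselCoeff (d i + 1) (q i) * x i ^ q i|) (Set.Ioi 0) := fun y hy => by
      have hy' : (0 : ℝ) < y := hy
      simp only [hF]
      rw [norm_mul, Real.norm_of_nonneg (by positivity), Real.norm_eq_abs]
    rw [setIntegral_congr_fun measurableSet_Ioi this, integral_mul_const, integral_exp_neg_mul_pow,
      laplaceCoeff, Finset.prod_mul_distrib, abs_mul, abs_mul, abs_mul, Nat.abs_cast, mul_assoc]
  have h := hasSum_integral_of_summable_integral_norm hI
    (((mEntire_laplaceCoeff N d).summable_abs x).congr fun q => (hnorm q).symm)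
  rw [mSum, ← tsum_congr hval, h.tsum_eq]
  congr 1
  funext y
  have h2 := (hasSum_prod_pi (fun i p => besselCoeff (d i + 1) p * (y * x i) ^ p) fun i =>
    ((entireCoeff_besselCoeff (d i + 1)).summable (y * x i)).norm).1
  have h3 := h2.mul_left (Real.exp (-y) * y ^ N)
  refine h3.tsum_eq.symm.trans (tsum_congr fun q => ?_)
  simp only [hF, mul_pow, Finset.prod_mul_distrib, pow_add, Finset.prod_pow_eq_pow_sum]
  ring

theorem integrableOn_besselG_prod {n : ℕ} (N : ℕ) (d : Fin n → ℕ) {x : Fin n → ℝ}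
    (hx : ∀ i, 0 ≤ x i) :
    IntegrableOn (fun y => Real.exp (-y) * y ^ N * ∏ i, besselG (d i + 1) (y * x i))
      (Set.Ioi 0) := by
  refine Integrable.mul_bdd (c := ∏ i : Fin n, 1 / ((d i + 1).factorial : ℝ))
    (integrableOn_exp_neg_mul_pow' N) ?_ ?_
  · refine (continuous_finsetProd _ fun i _ => ?_).aestronglyMeasurable
    exact (continuous_besselG _).comp (continuous_id.mul continuous_const)
  · filter_upwards [ae_restrict_mem measurableSet_Ioi] with y hy
    have hy' : (0 : ℝ) < y := hy
    rw [Real.norm_eq_abs, Finset.abs_prod]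
    exact Finset.prod_le_prod (fun i _ => abs_nonneg _) fun i _ =>
      abs_besselG_le _ (mul_nonneg hy'.le (hx i))

/-- Grouping by total degree p, the binomial coefficient times p! is (M+n+p)!/(M+n)!, and the sign
(-1)^p splits over the Bessel coefficients. -/
theorem sum_mem_antidiagonalTuple {n p : ℕ} (x : Fin n → ℝ) (M : ℕ) (d : Fin n → ℕ) :
    rhoTerm M d x p = ∑ q : Finset.Nat.antidiagonalTuple n p,
      (((M + n).factorial : ℝ)⁻¹ * laplaceCoeff (M + n) d q) * ∏ i, x i ^ (q : Fin n → ℕ) i := by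
  rw [rhoTerm, Finset.mul_sum, ← Finset.sum_coe_sort]
  refine Finset.sum_congr rfl fun q _ => ?_
  obtain ⟨q, hq⟩ := q
  have hq' := Finset.Nat.mem_antidiagonalTuple.1 hq
  subst hq'
  have h1 := Nat.add_choose_mul_factorial_mul_factorial (M + n) (∑ i, q i)
  have h2 : (((M + n + ∑ i, q i).choose (∑ i, q i) : ℕ) : ℝ) * ((∑ i, q i).factorial : ℝ) =
      ((M + n).factorial : ℝ)⁻¹ * ((M + n + ∑ i, q i).factorial : ℝ) := by
    rw [← h1]
    push_cast
    field_simp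
  have h3 : ∏ i, x i ^ q i / (((q i).factorial : ℝ) * ((d i + 1 + q i).factorial : ℝ)) =
      (-1) ^ (∑ i, q i) * ((∏ i, besselCoeff (d i + 1) (q i)) * ∏ i, x i ^ q i) := by
    rw [← Finset.prod_mul_distrib, ← Finset.prod_pow_eq_pow_sum, ← Finset.prod_mul_distrib]
    refine Finset.prod_congr rfl fun i _ => ?_
    have : ((-1 : ℝ) ^ q i) * (-1) ^ q i = 1 := by rw [← mul_pow]; simp
    rw [besselCoeff, add_comm (q i)]
    linear_combination (-(x i ^ q i) / (((q i).factorial : ℝ) * ((d i + 1 + q i).factorial : ℝ))) *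
      this
  have h4 : ((-1 : ℝ) ^ ∑ i, q i) * (-1) ^ ∑ i, q i = 1 := by rw [← mul_pow]; simp
  simp only
  rw [h3, laplaceCoeff, mul_assoc ((-1) ^ _), h2]
  linear_combination (((M + n).factorial : ℝ)⁻¹ * ((M + n + ∑ i, q i).factorial : ℝ) *
    ((∏ i, besselCoeff (d i + 1) (q i)) * ∏ i, x i ^ q i)) * h4

theorem hasSum_rhoTerm {n : ℕ} (M : ℕ) (d : Fin n → ℕ) (x : Fin n → ℝ) :
    HasSum (rhoTerm M d x) (((M + n).factorial : ℝ)⁻¹ * mSum (laplaceCoeff (M + n) d) x) := by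
  have h := ((mEntire_laplaceCoeff (M + n) d).summable x).hasSum.mul_left
    ((M + n).factorial : ℝ)⁻¹
  rw [← (Finset.Nat.sigmaAntidiagonalTupleEquivTuple n).hasSum_iff] at h
  refine h.sigma fun p => ?_
  rw [sum_mem_antidiagonalTuple]
  convert hasSum_fintype _ using 2
  simp [Finset.Nat.sigmaAntidiagonalTupleEquivTuple, mul_assoc]

theorem rhoSeries_eq {n : ℕ} (M : ℕ) (d : Fin n → ℕ) :
    rhoSeries M d = mSum fun q => ((M + n).factorial : ℝ)⁻¹ * laplaceCoeff (M + n) d q := by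
  funext x
  rw [rhoSeries, (hasSum_rhoTerm M d x).tsum_eq, mSum, mSum, ← tsum_mul_left]
  simp only [mul_assoc]

theorem MEntire.const_mul {n : ℕ} {a : (Fin n → ℕ) → ℝ} (ha : MEntire a) (c : ℝ) :
    MEntire fun q => c * a q := fun R hR =>
  ((ha R hR).mul_left |c|).congr fun q => by rw [abs_mul, mul_assoc]

theorem rho_eq {n : ℕ} (M : ℕ) (d : Fin n → ℕ) {x : Fin n → ℝ} (hx : ∀ i, 0 < x i) :
    rho M d x =
      ∫ y in Set.Ioi (0 : ℝ), Real.exp (-y) * y ^ (M + n) * ∏ i, besselG (d i + 1) (y * x i) :=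
  setIntegral_congr_fun measurableSet_Ioi fun _ hy => rhoIntegrand_eq M d hx hy

theorem integrableOn_rhoIntegrand {n : ℕ} (M : ℕ) (d : Fin n → ℕ) {x : Fin n → ℝ}
    (hx : ∀ i, 0 < x i) : IntegrableOn (rhoIntegrand M d x) (Set.Ioi 0) :=
  (integrableOn_besselG_prod (M + n) d fun i => (hx i).le).congr_fun
    (fun _ hy => (rhoIntegrand_eq M d hx hy).symm) measurableSet_Ioi

theorem rho_eq_rhoSeries {n : ℕ} (M : ℕ) (d : Fin n → ℕ) {x : Fin n → ℝ} (hx : ∀ i, 0 < x i) :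
    rho M d x = ((M + n).factorial : ℝ) * rhoSeries M d x := by
  rw [rho_eq M d hx, integral_besselG_prod, rhoSeries, (hasSum_rhoTerm M d x).tsum_eq]
  field_simp

/-- The left side is the coefficient of D_k and the right side that of -D_0. The right side is the
same for all k, which gives both families of differential equations. -/
theorem laplaceCoeff_add_single {n : ℕ} (N : ℕ) (d : Fin n → ℕ) (k : Fin n) (q : Fin n → ℕ) :
    ((q k : ℝ) + 1) * ((q k : ℝ) + d k + 2) * laplaceCoeff N d (q + Pi.single k 1) =
      -((N : ℝ) + ∑ i, (q i : ℝ) + 1) * laplaceCoeff N d q := by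
  have h1 : ∏ i, besselCoeff (d i + 1) ((q + Pi.single k 1 : Fin n → ℕ) i) =
      besselCoeff (d k + 1) (q k + 1) * ∏ i ∈ Finset.univ.erase k, besselCoeff (d i + 1) (q i) := by
    rw [← Finset.mul_prod_erase _ _ (Finset.mem_univ k)]
    congr 1
    · simp
    · exact Finset.prod_congr rfl fun i hi => by simp [(Finset.mem_erase.1 hi).1]
  have h2 : ((q k : ℝ) + 1) * ((q k : ℝ) + d k + 2) * besselCoeff (d k + 1) (q k + 1) =
      -besselCoeff (d k + 1) (q k) := by
    rw [besselCoeff, besselCoeff, show q k + 1 + (d k + 1) = (q k + (d k + 1)) + 1 by ring,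
      Nat.factorial_succ, Nat.factorial_succ]
    push_cast
    field_simp
    ring
  have h3 : ((N + ∑ i, (q + Pi.single k 1 : Fin n → ℕ) i).factorial : ℝ) =
      ((N : ℝ) + ∑ i, (q i : ℝ) + 1) * ((N + ∑ i, q i).factorial : ℝ) := by
    rw [sum_add_single, ← add_assoc, Nat.factorial_succ]
    push_cast
    ring
  rw [laplaceCoeff, laplaceCoeff, h1, h3, ← Finset.mul_prod_erase _ _ (Finset.mem_univ k)]
  linear_combination ((N : ℝ) + ∑ i, (q i : ℝ) + 1) * ((N + ∑ i, q i).factorial : ℝ) *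
    (∏ i ∈ Finset.univ.erase k, besselCoeff (d i + 1) (q i)) * h2

theorem summable_mul_index {n : ℕ} {a : (Fin n → ℕ) → ℝ} (ha : MEntire a) (x : Fin n → ℝ)
    (k : Fin n) : Summable fun q : Fin n → ℕ => ((q k : ℝ) * a q) * ∏ i, x i ^ q i := by
  refine summable_of_shift k (fun q hq => by simp [hq])
    ((((ha.shift k).summable x).mul_left (x k)).congr fun q => ?_)
  rw [prod_pow_add_single, mShift]
  simp
  ring

theorem opD_mSum {n : ℕ} (d : Fin n → ℕ) (k : Fin n) {a : (Fin n → ℕ) → ℝ} (ha : MEntire a)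
    (x : Fin n → ℝ) :
    opD d k (mSum a) x =
      mSum (fun q => ((q k : ℝ) + 1) * ((q k : ℝ) + d k + 2) * a (q + Pi.single k 1)) x := by
  have hA := ha.shift k
  have hB := hA.shift k
  have e : x k * mSum (mShift k (mShift k a)) x = mSum (fun q => (q k : ℝ) * mShift k a q) x :=
    mul_mSum_shift _ _ _
  have hs := summable_mul_index hA x k
  rw [opD, pd_mSum ha, pd_mSum hA, e, mSum, mSum, mSum, ← tsum_mul_left,
    ← hs.tsum_add ((hA.summable x).mul_left _)]
  refine tsum_congr fun q => ?_
  simp only [mShift]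
  ring

theorem opD0_mSum {n : ℕ} (M : ℕ) {a : (Fin n → ℕ) → ℝ} (ha : MEntire a)
    (x : Fin n → ℝ) :
    opD0 M (mSum a) x =
      mSum (fun q => ((M : ℝ) + n + ∑ i, (q i : ℝ) + 1) * a q) x := by
  have hs := summable_mul_index ha x
  have e : ∀ k, x k * pd k (mSum a) x = ∑' q : Fin n → ℕ, ((q k : ℝ) * a q) * ∏ i, x i ^ q i :=
    fun k => by rw [pd_mSum ha, mul_mSum_shift, mSum]
  rw [opD0, Finset.sum_congr rfl fun k _ => e k, ← Summable.tsum_finsetSum fun k _ => hs k, mSum,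
    ← tsum_mul_left, ← (summable_sum fun k _ => hs k).tsum_add ((ha.summable x).mul_left _), mSum]
  refine tsum_congr fun q => ?_
  simp only [mul_assoc]
  rw [← Finset.sum_mul]
  ring

theorem opD_rhoSeries {n : ℕ} (M : ℕ) (d : Fin n → ℕ) (x : Fin n → ℝ) (k : Fin n) :
    opD d k (rhoSeries M d) x = -opD0 M (rhoSeries M d) x := by
  have hm := (mEntire_laplaceCoeff (M + n) d).const_mul ((M + n).factorial : ℝ)⁻¹
  rw [rhoSeries_eq, opD_mSum d k hm, opD0_mSum M hm x, mSum, mSum,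
    ← tsum_neg]
  refine tsum_congr fun q => ?_
  have := laplaceCoeff_add_single (M + n) d k q
  push_cast at this
  linear_combination (((M + n).factorial : ℝ)⁻¹ * ∏ i, x i ^ q i) * this

/-! ### One spin: Laguerre polynomials -/

theorem iterate_derivCoeff (c : ℕ → ℝ) (k p : ℕ) :
    derivCoeff^[k] c p = ((p + k).factorial : ℝ) / (p.factorial : ℝ) * c (p + k) := by
  induction k generalizing p with
  | zero =>
    have : (p.factorial : ℝ) ≠ 0 := by positivity
    simp [this]
  | succ k ih =>
    rw [Function.iterate_succ_apply', derivCoeff, ih, show p + 1 + k = p + (k + 1) by ring,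
      Nat.factorial_succ p]
    push_cast
    field_simp

theorem iteratedDeriv_powerSum {c : ℕ → ℝ} (hc : EntireCoeff c) (k : ℕ) :
    iteratedDeriv k (powerSum c) = powerSum (derivCoeff^[k] c) ∧
      EntireCoeff (derivCoeff^[k] c) := by
  induction k with
  | zero => exact ⟨iteratedDeriv_zero, hc⟩
  | succ k ih =>
    rw [iteratedDeriv_succ, ih.1, Function.iterate_succ_apply']
    exact ⟨funext fun x => (hasDerivAt_powerSum ih.2 x).deriv, ih.2.derivCoeff⟩

/-- Power series coefficients of `e^{-t} t^m`. -/
noncomputable def expPowCoeff (m p : ℕ) : ℝ :=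
  if p < m then 0 else (-1) ^ (p - m) / ((p - m).factorial : ℝ)

theorem entireCoeff_expPowCoeff (m : ℕ) : EntireCoeff (expPowCoeff m) := by
  intro R hR
  refine (summable_nat_add_iff m).1 ?_
  refine ((Real.summable_pow_div_factorial R).mul_right (R ^ m)).congr fun p => ?_
  rw [expPowCoeff, if_neg (by omega), Nat.add_sub_cancel, abs_div, abs_pow, abs_neg, abs_one,
    one_pow, Nat.abs_cast, pow_add]
  ring

theorem powerSum_expPowCoeff (m : ℕ) :
    powerSum (expPowCoeff m) = fun t => Real.exp (-t) * t ^ m := by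
  funext t
  have h := (entireCoeff_expPowCoeff m).summable t
  rw [powerSum, ← h.sum_add_tsum_nat_add m, Finset.sum_eq_zero, zero_add, Real.exp_eq_exp_ℝ,
    NormedSpace.exp_eq_tsum_div, ← tsum_mul_right]
  · refine tsum_congr fun p => ?_
    rw [expPowCoeff, if_neg (by omega), Nat.add_sub_cancel, pow_add, neg_pow]
    ring
  · intro p hp
    rw [expPowCoeff, if_pos (Finset.mem_range.1 hp), zero_mul]

theorem mSum_one (a : (Fin 1 → ℕ) → ℝ) (x : ℝ) :
    mSum a (fun _ => x) = powerSum (fun p => a fun _ => p) x := by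
  rw [mSum, powerSum, ← (Equiv.funUnique (Fin 1) ℕ).symm.tsum_eq]
  refine tsum_congr fun p => ?_
  have : (Equiv.funUnique (Fin 1) ℕ).symm p = fun _ => p := rfl
  rw [this]
  simp

/-- Both sides are entire power series in x and agree coefficient by coefficient. The M + 1
derivatives exceed the vanishing order M - r at 0, so no coefficient falls in the zero range of
`expPowCoeff`. -/
theorem rho_one_eq_iteratedDeriv {M r : ℕ} (hr : r ≤ M) {x : ℝ} (hx : 0 < x) :
    rho M (fun _ : Fin 1 => r) (fun _ => x) = (-1 : ℝ) ^ (r + 1) *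
      iteratedDeriv (M + 1) (fun t : ℝ => Real.exp (-t) * t ^ (M - r)) x := by
  rw [rho_eq M _ fun _ => hx, integral_besselG_prod, mSum_one, ← powerSum_expPowCoeff,
    (iteratedDeriv_powerSum (entireCoeff_expPowCoeff (M - r)) (M + 1)).1, powerSum, powerSum,
    ← tsum_mul_left]
  refine tsum_congr fun p => ?_
  have e1 : p + (M + 1) - (M - r) = p + (r + 1) := by omega
  rw [iterate_derivCoeff, expPowCoeff, if_neg (by omega), e1, laplaceCoeff]
  simp only [Finset.univ_unique, Finset.sum_const, Finset.card_singleton, one_smul,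
    Finset.prod_const, pow_one, besselCoeff]
  have h4 : ((-1 : ℝ) ^ (r + 1)) * (-1) ^ (r + 1) = 1 := by rw [← mul_pow]; simp
  rw [pow_add (-1 : ℝ) p, add_comm (M + 1) p]
  field_simp
  linear_combination (-1 : ℝ) * h4

theorem iteratedDeriv_exp_neg (k : ℕ) (x : ℝ) :
    iteratedDeriv k (fun t : ℝ => Real.exp (-t)) x = (-1) ^ k * Real.exp (-x) := by
  rw [iteratedDeriv_comp_neg k Real.exp, iteratedDeriv_eq_iterate, Real.iter_deriv_exp, smul_eq_mul]

theorem iteratedDeriv_exp_mul_pow {M r : ℕ} (hr : r ≤ M) (x : ℝ) :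
    (-1 : ℝ) ^ (r + 1) * iteratedDeriv (M + 1) (fun t : ℝ => Real.exp (-t) * t ^ (M - r)) x =
      ((M - r).factorial : ℝ) * (Real.exp (-x) * (laguerre (r + 1) (M - r)).eval x) := by
  rw [iteratedDeriv_fun_mul (by fun_prop) (by fun_prop)]
  simp only [iteratedDeriv_exp_neg, iteratedDeriv_pow]
  obtain ⟨m, rfl⟩ := Nat.exists_eq_add_of_le hr
  -- In the Leibniz sum the first r + 1 terms put more than m derivatives on t^m and vanish; the
  -- remaining ones are indexed by j ≤ m.
  rw [Nat.add_sub_cancel_left, show r + m + 1 + 1 = (r + 1) + (m + 1) by ring,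
    Finset.sum_range_add, Finset.sum_eq_zero, zero_add, laguerre, Polynomial.eval_finsetSum,
    Finset.mul_sum, Finset.mul_sum, Finset.mul_sum]
  · refine Finset.sum_congr rfl fun j hj => ?_
    have hj : j ≤ m := by
      have := Finset.mem_range.1 hj
      omega
    have e1 : r + m + 1 - (r + 1 + j) = m - j := by omega
    have e2 : m - (m - j) = j := by omega
    have e3 : (r + m + 1).choose (r + 1 + j) = (m + (r + 1)).choose (m - j) := by
      rw [← Nat.choose_symm (by omega : m - j ≤ m + (r + 1)),
        show m + (r + 1) - (m - j) = r + 1 + j by omega]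
      congr 1
      ring
    have e4 : (m.descFactorial (m - j) : ℝ) = (m.factorial : ℝ) / (j.factorial : ℝ) := by
      rw [eq_div_iff (by positivity)]
      have := Nat.factorial_mul_descFactorial (Nat.sub_le m j)
      rw [e2] at this
      rw [mul_comm]
      exact_mod_cast this
    have h4 : ((-1 : ℝ) ^ (r + 1)) * (-1) ^ (r + 1) = 1 := by rw [← mul_pow]; simp
    rw [e1, e2, e3, e4, pow_add]
    simp only [Polynomial.eval_mul, Polynomial.eval_C, Polynomial.eval_pow, Polynomial.eval_X]
    linear_combination (((m + (r + 1)).choose (m - j) : ℝ) * (-1) ^ j * Real.exp (-x) *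
      ((m.factorial : ℝ) / (j.factorial : ℝ)) * x ^ j) * h4
  · intro i hi
    rw [Nat.descFactorial_of_lt (by
      have := Finset.mem_range.1 hi
      omega)]
    simp

theorem natDegree_laguerre (α k : ℕ) : (laguerre α k).natDegree = k := by
  refine Polynomial.natDegree_eq_of_le_of_coeff_ne_zero ?_ ?_
  · refine Polynomial.natDegree_sum_le_of_forall_le _ _ fun i hi => ?_
    refine (Polynomial.natDegree_C_mul_X_pow_le _ _).trans ?_
    have := Finset.mem_range.1 hi
    omega
  · rw [laguerre, Polynomial.finsetSum_coeff, Finset.sum_eq_single k]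
    · rw [Polynomial.coeff_C_mul_X_pow, if_pos rfl]
      simp [Nat.factorial_ne_zero]
    · intro i _ hi
      rw [Polynomial.coeff_C_mul_X_pow, if_neg hi.symm]
    · simp

/-! ### Laplace transforms of the entire Bessel functions -/

/-- The Laplace transform of `x ^ α * besselG k x`. -/
noncomputable def laplaceG (α k : ℕ) (η : ℝ) : ℝ :=
  ∫ x in Set.Ioi (0 : ℝ), Real.exp (-(η * x)) * x ^ α * besselG k x

theorem integrableOn_laplaceG (α k : ℕ) {η : ℝ} (hη : 0 < η) :
    IntegrableOn (fun x => Real.exp (-(η * x)) * x ^ α * besselG k x) (Set.Ioi 0) := by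
  refine Integrable.mul_bdd (c := 1 / (k.factorial : ℝ)) (integrableOn_exp_neg_mul_pow α hη)
    (continuous_besselG k).aestronglyMeasurable ?_
  filter_upwards [ae_restrict_mem measurableSet_Ioi] with x hx
  exact abs_besselG_le k (le_of_lt hx)

theorem integral_exp_neg_mul_mul_pow (α : ℕ) {η : ℝ} (hη : 0 < η) :
    ∫ x in Set.Ioi (0 : ℝ), Real.exp (-(η * x)) * x ^ α = (α.factorial : ℝ) / η ^ (α + 1) := by
  have h := Real.integral_rpow_mul_exp_neg_mul_Ioi (a := (α : ℝ) + 1) (by positivity) hη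
  rw [Real.Gamma_nat_eq_factorial, add_sub_cancel_right] at h
  simp only [Real.rpow_natCast] at h
  simp_rw [mul_comm (Real.exp _)]
  rw [h]
  have : (1 / η) ^ ((α : ℝ) + 1) = (1 / η) ^ (α + 1) := by
    rw [← Real.rpow_natCast]
    push_cast
    rfl
  rw [this, one_div, inv_pow]
  field_simp

theorem abs_laplaceG_le (α k : ℕ) {η : ℝ} (hη : 0 < η) :
    |laplaceG α k η| ≤ (α.factorial : ℝ) / η ^ (α + 1) := by
  rw [← integral_exp_neg_mul_mul_pow α hη, ← Real.norm_eq_abs]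
  refine norm_integral_le_of_norm_le (integrableOn_exp_neg_mul_pow α hη) ?_
  filter_upwards [ae_restrict_mem measurableSet_Ioi] with x hx
  have hx' : (0 : ℝ) < x := hx
  rw [norm_mul, Real.norm_of_nonneg (by positivity : 0 ≤ Real.exp (-(η * x)) * x ^ α)]
  refine mul_le_of_le_one_right (by positivity) ((abs_besselG_le k hx'.le).trans ?_)
  rw [div_le_one (by positivity)]
  exact_mod_cast Nat.factorial_pos k

/-- Rescaling by y turns the convergence factor δ into δ/y, so that δ → 0+ becomes a limit at the
origin of one fixed function. -/
theorem integral_exp_mul_besselG_mul (α k : ℕ) (δ : ℝ) {y : ℝ} (hy : 0 < y) :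
    ∫ x in Set.Ioi (0 : ℝ), Real.exp (-(δ * x)) * x ^ α * besselG k (y * x) =
      (y ^ (α + 1))⁻¹ * laplaceG α k (δ / y) := by
  have h := integral_comp_mul_left_Ioi
    (fun x => Real.exp (-(δ / y * x)) * x ^ α * besselG k x) 0 hy
  rw [mul_zero, smul_eq_mul] at h
  rw [laplaceG, pow_succ, mul_inv, mul_assoc, ← h, ← integral_const_mul]
  congr 1
  funext x
  have : δ / y * (y * x) = δ * x := by field_simp
  rw [this, mul_pow]
  field_simp

theorem tendsto_exp_mul_pow_mul_besselG (α k : ℕ) {η : ℝ} (hη : 0 < η) :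
    Tendsto (fun x => Real.exp (-(η * x)) * x ^ α * besselG k x) atTop (𝓝 0) := by
  refine squeeze_zero_norm' ?_ (tendsto_rpow_mul_exp_neg_mul_atTop_nhds_zero α η hη)
  filter_upwards [eventually_ge_atTop 0] with x hx
  rw [norm_mul, Real.norm_of_nonneg (by positivity : 0 ≤ Real.exp (-(η * x)) * x ^ α),
    Real.rpow_natCast, neg_mul, mul_comm (x ^ α)]
  refine mul_le_of_le_one_right (by positivity) ((abs_besselG_le k hx).trans ?_)
  rw [div_le_one (by positivity)]
  exact_mod_cast Nat.factorial_pos k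

/-- Integration by parts with G_k' = -G_{k+1}. The boundary value G_k(0) = 1/k! appears only here;
for positive powers of x it is zero. -/
theorem laplaceG_zero_succ (k : ℕ) {η : ℝ} (hη : 0 < η) :
    laplaceG 0 (k + 1) η = 1 / (k.factorial : ℝ) - η * laplaceG 0 k η := by
  have hd : ∀ x ∈ Set.Ici (0 : ℝ), HasDerivAt
      (fun x => Real.exp (-(η * x)) * x ^ 0 * besselG k x)
      (-η * (Real.exp (-(η * x)) * x ^ 0 * besselG k x) -
        Real.exp (-(η * x)) * x ^ 0 * besselG (k + 1) x) x := by
    intro x _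
    have h1 := ((hasDerivAt_id x).const_mul η).neg.exp
    refine ((h1.mul_const (x ^ 0)).mul (hasDerivAt_besselG k x)).congr_deriv ?_
    simp only [id, Pi.neg_apply]
    ring
  have h := integral_Ioi_of_hasDerivAt_of_tendsto' hd
    (((integrableOn_laplaceG 0 k hη).const_mul _).sub (integrableOn_laplaceG 0 (k + 1) hη))
    (tendsto_exp_mul_pow_mul_besselG 0 k hη)
  rw [integral_sub ((integrableOn_laplaceG 0 k hη).const_mul _)
    (integrableOn_laplaceG 0 (k + 1) hη), integral_const_mul] at h
  change -η * laplaceG 0 k η - laplaceG 0 (k + 1) η = _ at h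
  simp [besselG_zero] at h
  rw [one_div]
  linarith

theorem laplaceG_succ_succ (α k : ℕ) {η : ℝ} (hη : 0 < η) :
    laplaceG (α + 1) (k + 1) η =
      ((α : ℝ) + 1) * laplaceG α k η - η * laplaceG (α + 1) k η := by
  have hd : ∀ x ∈ Set.Ici (0 : ℝ), HasDerivAt
      (fun x => Real.exp (-(η * x)) * x ^ (α + 1) * besselG k x)
      (((α : ℝ) + 1) * (Real.exp (-(η * x)) * x ^ α * besselG k x) -
        η * (Real.exp (-(η * x)) * x ^ (α + 1) * besselG k x) -
        Real.exp (-(η * x)) * x ^ (α + 1) * besselG (k + 1) x) x := by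
    intro x _
    have h1 := ((hasDerivAt_id x).const_mul η).neg.exp
    refine ((h1.mul (hasDerivAt_pow (α + 1) x)).mul (hasDerivAt_besselG k x)).congr_deriv ?_
    simp only [id, Pi.neg_apply, Pi.mul_apply, Nat.add_sub_cancel]
    push_cast
    ring
  have i1 := (integrableOn_laplaceG α k hη).const_mul ((α : ℝ) + 1)
  have i2 := (integrableOn_laplaceG (α + 1) k hη).const_mul η
  have i3 := integrableOn_laplaceG (α + 1) (k + 1) hη
  have i12 : IntegrableOn (fun x => ((α : ℝ) + 1) * (Real.exp (-(η * x)) * x ^ α * besselG k x) -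
      η * (Real.exp (-(η * x)) * x ^ (α + 1) * besselG k x)) (Set.Ioi 0) := i1.sub i2
  have h := integral_Ioi_of_hasDerivAt_of_tendsto' hd (i12.sub i3)
    (tendsto_exp_mul_pow_mul_besselG (α + 1) k hη)
  rw [integral_sub i12 i3, integral_sub i1 i2, integral_const_mul,
    integral_const_mul] at h
  change ((α : ℝ) + 1) * laplaceG α k η - η * laplaceG (α + 1) k η -
    laplaceG (α + 1) (k + 1) η = _ at h
  simp at h
  linarith

theorem laplaceG_succ_two (α : ℕ) {η : ℝ} (hη : 0 < η) :
    laplaceG (α + 1) 2 η = laplaceG α 1 η - laplaceG α 0 η := by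
  rw [laplaceG, laplaceG, laplaceG,
    ← integral_sub (integrableOn_laplaceG α 1 hη) (integrableOn_laplaceG α 0 hη)]
  congr 1
  funext x
  have := besselG_recurrence 0 x
  simp only [zero_add, CharP.cast_eq_zero, one_mul] at this
  rw [← mul_sub, ← this]
  ring

/-- With x = 1/η, the one-variable series gives x∫ e^{-t} G_1(xt) dt = 1 - e^{-x}. By scaling the
left side is the transform of G_1, which integration by parts ties to that of G_0. -/
theorem mul_laplaceG_zero_zero {η : ℝ} (hη : 0 < η) :
    η * laplaceG 0 0 η = Real.exp (-(1 / η)) := by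
  set x := 1 / η with hx
  have hx0 : 0 < x := by positivity
  have h1 := integral_besselG_prod (n := 1) 0 (fun _ => 0) (fun _ => x)
  have h2 := integral_exp_mul_besselG_mul 0 1 1 hx0
  have h3 : ∫ y in Set.Ioi (0 : ℝ), Real.exp (-y) * y ^ 0 *
      ∏ i : Fin 1, besselG ((fun _ => 0 : Fin 1 → ℕ) i + 1) (y * (fun _ => x : Fin 1 → ℝ) i) =
      ∫ t in Set.Ioi (0 : ℝ), Real.exp (-(1 * t)) * t ^ 0 * besselG 1 (x * t) := by
    congr 1
    funext t
    simp [mul_comm]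
  have e : 1 / x = η := by rw [hx]; field_simp
  rw [h3, h2, mSum_one, e, zero_add, pow_one] at h1
  have h4 : x * powerSum (fun p => laplaceCoeff 0 (fun _ : Fin 1 => 0) fun _ => p) x =
      1 - Real.exp (-x) := by
    have hs := NormedSpace.expSeries_div_hasSum_exp (-x)
    rw [Real.exp_eq_exp_ℝ, ← hs.tsum_eq, hs.summable.tsum_eq_zero_add, powerSum, ← tsum_mul_left]
    simp only [pow_zero, Nat.factorial_zero, Nat.cast_one, div_one, sub_add_cancel_left]
    rw [← tsum_neg]
    refine tsum_congr fun p => ?_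
    simp only [laplaceCoeff, besselCoeff, Finset.univ_unique, Finset.sum_const,
      Finset.card_singleton, one_smul, Finset.prod_const, pow_one, zero_add]
    rw [neg_pow x, pow_succ, pow_succ x]
    field_simp
  rw [← h1, mul_inv_cancel_left₀ hx0.ne', laplaceG_zero_succ 0 hη] at h4
  simp at h4
  linarith

/-- For α = 0 the transform is e^{-1/η}/η, flat at the origin. A three-term relation in α propagates
flatness; each use divides by η², so the induction must carry all powers m at once. -/
theorem laplaceG_zero_right_le (α : ℕ) :
    ∀ m : ℕ, ∃ C : ℝ, 0 ≤ C ∧ ∀ η : ℝ, 0 < η → η ≤ 1 → |laplaceG α 0 η| ≤ C * η ^ m := by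
  induction α using Nat.strong_induction_on with
  | _ α ih =>
  intro m
  match α, ih with
  | 0, _ =>
    -- The exponent m + 1 pays for the division by η; the constant is the one in t^{m+1}/(m+1)! ≤
    -- e^t at t = 1/η.
    refine ⟨((m + 1).factorial : ℝ), by positivity, fun η hη _ => ?_⟩
    have h1 := mul_laplaceG_zero_zero hη
    have h2 : laplaceG 0 0 η = Real.exp (-(1 / η)) / η := by
      rw [← h1]
      field_simp
    have h3 := Real.pow_div_factorial_le_exp (1 / η) (by positivity) (m + 1)
    rw [h2, Real.exp_neg, abs_of_pos (by positivity), div_le_iff₀ hη]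
    rw [one_div_pow, div_div, one_div] at h3
    calc (Real.exp (1 / η))⁻¹ ≤ ((η ^ (m + 1) * ((m + 1).factorial : ℝ))⁻¹)⁻¹ := by gcongr
      _ = _ := by
        rw [inv_inv]
        ring
  | 1, ih =>
    obtain ⟨C, hC, h⟩ := ih 0 (by omega) (m + 2)
    refine ⟨2 * C, by positivity, fun η hη hη1 => ?_⟩
    -- The recurrence expresses the transform of x G_2 by those of G_1 and G_0, while two
    -- integrations by parts lower its order to 0; equating the two leaves order 0 only.
    have e : η ^ 2 * laplaceG 1 0 η = (η - 1) * laplaceG 0 0 η := by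
      have h1 := laplaceG_succ_two 0 hη
      have h2 := laplaceG_succ_succ 0 1 hη
      have h3 := laplaceG_succ_succ 0 0 hη
      simp at h1 h2 h3
      rw [h2, h3] at h1
      linear_combination h1
    have h4 := h η hη hη1
    have h5 : |η - 1| ≤ 2 := abs_le.2 ⟨by linarith, by linarith⟩
    have h6 : η ^ 2 * |laplaceG 1 0 η| ≤ η ^ 2 * (2 * C * η ^ m) := by
      rw [← abs_of_pos (by positivity : 0 < η ^ 2), ← abs_mul, e, abs_mul,
        abs_of_pos (by positivity : 0 < η ^ 2)]
      calc |η - 1| * |laplaceG 0 0 η| ≤ 2 * (C * η ^ (m + 2)) := by gcongr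
        _ = _ := by ring
    exact le_of_mul_le_mul_left h6 (by positivity)
  | α + 2, ih =>
    obtain ⟨C, hC, h⟩ := ih (α + 1) (by omega) (m + 2)
    obtain ⟨C', hC', h'⟩ := ih α (by omega) (m + 2)
    set K : ℝ := (α : ℝ) + 1 with hK
    have hK0 : 0 ≤ K := by positivity
    refine ⟨K * K * C' + (2 * K + 2) * C, by positivity, fun η hη hη1 => ?_⟩
    -- The same elimination of orders 1 and 2 in general, with K = α + 1.
    have e : η ^ 2 * laplaceG (α + 2) 0 η =
        (K * η + (K + 1) * η - 1) * laplaceG (α + 1) 0 η - K * K * laplaceG α 0 η := by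
      have h1 := laplaceG_succ_two (α + 1) hη
      have h2 := laplaceG_succ_succ (α + 1) 1 hη
      have h3 := laplaceG_succ_succ (α + 1) 0 hη
      have h5 := laplaceG_succ_succ α 0 hη
      simp only [Nat.reduceAdd, Nat.cast_add, Nat.cast_one, add_assoc, zero_add, ← hK] at h1 h2 h3 h5
      rw [h2, h3, h5] at h1
      rw [hK] at h1 ⊢
      linear_combination h1
    have h4 := h η hη hη1
    have h4' := h' η hη hη1
    have h5 : |K * η + (K + 1) * η - 1| ≤ 2 * K + 2 := abs_le.2 ⟨by nlinarith, by nlinarith⟩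
    have h6 : η ^ 2 * |laplaceG (α + 2) 0 η| ≤
        η ^ 2 * ((K * K * C' + (2 * K + 2) * C) * η ^ m) := by
      rw [← abs_of_pos (by positivity : 0 < η ^ 2), ← abs_mul, e,
        abs_of_pos (by positivity : 0 < η ^ 2)]
      refine (abs_sub _ _).trans ?_
      rw [abs_mul, abs_mul, abs_of_nonneg (by positivity : 0 ≤ K * K)]
      calc |K * η + (K + 1) * η - 1| * |laplaceG (α + 1) 0 η| + K * K * |laplaceG α 0 η|
          ≤ (2 * K + 2) * (C * η ^ (m + 2)) + K * K * (C' * η ^ (m + 2)) := by gcongr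
        _ = _ := by ring
    exact le_of_mul_le_mul_left h6 (by positivity)

/-- The limit of `laplaceG α k η` as `η → 0+`. -/
noncomputable def laplaceLim (α k : ℕ) : ℝ :=
  if α < k then (α.factorial : ℝ) / ((k - 1 - α).factorial : ℝ) else 0

theorem laplaceLim_zero_succ (k : ℕ) : laplaceLim 0 (k + 1) = 1 / (k.factorial : ℝ) := by
  simp [laplaceLim]

theorem laplaceLim_succ_succ (α k : ℕ) :
    laplaceLim (α + 1) (k + 1) = ((α : ℝ) + 1) * laplaceLim α k := by
  rw [laplaceLim, laplaceLim]
  by_cases h : α < k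
  · rw [if_pos h, if_pos (by omega), show k + 1 - 1 - (α + 1) = k - 1 - α by omega,
      Nat.factorial_succ]
    push_cast
    ring
  · rw [if_neg h, if_neg (by omega), mul_zero]

/-- Induction on the order k: integration by parts reproduces the recursion of the limits up to η
times a bounded term. Order 0 is the flat case, with limit 0. -/
theorem abs_laplaceG_sub_le (k : ℕ) : ∀ α : ℕ,
    ∃ C : ℝ, 0 ≤ C ∧ ∀ η : ℝ, 0 < η → η ≤ 1 → |laplaceG α k η - laplaceLim α k| ≤ C * η := by
  induction k with
  | zero =>
    intro α
    simpa [laplaceLim] using laplaceG_zero_right_le α 1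
  | succ k ih =>
    intro α
    obtain ⟨C, hC, h⟩ := ih α
    have hL : ∀ η : ℝ, 0 < η → η ≤ 1 → |laplaceG α k η| ≤ C + |laplaceLim α k| := by
      intro η hη hη1
      have h1 := h η hη hη1
      have h2 : C * η ≤ C := mul_le_of_le_one_right hC hη1
      calc |laplaceG α k η| = |(laplaceG α k η - laplaceLim α k) + laplaceLim α k| := by ring_nf
        _ ≤ _ := (abs_add_le _ _).trans (by linarith)
    match α with
    | 0 =>
      refine ⟨C + |laplaceLim 0 k|, by positivity, fun η hη hη1 => ?_⟩
      rw [laplaceG_zero_succ k hη, laplaceLim_zero_succ, sub_sub_cancel_left, abs_neg, abs_mul,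
        abs_of_pos hη, mul_comm]
      exact mul_le_mul_of_nonneg_right (hL η hη hη1) hη.le
    | α + 1 =>
      obtain ⟨C', hC', h'⟩ := ih α
      refine ⟨((α : ℝ) + 1) * C' + (C + |laplaceLim (α + 1) k|), by positivity,
        fun η hη hη1 => ?_⟩
      rw [laplaceG_succ_succ α k hη, laplaceLim_succ_succ]
      have e : ((α : ℝ) + 1) * laplaceG α k η - η * laplaceG (α + 1) k η -
          ((α : ℝ) + 1) * laplaceLim α k =
          ((α : ℝ) + 1) * (laplaceG α k η - laplaceLim α k) - η * laplaceG (α + 1) k η := by ring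
      rw [e]
      refine (abs_sub _ _).trans ?_
      rw [abs_mul, abs_mul, abs_of_pos hη, abs_of_nonneg (by positivity : 0 ≤ (α : ℝ) + 1)]
      calc ((α : ℝ) + 1) * |laplaceG α k η - laplaceLim α k| + η * |laplaceG (α + 1) k η|
          ≤ ((α : ℝ) + 1) * (C' * η) + η * (C + |laplaceLim (α + 1) k|) := by
            gcongr
            · exact h' η hη hη1
            · exact hL η hη hη1
        _ = _ := by ring

theorem tendsto_laplaceG (α k : ℕ) :
    Tendsto (laplaceG α k) (𝓝[>] 0) (𝓝 (laplaceLim α k)) := by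
  obtain ⟨C, hC, h⟩ := abs_laplaceG_sub_le k α
  rw [tendsto_iff_norm_sub_tendsto_zero]
  have h0 : Tendsto (fun η : ℝ => C * η) (𝓝[>] 0) (𝓝 0) := by
    have : Tendsto (fun η : ℝ => C * η) (𝓝 0) (𝓝 (C * 0)) := tendsto_id.const_mul C
    rw [mul_zero] at this
    exact this.mono_left nhdsWithin_le_nhds
  refine squeeze_zero' (Eventually.of_forall fun _ => norm_nonneg _) ?_ h0
  filter_upwards [Ioc_mem_nhdsGT (zero_lt_one' ℝ)] with η hη
  exact h η hη.1 hη.2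

/-- The bound must be uniform in all η > 0, because η = δ/y runs over the whole half-line under the
y-integral: the linear estimate serves η ≤ 1, the trivial one η ≥ 1. -/
theorem exists_abs_laplaceG_le (α k : ℕ) :
    ∃ C : ℝ, 0 ≤ C ∧ ∀ η : ℝ, 0 < η → |laplaceG α k η| ≤ C := by
  obtain ⟨C, hC, h⟩ := abs_laplaceG_sub_le k α
  refine ⟨C + |laplaceLim α k| + (α.factorial : ℝ), by positivity, fun η hη => ?_⟩
  rcases le_total η 1 with h1 | h1
  · have h2 := h η hη h1
    have h3 : C * η ≤ C := mul_le_of_le_one_right hC h1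
    have h4 : (0 : ℝ) ≤ (α.factorial : ℝ) := by positivity
    calc |laplaceG α k η| = |(laplaceG α k η - laplaceLim α k) + laplaceLim α k| := by ring_nf
      _ ≤ _ := (abs_add_le _ _).trans (by linarith)
  · refine (abs_laplaceG_le α k hη).trans ?_
    have h2 : (α.factorial : ℝ) / η ^ (α + 1) ≤ (α.factorial : ℝ) :=
      div_le_self (by positivity) (one_le_pow₀ h1)
    have := abs_nonneg (laplaceLim α k)
    linarith

/-! ### Radial integrals over the complex plane -/

theorem integral_exp_int_mul_I {a b : ℕ} (h : a ≠ b) :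
    ∫ θ in Set.Ioo (-Real.pi) Real.pi, Complex.exp (((b : ℂ) - (a : ℂ)) * Complex.I * (θ : ℂ)) =
      0 := by
  have hc : ((b : ℂ) - (a : ℂ)) * Complex.I ≠ 0 := by
    refine mul_ne_zero (sub_ne_zero.2 ?_) Complex.I_ne_zero
    exact_mod_cast h.symm
  rw [← integral_Ioc_eq_integral_Ioo,
    ← intervalIntegral.integral_of_le (by linarith [Real.pi_pos]), integral_exp_mul_complex hc]
  rw [div_eq_zero_iff]
  left
  rw [sub_eq_zero, Complex.exp_eq_exp_iff_exists_int]
  refine ⟨(b : ℤ) - a, ?_⟩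
  push_cast
  ring

theorem integral_Ioi_mul_comp_sq (f : ℝ → ℝ) :
    ∫ r in Set.Ioi (0 : ℝ), r * f (r ^ 2) = 1 / 2 * ∫ x in Set.Ioi (0 : ℝ), f x := by
  rw [← integral_comp_rpow_Ioi_of_pos (g := f) (two_pos), ← integral_const_mul]
  congr 1
  funext r
  have : (2 : ℝ) - 1 = 1 := by norm_num
  rw [this, Real.rpow_one, Real.rpow_two, smul_eq_mul]
  ring

/-- In polar coordinates the angular integral selects a = b, and x = r² handles the radial one. No
integrability is assumed, since the product formula for integrals holds unconditionally. -/
theorem integral_radial_mul (φ : ℝ → ℝ) (a b : ℕ) :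
    ∫ z : ℂ, ((φ (‖z‖ ^ 2) : ℝ) : ℂ) * ((starRingEnd ℂ) z ^ a * z ^ b) =
      if a = b then ((Real.pi * ∫ x in Set.Ioi (0 : ℝ), φ x * x ^ a : ℝ) : ℂ) else 0 := by
  rw [← Complex.integral_comp_polarCoord_symm, polarCoord_target, Measure.volume_eq_prod]
  have hpt : ∀ p ∈ Set.Ioi (0 : ℝ) ×ˢ Set.Ioo (-Real.pi) Real.pi,
      p.1 • (((φ (‖Complex.polarCoord.symm p‖ ^ 2) : ℝ) : ℂ) *
        ((starRingEnd ℂ) (Complex.polarCoord.symm p) ^ a * (Complex.polarCoord.symm p) ^ b)) =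
      ((p.1 * (φ (p.1 ^ 2) * p.1 ^ (a + b)) : ℝ) : ℂ) *
        Complex.exp (((b : ℂ) - (a : ℂ)) * Complex.I * ((p.2 : ℝ) : ℂ)) := by
    rintro ⟨r, θ⟩ hp
    have hr : 0 < r := hp.1
    have e1 : (Complex.polarCoord.symm (r, θ) : ℂ) = r * Complex.exp (θ * Complex.I) := by
      rw [Complex.polarCoord_symm_apply, Complex.exp_mul_I, Complex.ofReal_cos, Complex.ofReal_sin]
    have e2 : ‖(Complex.polarCoord.symm (r, θ) : ℂ)‖ = r := by
      rw [e1, norm_mul, Complex.norm_exp_ofReal_mul_I, mul_one, Complex.norm_real,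
        Real.norm_of_nonneg hr.le]
    have e3 : (starRingEnd ℂ) (r * Complex.exp (θ * Complex.I)) =
        r * Complex.exp (-(θ * Complex.I)) := by
      rw [map_mul, Complex.conj_ofReal, ← Complex.exp_conj, map_mul, Complex.conj_ofReal,
        Complex.conj_I, mul_neg]
    have e4 : Complex.exp (((b : ℂ) - (a : ℂ)) * Complex.I * (θ : ℂ)) =
        Complex.exp (-(θ * Complex.I)) ^ a * Complex.exp (θ * Complex.I) ^ b := by
      rw [← Complex.exp_nat_mul, ← Complex.exp_nat_mul, ← Complex.exp_add]
      congr 1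
      ring
    rw [e2, e1, e3, e4, mul_pow, mul_pow, Complex.real_smul]
    push_cast
    ring
  rw [setIntegral_congr_fun (measurableSet_Ioi.prod measurableSet_Ioo) hpt]
  rw [setIntegral_prod_mul
    (fun r : ℝ => ((r * (φ (r ^ 2) * r ^ (a + b)) : ℝ) : ℂ))
    (fun θ : ℝ => Complex.exp (((b : ℂ) - (a : ℂ)) * Complex.I * (θ : ℂ)))]
  split_ifs with h
  · subst h
    have e : ∫ r in Set.Ioi (0 : ℝ), ((r * (φ (r ^ 2) * r ^ (a + a)) : ℝ) : ℂ) =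
        ((1 / 2 * ∫ x in Set.Ioi (0 : ℝ), φ x * x ^ a : ℝ) : ℂ) := by
      rw [← integral_Ioi_mul_comp_sq fun x => φ x * x ^ a, integral_complex_ofReal]
      congr 2
      funext r
      ring
    rw [e]
    simp
    rw [max_eq_left (by positivity)]
    push_cast
    ring
  · rw [integral_exp_int_mul_I h, mul_zero]

theorem integrable_exp_neg_mul_norm_pow {b : ℝ} (hb : 0 < b) (m : ℕ) :
    Integrable fun z : ℂ => Real.exp (-(b * ‖z‖ ^ 2)) * ‖z‖ ^ m := by
  -- Half of the Gaussian exponent is kept for integrability; the other half absorbs the power of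
  -- the norm.
  have h := (GaussianFourier.integrable_cexp_neg_mul_sq_norm_add (b := ((b / 2 : ℝ) : ℂ)) (V := ℂ)
    (by rw [Complex.ofReal_re]; positivity) 0 0).norm
  have h' := h.const_mul (1 + (m.factorial : ℝ) / (b / 2) ^ m)
  refine h'.mono' (by fun_prop) (Eventually.of_forall fun z => ?_)
  have e : ‖Complex.exp (-((b / 2 : ℝ) : ℂ) * (‖z‖ : ℂ) ^ 2 + 0 * ((inner ℝ (0 : ℂ) z : ℝ) : ℂ))‖ =
      Real.exp (-(b / 2 * ‖z‖ ^ 2)) := by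
    rw [Complex.norm_exp]
    congr 1
    rw [zero_mul, add_zero, ← Complex.ofReal_neg, ← Complex.ofReal_pow, ← Complex.ofReal_mul,
      Complex.ofReal_re]
    ring
  rw [e, Real.norm_of_nonneg (by positivity)]
  set r := ‖z‖ with hr
  have hr0 : 0 ≤ r := norm_nonneg z
  have h1 := Real.pow_div_factorial_le_exp (b / 2 * r ^ 2) (by positivity) m
  have h2 : r ^ m ≤ 1 + r ^ (2 * m) := by
    rw [mul_comm, pow_mul]
    nlinarith [sq_nonneg (r ^ m - 1 / 2)]
  have h3 : r ^ (2 * m) ≤ (m.factorial : ℝ) / (b / 2) ^ m * Real.exp (b / 2 * r ^ 2) := by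
    rw [div_le_iff₀ (by positivity), mul_pow, ← pow_mul] at h1
    rw [div_mul_eq_mul_div, le_div_iff₀ (by positivity)]
    linarith
  have h4 : (1 : ℝ) ≤ Real.exp (b / 2 * r ^ 2) := Real.one_le_exp (by positivity)
  have h5 : Real.exp (-(b * r ^ 2)) * Real.exp (b / 2 * r ^ 2) = Real.exp (-(b / 2 * r ^ 2)) := by
    rw [← Real.exp_add]
    congr 1
    ring
  rw [← h5]
  calc Real.exp (-(b * r ^ 2)) * r ^ m
      ≤ Real.exp (-(b * r ^ 2)) * (Real.exp (b / 2 * r ^ 2) +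
        (m.factorial : ℝ) / (b / 2) ^ m * Real.exp (b / 2 * r ^ 2)) := by
        gcongr
        linarith
    _ = _ := by ring

/-! ### The scalar product of monomials -/

/-- The integral `∫ e^{-y} y^N ∏ G(y x_i) dy`, which is the density continued to `x_i = 0`. -/
noncomputable def besselIntegral {n : ℕ} (N : ℕ) (k : Fin n → ℕ) (x : Fin n → ℝ) : ℝ :=
  ∫ y in Set.Ioi (0 : ℝ), Real.exp (-y) * y ^ N * ∏ i, besselG (k i) (y * x i)

/-- The integrand of the regularized scalar product of two monomials, before integration over the
auxiliary variable `y`. -/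
noncomputable def monomialKernel {n : ℕ} (N : ℕ) (k : Fin n → ℕ) (c δ : ℝ) (α β : Fin n → ℕ)
    (z : Fin n → ℂ) (y : ℝ) : ℂ :=
  (∏ i, ((Real.exp (-(δ * c * ‖z i‖ ^ 2)) * besselG (k i) (y * (c * ‖z i‖ ^ 2)) : ℝ) : ℂ) *
    ((starRingEnd ℂ) (z i) ^ α i * z i ^ β i)) * ((Real.exp (-y) * y ^ N : ℝ) : ℂ)

theorem abs_besselG_le_one (k : ℕ) {x : ℝ} (hx : 0 ≤ x) : |besselG k x| ≤ 1 := by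
  refine (abs_besselG_le k hx).trans ?_
  rw [div_le_one (by positivity)]
  exact_mod_cast Nat.factorial_pos k

/-- The bound |G_k| ≤ 1 decouples z from y, and the factor with δ > 0 supplies Gaussian decay in z.
This licenses Fubini: the y-integral gives the regularized integrand, the z-integral factorises over
the coordinates. -/
theorem integrable_monomialKernel {n : ℕ} (N : ℕ) (k : Fin n → ℕ) {c δ : ℝ} (hc : 0 < c)
    (hδ : 0 < δ) (α β : Fin n → ℕ) :
    Integrable (Function.uncurry (monomialKernel N k c δ α β))
      ((volume : Measure (Fin n → ℂ)).prod (volume.restrict (Set.Ioi (0 : ℝ)))) := by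
  have hz : Integrable fun z : Fin n → ℂ =>
      ∏ i, Real.exp (-(δ * c * ‖z i‖ ^ 2)) * ‖z i‖ ^ (α i + β i) :=
    Integrable.fintype_prod (f := fun i (z : ℂ) => Real.exp (-(δ * c * ‖z‖ ^ 2)) * ‖z‖ ^ (α i + β i))
      fun i => integrable_exp_neg_mul_norm_pow (by positivity) _
  have hy := integrableOn_exp_neg_mul_pow' N
  refine (hz.mul_prod hy).mono' ?_ ?_
  · refine Continuous.aestronglyMeasurable ?_
    unfold monomialKernel Function.uncurry
    have hG : ∀ i, Continuous (besselG (k i)) := fun i => continuous_besselG (k i)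
    fun_prop
  · have h0 : ∀ᵐ y ∂(volume.restrict (Set.Ioi (0 : ℝ))), 0 < y := ae_restrict_mem measurableSet_Ioi
    filter_upwards [Measure.quasiMeasurePreserving_snd.ae h0] with p hp
    obtain ⟨z, y⟩ := p
    simp only at hp
    simp only [Function.uncurry, monomialKernel]
    rw [norm_mul, Complex.norm_real, Real.norm_of_nonneg (by positivity : 0 ≤ Real.exp (-y) * y ^ N)]
    refine mul_le_mul_of_nonneg_right ?_ (by positivity)
    rw [norm_prod]
    refine Finset.prod_le_prod (fun i _ => norm_nonneg _) fun i _ => ?_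
    rw [norm_mul, norm_mul, norm_pow, norm_pow, RCLike.norm_conj, Complex.norm_real, norm_mul,
      Real.norm_of_nonneg (Real.exp_pos _).le, ← pow_add]
    refine mul_le_mul_of_nonneg_right ?_ (by positivity)
    exact mul_le_of_le_one_right (Real.exp_pos _).le (abs_besselG_le_one _ (by positivity))

theorem integral_monomialKernel_right {n : ℕ} (N : ℕ) (k : Fin n → ℕ) (c δ : ℝ)
    (α β : Fin n → ℕ) (z : Fin n → ℂ) :
    ∫ y in Set.Ioi (0 : ℝ), monomialKernel N k c δ α β z y =
      (Real.exp (-δ * ∑ i, c * ‖z i‖ ^ 2) : ℂ) *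
        (((besselIntegral N k fun i => c * ‖z i‖ ^ 2 : ℝ) : ℂ) *
          ((starRingEnd ℂ) (∏ i, z i ^ α i) * ∏ i, z i ^ β i)) := by
  have e : ∀ y, monomialKernel N k c δ α β z y =
      ((Real.exp (-y) * y ^ N * ∏ i, besselG (k i) (y * (c * ‖z i‖ ^ 2)) : ℝ) : ℂ) *
      ((Real.exp (-δ * ∑ i, c * ‖z i‖ ^ 2) : ℂ) *
        ((starRingEnd ℂ) (∏ i, z i ^ α i) * ∏ i, z i ^ β i)) := by
    intro y
    have e1 : Real.exp (-δ * ∑ i, c * ‖z i‖ ^ 2) = ∏ i, Real.exp (-(δ * c * ‖z i‖ ^ 2)) := by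
      rw [← Real.exp_sum, Finset.mul_sum]
      congr 1
      exact Finset.sum_congr rfl fun i _ => by ring
    rw [monomialKernel, e1, Finset.prod_mul_distrib, Finset.prod_mul_distrib, map_prod]
    simp only [map_pow]
    push_cast
    rw [Finset.prod_mul_distrib]
    ring
  rw [integral_congr_ae (Eventually.of_forall e), integral_mul_const, integral_complex_ofReal,
    besselIntegral]
  ring

theorem integral_monomialKernel_left {n : ℕ} (N : ℕ) (k : Fin n → ℕ) {c δ : ℝ} (hc : 0 < c)
    (α β : Fin n → ℕ) {y : ℝ} (hy : 0 < y) :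
    ∫ z, monomialKernel N k c δ α β z y =
      if α = β then
        (((∏ i, Real.pi / c ^ (α i + 1) * laplaceG (α i) (k i) (δ / y)) *
          ((∏ i, (y ^ (α i + 1))⁻¹) * (Real.exp (-y) * y ^ N)) : ℝ) : ℂ)
      else 0 := by
  have h1 : ∀ i, ∫ z : ℂ,
      ((Real.exp (-(δ * c * ‖z‖ ^ 2)) * besselG (k i) (y * (c * ‖z‖ ^ 2)) : ℝ) : ℂ) *
        ((starRingEnd ℂ) z ^ α i * z ^ β i) =
      if α i = β i then
        ((Real.pi / c ^ (α i + 1) * laplaceG (α i) (k i) (δ / y) * (y ^ (α i + 1))⁻¹ : ℝ) : ℂ)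
      else 0 := by
    intro i
    rw [integral_radial_mul
      (fun x => Real.exp (-(δ * c * x)) * besselG (k i) (y * (c * x))) (α i) (β i)]
    have h2 := integral_exp_mul_besselG_mul (α i) (k i) (δ * c) (mul_pos hy hc)
    have e : δ * c / (y * c) = δ / y := by field_simp
    rw [e] at h2
    have e2 : ∫ x in Set.Ioi (0 : ℝ),
        Real.exp (-(δ * c * x)) * besselG (k i) (y * (c * x)) * x ^ α i =
        ∫ x in Set.Ioi (0 : ℝ), Real.exp (-(δ * c * x)) * x ^ α i * besselG (k i) (y * c * x) := by
      congr 1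
      funext x
      rw [mul_assoc y]
      ring
    rw [e2, h2]
    congr 2
    rw [mul_pow, mul_inv]
    field_simp
  simp only [monomialKernel]
  rw [integral_mul_const, integral_fintype_prod_volume_eq_prod (fun i (z : ℂ) =>
    ((Real.exp (-(δ * c * ‖z‖ ^ 2)) * besselG (k i) (y * (c * ‖z‖ ^ 2)) : ℝ) : ℂ) *
      ((starRingEnd ℂ) z ^ α i * z ^ β i)), Finset.prod_congr rfl fun i _ => h1 i]
  split_ifs with h
  · subst h
    simp only [if_true]
    rw [← Complex.ofReal_prod, Finset.prod_mul_distrib]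
    push_cast
    ring
  · obtain ⟨i, hi⟩ := Function.ne_iff.1 h
    rw [Finset.prod_eq_zero (Finset.mem_univ i) (if_neg hi), zero_mul]

/-- The norm squared of the monomial `z ^ α` in the scalar product. -/
noncomputable def monomialWeight {n : ℕ} (M : ℕ) (k : Fin n → ℕ) (c : ℝ) (α : Fin n → ℕ) : ℝ :=
  (∏ i, Real.pi / c ^ (α i + 1) * laplaceLim (α i) (k i)) * ((M - ∑ i, α i).factorial : ℝ)

/-- The regularized integrand of the scalar product in the coordinates `z`. -/
noncomputable def zIntegrand {n : ℕ} (N : ℕ) (k : Fin n → ℕ) (c δ : ℝ) (f h : (Fin n → ℂ) → ℂ)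
    (z : Fin n → ℂ) : ℂ :=
  (Real.exp (-δ * ∑ i, c * ‖z i‖ ^ 2) : ℂ) *
    (((besselIntegral N k fun i => c * ‖z i‖ ^ 2 : ℝ) : ℂ) * ((starRingEnd ℂ) (f z) * h z))

theorem integrable_zIntegrand_monomial {n : ℕ} (N : ℕ) (k : Fin n → ℕ) {c δ : ℝ} (hc : 0 < c)
    (hδ : 0 < δ) (α β : Fin n → ℕ) :
    Integrable (zIntegrand N k c δ (fun z => ∏ i, z i ^ α i) fun z => ∏ i, z i ^ β i) := by
  refine (integrable_monomialKernel N k hc hδ α β).integral_prod_left.congr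
    (Eventually.of_forall fun z => ?_)
  exact integral_monomialKernel_right N k c δ α β z

theorem integral_zIntegrand_monomial {n : ℕ} (N : ℕ) (k : Fin n → ℕ) {c δ : ℝ} (hc : 0 < c)
    (hδ : 0 < δ) (α β : Fin n → ℕ) :
    ∫ z, zIntegrand N k c δ (fun z => ∏ i, z i ^ α i) (fun z => ∏ i, z i ^ β i) z =
      if α = β then
        ((∫ y in Set.Ioi (0 : ℝ), (∏ i, Real.pi / c ^ (α i + 1) * laplaceG (α i) (k i) (δ / y)) *
          ((∏ i, (y ^ (α i + 1))⁻¹) * (Real.exp (-y) * y ^ N)) : ℝ) : ℂ)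
      else 0 := by
  have h1 : ∀ z, zIntegrand N k c δ (fun z => ∏ i, z i ^ α i) (fun z => ∏ i, z i ^ β i) z =
      ∫ y in Set.Ioi (0 : ℝ), monomialKernel N k c δ α β z y := fun z =>
    (integral_monomialKernel_right N k c δ α β z).symm
  rw [integral_congr_ae (Eventually.of_forall h1),
    integral_integral_swap (integrable_monomialKernel N k hc hδ α β),
    setIntegral_congr_fun measurableSet_Ioi fun y hy =>
      integral_monomialKernel_left N k (δ := δ) hc α β hy]
  split_ifs with h
  · rw [integral_complex_ofReal]
  · simp

/-- Dominated convergence in y: the transforms are uniformly bounded and converge pointwise to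
`laplaceLim`, leaving ∫ e^{-y} y^{M-|α|} dy = (M-|α|)!. -/
theorem tendsto_integral_laplaceG_prod {n : ℕ} (M : ℕ) (k : Fin n → ℕ) {c : ℝ}
    (α : Fin n → ℕ) (hα : ∑ i, α i ≤ M) :
    Tendsto (fun δ : ℝ => ∫ y in Set.Ioi (0 : ℝ),
      (∏ i, Real.pi / c ^ (α i + 1) * laplaceG (α i) (k i) (δ / y)) *
          ((∏ i, (y ^ (α i + 1))⁻¹) * (Real.exp (-y) * y ^ (M + n))))
      (𝓝[>] 0) (𝓝 (monomialWeight M k c α)) := by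
  -- Here the exponent M + n of the density meets |α| ≤ M: rescaling removes y^{|α|+n}, and a
  -- nonnegative power remains.
  have hpow : ∀ y : ℝ, 0 < y → (∏ i, (y ^ (α i + 1))⁻¹) * (Real.exp (-y) * y ^ (M + n)) =
      Real.exp (-y) * y ^ (M - ∑ i, α i) := by
    intro y hy
    have e : ∏ i, y ^ (α i + 1) = y ^ (∑ i, α i + n) := by
      rw [Finset.prod_pow_eq_pow_sum, Finset.sum_add_distrib]
      simp
    rw [Finset.prod_inv_distrib, e, show M + n = (∑ i, α i + n) + (M - ∑ i, α i) by omega, pow_add]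
    field_simp
    rw [pow_add, pow_add]
  choose C hC0 hC using fun i => exists_abs_laplaceG_le (α i) (k i)
  have hmeas : ∀ i, Measurable (laplaceG (α i) (k i)) := by
    intro i
    have : StronglyMeasurable (laplaceG (α i) (k i)) := by
      unfold laplaceG
      refine StronglyMeasurable.integral_prod_right (f := fun η x : ℝ =>
        Real.exp (-(η * x)) * x ^ α i * besselG (k i) x) ?_
      refine Continuous.stronglyMeasurable ?_
      have := continuous_besselG (k i)
      unfold Function.uncurry
      fun_prop
    exact this.measurable
  have hval : monomialWeight M k c α = ∫ y in Set.Ioi (0 : ℝ),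
      (∏ i, Real.pi / c ^ (α i + 1) * laplaceLim (α i) (k i)) *
          ((∏ i, (y ^ (α i + 1))⁻¹) * (Real.exp (-y) * y ^ (M + n))) := by
    rw [integral_const_mul, setIntegral_congr_fun measurableSet_Ioi fun y hy => hpow y hy,
      integral_exp_neg_mul_pow, monomialWeight]
  rw [hval]
  refine tendsto_integral_filter_of_dominated_convergence
    (fun y => (∏ i, |Real.pi / c ^ (α i + 1)| * C i) * (Real.exp (-y) * y ^ (M - ∑ i, α i)))
    ?_ ?_ ((integrableOn_exp_neg_mul_pow' _).const_mul _) ?_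
  · refine Eventually.of_forall fun δ => Measurable.aestronglyMeasurable ?_
    refine Measurable.mul (Finset.measurable_prod _ fun i _ => ?_) ?_
    · exact ((hmeas i).comp (measurable_const.div measurable_id)).const_mul _
    · fun_prop
  · filter_upwards [self_mem_nhdsWithin] with δ hδ
    have hδ' : 0 < δ := hδ
    filter_upwards [ae_restrict_mem measurableSet_Ioi] with y hy
    have hy' : 0 < y := hy
    rw [hpow y hy, norm_mul, Real.norm_of_nonneg
      (by positivity : 0 ≤ Real.exp (-y) * y ^ (M - ∑ i, α i))]
    refine mul_le_mul_of_nonneg_right ?_ (by positivity)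
    rw [norm_prod]
    refine Finset.prod_le_prod (fun i _ => norm_nonneg _) fun i _ => ?_
    rw [norm_mul]
    exact mul_le_mul_of_nonneg_left (hC i _ (by positivity)) (abs_nonneg _)
  · filter_upwards [ae_restrict_mem measurableSet_Ioi] with y hy
    have hy' : 0 < y := hy
    refine Tendsto.mul_const _ (tendsto_finsetProd _ fun i _ => Tendsto.const_mul _ ?_)
    refine (tendsto_laplaceG (α i) (k i)).comp ?_
    refine tendsto_nhdsWithin_iff.2 ⟨?_, ?_⟩
    · have : Tendsto (fun δ : ℝ => δ / y) (𝓝 0) (𝓝 (0 / y)) := tendsto_id.div_const y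
      rw [zero_div] at this
      exact this.mono_left nhdsWithin_le_nhds
    · filter_upwards [self_mem_nhdsWithin] with δ hδ
      exact div_pos hδ hy'

theorem tendsto_integral_zIntegrand_monomial {n : ℕ} (M : ℕ) (k : Fin n → ℕ) {c : ℝ} (hc : 0 < c)
    (α β : Fin n → ℕ) (hα : ∑ i, α i ≤ M) :
    Tendsto (fun δ : ℝ =>
      ∫ z, zIntegrand (M + n) k c δ (fun z => ∏ i, z i ^ α i) (fun z => ∏ i, z i ^ β i) z)
      (𝓝[>] 0) (𝓝 (if α = β then (monomialWeight M k c α : ℂ) else 0)) := by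
  have h : ∀ᶠ δ in 𝓝[>] (0 : ℝ), (if α = β then
        ((∫ y in Set.Ioi (0 : ℝ), (∏ i, Real.pi / c ^ (α i + 1) * laplaceG (α i) (k i) (δ / y)) *
          ((∏ i, (y ^ (α i + 1))⁻¹) * (Real.exp (-y) * y ^ (M + n))) : ℝ) : ℂ)
      else 0) =
      ∫ z, zIntegrand (M + n) k c δ (fun z => ∏ i, z i ^ α i) (fun z => ∏ i, z i ^ β i) z := by
    filter_upwards [self_mem_nhdsWithin] with δ hδ
    rw [integral_zIntegrand_monomial (M + n) k hc hδ α β]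
  refine Tendsto.congr' h ?_
  split_ifs with h
  · exact (Complex.continuous_ofReal.tendsto _).comp (tendsto_integral_laplaceG_prod M k α hα)
  · exact tendsto_const_nhds

open MvPolynomial in
theorem monomial_mem_restrictTotalDegree {n M : ℕ} {v : Fin n →₀ ℕ} (hv : v.degree ≤ M) (a : ℂ) :
    monomial v a ∈ restrictTotalDegree (Fin n) ℂ M := by
  rw [mem_restrictTotalDegree]
  exact (totalDegree_monomial_le v a).trans hv

open MvPolynomial in
theorem degree_le_of_mem_support {n M : ℕ} {F : MvPolynomial (Fin n) ℂ}
    (hF : F ∈ restrictTotalDegree (Fin n) ℂ M) {v : Fin n →₀ ℕ} (hv : v ∈ F.support) :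
    v.degree ≤ M :=
  (le_totalDegree hv).trans ((mem_restrictTotalDegree _ _ _).1 hF)

/-! ### The scalar product on polynomials -/

/-- The exponents of total degree at most `M`. -/
noncomputable def lowDegree (n M : ℕ) : Finset (Fin n →₀ ℕ) :=
  (Finsupp.finite_of_degree_le (σ := Fin n) M).toFinset

theorem mem_lowDegree {n M : ℕ} {v : Fin n →₀ ℕ} : v ∈ lowDegree n M ↔ v.degree ≤ M := by
  simp [lowDegree]

open MvPolynomial in
theorem sum_monomial_coeff_lowDegree {n M : ℕ} {F : MvPolynomial (Fin n) ℂ}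
    (hF : F ∈ restrictTotalDegree (Fin n) ℂ M) :
    ∑ v ∈ lowDegree n M, monomial v (coeff v F) = F := by
  conv_rhs => rw [F.as_sum]
  refine (Finset.sum_subset (fun v hv => ?_) fun v _ hv => ?_).symm
  · exact mem_lowDegree.2 (degree_le_of_mem_support hF hv)
  · rw [notMem_support_iff.1 hv, map_zero]

/-- The scalar product of polynomials of degree at most `M`, diagonal in the monomials with
weights `w`. -/
noncomputable def polyInner {n : ℕ} (M : ℕ) (w : (Fin n → ℕ) → ℝ)
    (F H : MvPolynomial (Fin n) ℂ) : ℂ :=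
  ∑ v ∈ lowDegree n M, (starRingEnd ℂ) (F.coeff v) * H.coeff v * (w v : ℂ)

theorem eval_eq_lowDegree {n M : ℕ} {F : MvPolynomial (Fin n) ℂ}
    (hF : F ∈ MvPolynomial.restrictTotalDegree (Fin n) ℂ M) (z : Fin n → ℂ) :
    F.eval z = ∑ v ∈ lowDegree n M, F.coeff v * ∏ i, z i ^ v i := by
  conv_lhs => rw [← sum_monomial_coeff_lowDegree hF]
  rw [map_sum]
  refine Finset.sum_congr rfl fun v _ => ?_
  rw [MvPolynomial.eval_monomial, Finsupp.prod_fintype _ _ fun i => pow_zero _]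

theorem zIntegrand_eval {n M : ℕ} (N : ℕ) (k : Fin n → ℕ) (c δ : ℝ)
    {F H : MvPolynomial (Fin n) ℂ}
    (hF : F ∈ MvPolynomial.restrictTotalDegree (Fin n) ℂ M)
    (hH : H ∈ MvPolynomial.restrictTotalDegree (Fin n) ℂ M) :
    zIntegrand N k c δ (fun z => F.eval z) (fun z => H.eval z) = fun z =>
      ∑ v ∈ lowDegree n M, ∑ u ∈ lowDegree n M, ((starRingEnd ℂ) (F.coeff v) * H.coeff u) *
        zIntegrand N k c δ (fun z => ∏ i, z i ^ v i) (fun z => ∏ i, z i ^ u i) z := by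
  funext z
  simp only [zIntegrand]
  rw [eval_eq_lowDegree hF, eval_eq_lowDegree hH, map_sum, Finset.sum_mul_sum]
  generalize (Real.exp (-δ * ∑ i, c * ‖z i‖ ^ 2) : ℂ) = e
  simp only [Finset.mul_sum, map_mul]
  refine Finset.sum_congr rfl fun v _ => Finset.sum_congr rfl fun u _ => ?_
  ring

theorem integrable_zIntegrand_eval {n M : ℕ} (N : ℕ) (k : Fin n → ℕ) {c δ : ℝ} (hc : 0 < c)
    (hδ : 0 < δ) {F H : MvPolynomial (Fin n) ℂ}
    (hF : F ∈ MvPolynomial.restrictTotalDegree (Fin n) ℂ M)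
    (hH : H ∈ MvPolynomial.restrictTotalDegree (Fin n) ℂ M) :
    Integrable (zIntegrand N k c δ (fun z => F.eval z) fun z => H.eval z) := by
  rw [zIntegrand_eval N k c δ hF hH]
  exact integrable_finsetSum _ fun v _ => integrable_finsetSum _ fun u _ =>
    (integrable_zIntegrand_monomial N k hc hδ v u).const_mul _

theorem tendsto_integral_zIntegrand_eval {n M : ℕ} (k : Fin n → ℕ) {c : ℝ} (hc : 0 < c)
    {F H : MvPolynomial (Fin n) ℂ}
    (hF : F ∈ MvPolynomial.restrictTotalDegree (Fin n) ℂ M)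
    (hH : H ∈ MvPolynomial.restrictTotalDegree (Fin n) ℂ M) :
    Tendsto (fun δ : ℝ =>
      ∫ z, zIntegrand (M + n) k c δ (fun z => F.eval z) (fun z => H.eval z) z)
      (𝓝[>] 0) (𝓝 (polyInner M (monomialWeight M k c) F H)) := by
  have h1 : ∀ᶠ δ in 𝓝[>] (0 : ℝ),
      ∑ v ∈ lowDegree n M, ∑ u ∈ lowDegree n M, ((starRingEnd ℂ) (F.coeff v) * H.coeff u) *
        ∫ z, zIntegrand (M + n) k c δ (fun z => ∏ i, z i ^ v i) (fun z => ∏ i, z i ^ u i) z =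
      ∫ z, zIntegrand (M + n) k c δ (fun z => F.eval z) (fun z => H.eval z) z := by
    filter_upwards [self_mem_nhdsWithin] with δ hδ
    have hi := integrable_zIntegrand_monomial (M + n) k hc hδ
    simp only [zIntegrand_eval (M + n) k c δ hF hH]
    rw [integral_finsetSum _ fun (v : Fin n →₀ ℕ) _ =>
      integrable_finsetSum _ fun (u : Fin n →₀ ℕ) _ => (hi v u).const_mul _]
    refine Finset.sum_congr rfl fun v _ => ?_
    rw [integral_finsetSum _ fun (u : Fin n →₀ ℕ) _ => (hi v u).const_mul _]
    exact Finset.sum_congr rfl fun u _ => (integral_const_mul _ _).symm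
  refine Tendsto.congr' h1 ?_
  refine tendsto_finsetSum _ fun v hv => ?_
  -- Orthogonality of distinct monomials leaves only the diagonal of the double sum.
  have h2 : (starRingEnd ℂ) (F.coeff v) * H.coeff v * (monomialWeight M k c v : ℂ) =
      ∑ u ∈ lowDegree n M, ((starRingEnd ℂ) (F.coeff v) * H.coeff u) *
        if (v : Fin n → ℕ) = u then (monomialWeight M k c v : ℂ) else 0 := by
    rw [Finset.sum_eq_single v]
    · rw [if_pos rfl]
    · intro u _ hu
      rw [if_neg fun h => hu (DFunLike.coe_injective h).symm, mul_zero]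
    · exact fun h => absurd hv h
  rw [h2]
  refine tendsto_finsetSum _ fun u _ => Tendsto.const_mul _ ?_
  refine tendsto_integral_zIntegrand_monomial M k hc v u ?_
  rw [← Finsupp.degree_eq_sum]
  exact mem_lowDegree.1 hv

/-! ### Symmetric operators -/

/-- `T'` is adjoint to `T` on the polynomials of degree at most `M`. -/
def IsAdj {n : ℕ} (M : ℕ) (w : (Fin n → ℕ) → ℝ)
    (T T' : MvPolynomial (Fin n) ℂ →ₗ[ℂ] MvPolynomial (Fin n) ℂ) : Prop :=
  ∀ F ∈ MvPolynomial.restrictTotalDegree (Fin n) ℂ M,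
    ∀ H ∈ MvPolynomial.restrictTotalDegree (Fin n) ℂ M,
      polyInner M w F (T H) = polyInner M w (T' F) H

section

variable {n M : ℕ} {w : (Fin n → ℕ) → ℝ}
  {T T' U U' : MvPolynomial (Fin n) ℂ →ₗ[ℂ] MvPolynomial (Fin n) ℂ}

theorem polyInner_add_right (F H K : MvPolynomial (Fin n) ℂ) :
    polyInner M w F (H + K) = polyInner M w F H + polyInner M w F K := by
  simp only [polyInner, MvPolynomial.coeff_add, ← Finset.sum_add_distrib]
  exact Finset.sum_congr rfl fun _ _ => by ring

theorem polyInner_add_left (F H K : MvPolynomial (Fin n) ℂ) :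
    polyInner M w (F + H) K = polyInner M w F K + polyInner M w H K := by
  simp only [polyInner, MvPolynomial.coeff_add, ← Finset.sum_add_distrib, map_add]
  exact Finset.sum_congr rfl fun _ _ => by ring

theorem polyInner_smul_right (a : ℂ) (F H : MvPolynomial (Fin n) ℂ) :
    polyInner M w F (a • H) = a * polyInner M w F H := by
  simp only [polyInner, MvPolynomial.coeff_smul, Finset.mul_sum, smul_eq_mul]
  exact Finset.sum_congr rfl fun _ _ => by ring

theorem polyInner_smul_left (a : ℂ) (F H : MvPolynomial (Fin n) ℂ) :
    polyInner M w (a • F) H = (starRingEnd ℂ) a * polyInner M w F H := by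
  simp only [polyInner, MvPolynomial.coeff_smul, Finset.mul_sum, smul_eq_mul, map_mul]
  exact Finset.sum_congr rfl fun _ _ => by ring

theorem polyInner_sum_right {ι : Type*} (s : Finset ι) (F : MvPolynomial (Fin n) ℂ)
    (H : ι → MvPolynomial (Fin n) ℂ) :
    polyInner M w F (∑ i ∈ s, H i) = ∑ i ∈ s, polyInner M w F (H i) := by
  simp only [polyInner, MvPolynomial.coeff_sum, Finset.mul_sum, Finset.sum_mul]
  exact Finset.sum_comm

theorem polyInner_sum_left {ι : Type*} (s : Finset ι) (F : ι → MvPolynomial (Fin n) ℂ)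
    (H : MvPolynomial (Fin n) ℂ) :
    polyInner M w (∑ i ∈ s, F i) H = ∑ i ∈ s, polyInner M w (F i) H := by
  simp only [polyInner, MvPolynomial.coeff_sum, Finset.sum_mul, map_sum]
  exact Finset.sum_comm

theorem polyInner_monomial {u v : Fin n →₀ ℕ} (hu : u.degree ≤ M) (a b : ℂ) :
    polyInner M w (MvPolynomial.monomial u a) (MvPolynomial.monomial v b) =
      if u = v then (starRingEnd ℂ) a * b * (w u : ℂ) else 0 := by
  classical
  rw [polyInner, Finset.sum_eq_single u]
  · rw [MvPolynomial.coeff_monomial, MvPolynomial.coeff_monomial, if_pos rfl]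
    by_cases h : u = v
    · rw [if_pos h, if_pos h.symm]
    · rw [if_neg h, if_neg fun h' => h h'.symm, mul_zero, zero_mul]
  · intro x _ hx
    rw [MvPolynomial.coeff_monomial, if_neg hx.symm, map_zero, zero_mul, zero_mul]
  · exact fun h => absurd (mem_lowDegree.2 hu) h

theorem polyInner_conj (F H : MvPolynomial (Fin n) ℂ) :
    (starRingEnd ℂ) (polyInner M w F H) = polyInner M w H F := by
  simp only [polyInner, map_sum, map_mul, Complex.conj_conj, Complex.conj_ofReal]
  exact Finset.sum_congr rfl fun _ _ => by ring

/-- Only one exponent needs the degree bound, since the product vanishes unless the exponents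
coincide; this form is used when an operator might raise the degree on the left. -/
theorem polyInner_monomial' {u v : Fin n →₀ ℕ} (hv : v.degree ≤ M) (a b : ℂ) :
    polyInner M w (MvPolynomial.monomial u a) (MvPolynomial.monomial v b) =
      if u = v then (starRingEnd ℂ) a * b * (w v : ℂ) else 0 := by
  rw [← polyInner_conj, polyInner_monomial hv]
  by_cases h : v = u
  · rw [if_pos h, if_pos h.symm, map_mul, map_mul, Complex.conj_conj, Complex.conj_ofReal]
    ring
  · rw [if_neg h, if_neg fun h' => h h'.symm, map_zero]

theorem isAdj_of_monomial (h : ∀ u v : Fin n →₀ ℕ, u.degree ≤ M → v.degree ≤ M →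
    ∀ a b : ℂ, polyInner M w (MvPolynomial.monomial u a) (T (MvPolynomial.monomial v b)) =
      polyInner M w (T' (MvPolynomial.monomial u a)) (MvPolynomial.monomial v b)) :
    IsAdj M w T T' := by
  intro F hF H hH
  rw [← sum_monomial_coeff_lowDegree hF, ← sum_monomial_coeff_lowDegree hH, map_sum, map_sum,
    polyInner_sum_left, polyInner_sum_left]
  refine Finset.sum_congr rfl fun u hu => ?_
  rw [polyInner_sum_right, polyInner_sum_right]
  exact Finset.sum_congr rfl fun v hv => h u v (mem_lowDegree.1 hu) (mem_lowDegree.1 hv) _ _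

theorem IsAdj.add (h : IsAdj M w T T') (h' : IsAdj M w U U') : IsAdj M w (T + U) (T' + U') := by
  intro F hF H hH
  rw [LinearMap.add_apply, LinearMap.add_apply, polyInner_add_right, polyInner_add_left, h F hF H hH,
    h' F hF H hH]

/-- The scalar is real because the left slot is conjugate-linear; this is where the reality of ω and
of the ε_k enters. -/
theorem IsAdj.smul (a : ℝ) (h : IsAdj M w T T') : IsAdj M w ((a : ℂ) • T) ((a : ℂ) • T') := by
  intro F hF H hH
  rw [LinearMap.smul_apply, LinearMap.smul_apply, polyInner_smul_right, polyInner_smul_left,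
    h F hF H hH, Complex.conj_ofReal]

theorem IsAdj.sum {ι : Type*} (s : Finset ι)
    {V V' : ι → MvPolynomial (Fin n) ℂ →ₗ[ℂ] MvPolynomial (Fin n) ℂ}
    (h : ∀ i ∈ s, IsAdj M w (V i) (V' i)) : IsAdj M w (∑ i ∈ s, V i) (∑ i ∈ s, V' i) := by
  intro F hF H hH
  rw [LinearMap.sum_apply, LinearMap.sum_apply, polyInner_sum_right, polyInner_sum_left]
  exact Finset.sum_congr rfl fun i hi => h i hi F hF H hH

end

/-! ### The Hamiltonians in the coordinates `z` -/

/-- Multiplication by `z_j`. -/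
noncomputable def mulZ {n : ℕ} (j : Fin n) : MvPolynomial (Fin n) ℂ →ₗ[ℂ] MvPolynomial (Fin n) ℂ :=
  LinearMap.mulLeft ℂ (MvPolynomial.X j)

/-- Differentiation with respect to `z_j`. -/
noncomputable def dZ {n : ℕ} (j : Fin n) : MvPolynomial (Fin n) ℂ →ₗ[ℂ] MvPolynomial (Fin n) ℂ :=
  (MvPolynomial.pderiv j).toLinearMap

theorem dZ_apply {n : ℕ} (j : Fin n) (F : MvPolynomial (Fin n) ℂ) :
    dZ j F = MvPolynomial.pderiv j F := rfl

theorem mulZ_apply {n : ℕ} (j : Fin n) (F : MvPolynomial (Fin n) ℂ) :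
    mulZ j F = MvPolynomial.X j * F := rfl

/-- The number operator `z_j ∂_j`. -/
noncomputable def numZ {n : ℕ} (j : Fin n) : MvPolynomial (Fin n) ℂ →ₗ[ℂ] MvPolynomial (Fin n) ℂ :=
  mulZ j ∘ₗ dZ j

/-- The lowering operator `z_j ∂_j² - 2 s_j ∂_j`. -/
noncomputable def lowerZ {n : ℕ} (d : Fin n → ℕ) (j : Fin n) :
    MvPolynomial (Fin n) ℂ →ₗ[ℂ] MvPolynomial (Fin n) ℂ :=
  mulZ j ∘ₗ dZ j ∘ₗ dZ j - (d j : ℂ) • dZ j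

/-- The raising operator `c z_j (∑_k z_k ∂_k - M)`. -/
noncomputable def raiseZ {n : ℕ} (M : ℕ) (c : ℝ) (j : Fin n) :
    MvPolynomial (Fin n) ℂ →ₗ[ℂ] MvPolynomial (Fin n) ℂ :=
  (c : ℂ) • (mulZ j ∘ₗ (∑ k, numZ k - (M : ℂ) • LinearMap.id))

/-- The interaction of the spins `j` and `k`. -/
noncomputable def exchangeZ {n : ℕ} (d : Fin n → ℕ) (j k : Fin n) :
    MvPolynomial (Fin n) ℂ →ₗ[ℂ] MvPolynomial (Fin n) ℂ :=
  (mulZ k ∘ₗ lowerZ d j + mulZ j ∘ₗ lowerZ d k) +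
    (((-2 : ℝ) : ℂ) • (numZ j ∘ₗ numZ k) +
      (((d k : ℝ) : ℂ) • numZ j + ((d j : ℝ) : ℂ) • numZ k))

/-- The Hamiltonian `H_j` in the coordinates `z`, with `κ` the coefficient of `z_j ∂_j`. -/
noncomputable def hamZ {n : ℕ} (M : ℕ) (d : Fin n → ℕ) (c κ : ℝ) (ε : Fin n → ℝ) (j : Fin n) :
    MvPolynomial (Fin n) ℂ →ₗ[ℂ] MvPolynomial (Fin n) ℂ :=
  (lowerZ d j + raiseZ M c j) + ((κ : ℂ) • numZ j +
    ∑ k ∈ Finset.univ.erase j, (((ε j - ε k)⁻¹ : ℝ) : ℂ) • exchangeZ d j k)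

section

variable {n : ℕ}

open MvPolynomial

theorem mulZ_monomial (j : Fin n) (v : Fin n →₀ ℕ) (a : ℂ) :
    mulZ j (monomial v a) = monomial (v + Finsupp.single j 1) a := by
  rw [mulZ, LinearMap.mulLeft_apply, X, monomial_mul, one_mul, add_comm]

theorem numZ_monomial (j : Fin n) (v : Fin n →₀ ℕ) (a : ℂ) :
    numZ j (monomial v a) = monomial v ((v j : ℂ) * a) := by
  have h := X_mul_pderiv_monomial (i := j) (m := v) (r := a)
  rw [smul_monomial, nsmul_eq_mul] at h
  exact h

theorem lowerZ_monomial_of_eq_zero (d : Fin n → ℕ) {j : Fin n} {v : Fin n →₀ ℕ} (hv : v j = 0)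
    (a : ℂ) : lowerZ d j (monomial v a) = 0 := by
  have : dZ j (monomial v a) = 0 := by
    rw [dZ_apply, pderiv_monomial, hv]
    simp
  simp [lowerZ, this]

theorem lowerZ_monomial_add_single (d : Fin n → ℕ) (j : Fin n) (v : Fin n →₀ ℕ) (a : ℂ) :
    lowerZ d j (monomial (v + Finsupp.single j 1) a) =
      monomial v (((((v j : ℝ) + 1) * ((v j : ℝ) - d j) : ℝ) : ℂ) * a) := by
  have h1 : dZ j (monomial (v + Finsupp.single j 1) a) = monomial v (((v j : ℂ) + 1) * a) := by
    rw [dZ_apply, pderiv_monomial]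
    simp [mul_comm]
  have h2 := numZ_monomial j v (((v j : ℂ) + 1) * a)
  rw [numZ, LinearMap.comp_apply] at h2
  rw [lowerZ, LinearMap.sub_apply, LinearMap.smul_apply, LinearMap.comp_apply, LinearMap.comp_apply,
    h1, h2, smul_monomial, ← map_sub]
  congr 1
  push_cast
  rw [smul_eq_mul]
  ring

theorem raiseZ_monomial (M : ℕ) (c : ℝ) (j : Fin n) (v : Fin n →₀ ℕ) (a : ℂ) :
    raiseZ M c j (monomial v a) =
      monomial (v + Finsupp.single j 1) (((c * ((v.degree : ℝ) - M) : ℝ) : ℂ) * a) := by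
  rw [raiseZ, LinearMap.smul_apply, LinearMap.comp_apply, LinearMap.sub_apply,
    LinearMap.sum_apply, LinearMap.smul_apply, LinearMap.id_apply]
  simp only [numZ_monomial]
  rw [← map_sum, smul_monomial, ← map_sub, mulZ_monomial, smul_monomial, ← Finset.sum_mul,
    Finsupp.degree_eq_sum]
  congr 1
  push_cast
  rw [smul_eq_mul, smul_eq_mul]
  ring

theorem degree_add_single (v : Fin n →₀ ℕ) (j : Fin n) :
    (v + Finsupp.single j 1).degree = v.degree + 1 := by
  rw [map_add, Finsupp.degree_single]

theorem eq_add_single_of_ne_zero {v : Fin n →₀ ℕ} {j : Fin n} (h : v j ≠ 0) :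
    ∃ u : Fin n →₀ ℕ, v = u + Finsupp.single j 1 := by
  refine ⟨v - Finsupp.single j 1, ?_⟩
  rw [tsub_add_cancel_of_le]
  exact Finsupp.single_le_iff.2 (Nat.one_le_iff_ne_zero.2 h)

/-- The weights of the monomials in the scalar product, with a common recursion. -/
theorem monomialWeight_add_single (d : Fin n → ℕ) {c : ℝ} (hc : c ≠ 0) (j : Fin n)
    (v : Fin n →₀ ℕ) :
    ((v j : ℝ) + 1) * ((v j : ℝ) - d j) *
        ∏ i, Real.pi / c ^ (v i + 1) * laplaceLim (v i) (d i + 1) =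
      -c * ∏ i, Real.pi / c ^ ((v + Finsupp.single j 1 : Fin n →₀ ℕ) i + 1) *
        laplaceLim ((v + Finsupp.single j 1 : Fin n →₀ ℕ) i) (d i + 1) := by
  rw [← Finset.mul_prod_erase _ _ (Finset.mem_univ j),
    ← Finset.mul_prod_erase Finset.univ (fun i => Real.pi /
      c ^ ((v + Finsupp.single j 1 : Fin n →₀ ℕ) i + 1) *
        laplaceLim ((v + Finsupp.single j 1 : Fin n →₀ ℕ) i) (d i + 1)) (Finset.mem_univ j)]
  have h1 : ∏ i ∈ Finset.univ.erase j, Real.pi /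
      c ^ ((v + Finsupp.single j 1 : Fin n →₀ ℕ) i + 1) *
        laplaceLim ((v + Finsupp.single j 1 : Fin n →₀ ℕ) i) (d i + 1) =
      ∏ i ∈ Finset.univ.erase j, Real.pi / c ^ (v i + 1) * laplaceLim (v i) (d i + 1) :=
    Finset.prod_congr rfl fun i hi => by
      have : (v + Finsupp.single j 1 : Fin n →₀ ℕ) i = v i := by
        simp [(Finset.mem_erase.1 hi).1.symm]
      rw [this]
  have h2 : (v + Finsupp.single j 1 : Fin n →₀ ℕ) j = v j + 1 := by simp
  -- At v_j = d_j the factor d_j - v_j vanishes exactly when the exponent leaves the range where the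
  -- limit is nonzero, so the recursion needs no exception.
  have h3 : laplaceLim (v j + 1) (d j + 1) =
      ((v j : ℝ) + 1) * ((d j : ℝ) - v j) * laplaceLim (v j) (d j + 1) := by
    simp only [laplaceLim]
    rcases lt_trichotomy (v j) (d j) with h | h | h
    · obtain ⟨e, he⟩ := Nat.exists_eq_add_of_lt h
      rw [if_pos (by omega), if_pos (by omega), he,
        show v j + e + 1 + 1 - 1 - (v j + 1) = e by omega,
        show v j + e + 1 + 1 - 1 - v j = e + 1 by omega, Nat.factorial_succ, Nat.factorial_succ]
      push_cast
      field_simp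
      ring
    · rw [h]
      simp
    · rw [if_neg (by omega), if_neg (by omega), mul_zero]
  rw [h1, h2, h3, pow_succ c (v j + 1)]
  field_simp
  ring

end

theorem IsAdj.symm {n M : ℕ} {w : (Fin n → ℕ) → ℝ}
    {T T' : MvPolynomial (Fin n) ℂ →ₗ[ℂ] MvPolynomial (Fin n) ℂ} (h : IsAdj M w T T') :
    IsAdj M w T' T := by
  intro F hF H hH
  rw [← polyInner_conj, ← h H hH F hF, polyInner_conj]

/-! ### Adjoint relations between the operators -/

section

variable {n : ℕ}

open MvPolynomial

/-- The left factor is the matrix element of lowering, the right one that of raising. The factor M -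
|v| comes from the factorial in the weight. -/
theorem monomialWeight_lower {M : ℕ} (d : Fin n → ℕ) {c : ℝ} (hc : c ≠ 0) (j : Fin n)
    {v : Fin n →₀ ℕ} (hv : v.degree + 1 ≤ M) :
    ((v j : ℝ) + 1) * ((v j : ℝ) - d j) * monomialWeight M (fun i => d i + 1) c v =
      c * ((v.degree : ℝ) - M) *
        monomialWeight M (fun i => d i + 1) c (v + Finsupp.single j 1 : Fin n →₀ ℕ) := by
  have h := monomialWeight_add_single d hc j v
  obtain ⟨m, hm⟩ := Nat.exists_eq_add_of_le hv
  rw [monomialWeight, monomialWeight, ← mul_assoc, h, ← Finsupp.degree_eq_sum,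
    ← Finsupp.degree_eq_sum, degree_add_single, hm,
    show v.degree + 1 + m - v.degree = m + 1 by omega,
    show v.degree + 1 + m - (v.degree + 1) = m by omega, Nat.factorial_succ]
  push_cast
  ring

/-- The monomials z^v z_j and z^v z_k have the same degree, so the factorials agree, and both sides
are multiples of the weight product at v. -/
theorem monomialWeight_exchange {M : ℕ} (d : Fin n → ℕ) {c : ℝ} (hc : c ≠ 0) (j k : Fin n)
    (v : Fin n →₀ ℕ) :
    ((v j : ℝ) + 1) * ((v j : ℝ) - d j) *
        monomialWeight M (fun i => d i + 1) c (v + Finsupp.single k 1 : Fin n →₀ ℕ) =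
      ((v k : ℝ) + 1) * ((v k : ℝ) - d k) *
        monomialWeight M (fun i => d i + 1) c (v + Finsupp.single j 1 : Fin n →₀ ℕ) := by
  have hj := monomialWeight_add_single d hc j v
  have hk := monomialWeight_add_single d hc k v
  rw [monomialWeight, monomialWeight, ← Finsupp.degree_eq_sum, ← Finsupp.degree_eq_sum,
    degree_add_single, degree_add_single, ← mul_assoc, ← mul_assoc]
  congr 1
  refine mul_left_cancel₀ hc ?_
  linear_combination ((v j : ℝ) + 1) * ((v j : ℝ) - d j) * hk -
    ((v k : ℝ) + 1) * ((v k : ℝ) - d k) * hj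

theorem isAdj_numZ {M : ℕ} (w : (Fin n → ℕ) → ℝ) (j : Fin n) : IsAdj M w (numZ j) (numZ j) := by
  refine isAdj_of_monomial fun u v hu hv a b => ?_
  rw [numZ_monomial, numZ_monomial, polyInner_monomial hu, polyInner_monomial hu]
  by_cases h : u = v
  · rw [if_pos h, if_pos h, h, map_mul, Complex.conj_natCast]
    ring
  · rw [if_neg h, if_neg h]

theorem isAdj_numZ_numZ {M : ℕ} (w : (Fin n → ℕ) → ℝ) (j k : Fin n) :
    IsAdj M w (numZ j ∘ₗ numZ k) (numZ j ∘ₗ numZ k) := by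
  refine isAdj_of_monomial fun u v hu hv a b => ?_
  simp only [LinearMap.comp_apply, numZ_monomial]
  rw [polyInner_monomial hu, polyInner_monomial hu]
  by_cases h : u = v
  · rw [if_pos h, if_pos h, h, map_mul, map_mul, Complex.conj_natCast, Complex.conj_natCast]
    ring
  · rw [if_neg h, if_neg h]

theorem isAdj_lowerZ (M : ℕ) (d : Fin n → ℕ) {c : ℝ} (hc : c ≠ 0) (j : Fin n) :
    IsAdj M (monomialWeight M (fun i => d i + 1) c) (lowerZ d j) (raiseZ M c j) := by
  refine isAdj_of_monomial fun u v hu hv a b => ?_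
  rw [raiseZ_monomial, polyInner_monomial' hv]
  -- If v_j = 0 then lowering gives zero, while raising only produces exponents with positive j-th
  -- entry, orthogonal to z^v.
  by_cases h0 : v j = 0
  · rw [lowerZ_monomial_of_eq_zero d h0, if_neg]
    · simp [polyInner]
    · rintro rfl
      simp at h0
  · obtain ⟨v, rfl⟩ := eq_add_single_of_ne_zero h0
    rw [lowerZ_monomial_add_single, polyInner_monomial hu]
    by_cases h : u = v
    · subst h
      rw [degree_add_single] at hv
      rw [if_pos rfl, if_pos rfl, map_mul, Complex.conj_ofReal]
      have := monomialWeight_lower d hc j hv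
      have h' := congrArg (fun x : ℝ => (x : ℂ)) this
      simp only [Complex.ofReal_mul] at h'
      rw [Complex.ofReal_mul, Complex.ofReal_mul]
      linear_combination (starRingEnd ℂ) a * b * h'
    · rw [if_neg h, if_neg fun h' => h (add_right_cancel h')]

/-- Both operators conserve the total degree, moving one unit between sites j and k in opposite
directions, so the factorial in the weights plays no role. -/
theorem isAdj_mulZ_lowerZ (M : ℕ) (d : Fin n → ℕ) {c : ℝ} (hc : c ≠ 0) {j k : Fin n} :
    IsAdj M (monomialWeight M (fun i => d i + 1) c) (mulZ k ∘ₗ lowerZ d j)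
      (mulZ j ∘ₗ lowerZ d k) := by
  refine isAdj_of_monomial fun u v hu hv a b => ?_
  rw [LinearMap.comp_apply, LinearMap.comp_apply]
  by_cases h0 : v j = 0
  · rw [lowerZ_monomial_of_eq_zero d h0]
    by_cases h1 : u k = 0
    · rw [lowerZ_monomial_of_eq_zero d h1]
      simp [polyInner]
    · obtain ⟨u, rfl⟩ := eq_add_single_of_ne_zero h1
      rw [lowerZ_monomial_add_single, mulZ_monomial, polyInner_monomial' hv, if_neg]
      · simp [polyInner]
      · rintro rfl
        simp at h0
  · obtain ⟨v, rfl⟩ := eq_add_single_of_ne_zero h0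
    rw [lowerZ_monomial_add_single, mulZ_monomial, polyInner_monomial hu]
    by_cases h1 : u k = 0
    · rw [lowerZ_monomial_of_eq_zero d h1, if_neg]
      · simp [polyInner]
      · rintro rfl
        simp at h1
    · obtain ⟨u, rfl⟩ := eq_add_single_of_ne_zero h1
      rw [lowerZ_monomial_add_single, mulZ_monomial, polyInner_monomial' hv]
      by_cases h : u = v
      · subst h
        rw [if_pos rfl, if_pos rfl, map_mul, Complex.conj_ofReal]
        have := monomialWeight_exchange (M := M) d hc j k u
        have h' := congrArg (fun x : ℝ => (x : ℂ)) this
        simp only [Complex.ofReal_mul] at h'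
        rw [Complex.ofReal_mul, Complex.ofReal_mul]
        linear_combination (starRingEnd ℂ) a * b * h'
      · rw [if_neg fun h' => h (add_right_cancel h'), if_neg fun h' => h (add_right_cancel h')]

theorem isAdj_exchangeZ (M : ℕ) (d : Fin n → ℕ) {c : ℝ} (hc : c ≠ 0) (j k : Fin n) :
    IsAdj M (monomialWeight M (fun i => d i + 1) c) (exchangeZ d j k) (exchangeZ d j k) := by
  have h1 := (isAdj_mulZ_lowerZ M d hc (j := j) (k := k)).add
    (isAdj_mulZ_lowerZ M d hc (j := k) (k := j))
  rw [add_comm (mulZ j ∘ₗ lowerZ d k) (mulZ k ∘ₗ lowerZ d j)] at h1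
  exact h1.add (((isAdj_numZ_numZ _ j k).smul _).add
    (((isAdj_numZ _ j).smul _).add ((isAdj_numZ _ k).smul _)))

theorem isAdj_hamZ (M : ℕ) (d : Fin n → ℕ) {c : ℝ} (hc : c ≠ 0) (κ : ℝ) (ε : Fin n → ℝ)
    (j : Fin n) :
    IsAdj M (monomialWeight M (fun i => d i + 1) c) (hamZ M d c κ ε j) (hamZ M d c κ ε j) := by
  have h1 := (isAdj_lowerZ M d hc j).add (isAdj_lowerZ M d hc j).symm
  rw [add_comm (raiseZ M c j) (lowerZ d j)] at h1
  exact h1.add (((isAdj_numZ _ j).smul κ).add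
    (IsAdj.sum _ fun k _ => (isAdj_exchangeZ M d hc j k).smul _))

/-! ### Preservation of total degree at most `M` -/

theorem mem_restrictTotalDegree_of_monomial {M : ℕ}
    {T : MvPolynomial (Fin n) ℂ →ₗ[ℂ] MvPolynomial (Fin n) ℂ}
    (h : ∀ v : Fin n →₀ ℕ, v.degree ≤ M → ∀ a : ℂ,
      T (monomial v a) ∈ restrictTotalDegree (Fin n) ℂ M)
    {F : MvPolynomial (Fin n) ℂ} (hF : F ∈ restrictTotalDegree (Fin n) ℂ M) :
    T F ∈ restrictTotalDegree (Fin n) ℂ M := by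
  rw [← sum_monomial_coeff_lowDegree hF, map_sum]
  exact Submodule.sum_mem _ fun v hv => h v (mem_lowDegree.1 hv) _

theorem lowerZ_monomial_mem {M : ℕ} (d : Fin n → ℕ) (j k : Fin n) {v : Fin n →₀ ℕ}
    (hv : v.degree ≤ M) (a : ℂ) :
    lowerZ d j (monomial v a) ∈ restrictTotalDegree (Fin n) ℂ M ∧
      mulZ k (lowerZ d j (monomial v a)) ∈ restrictTotalDegree (Fin n) ℂ M := by
  by_cases h0 : v j = 0
  · rw [lowerZ_monomial_of_eq_zero d h0, map_zero]
    exact ⟨Submodule.zero_mem _, Submodule.zero_mem _⟩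
  · obtain ⟨v, rfl⟩ := eq_add_single_of_ne_zero h0
    rw [degree_add_single] at hv
    rw [lowerZ_monomial_add_single, mulZ_monomial]
    exact ⟨monomial_mem_restrictTotalDegree (by omega) _,
      monomial_mem_restrictTotalDegree (by rw [degree_add_single]; omega) _⟩

theorem raiseZ_monomial_mem {M : ℕ} (c : ℝ) (j : Fin n) {v : Fin n →₀ ℕ}
    (hv : v.degree ≤ M) (a : ℂ) :
    raiseZ M c j (monomial v a) ∈ restrictTotalDegree (Fin n) ℂ M := by
  rw [raiseZ_monomial]
  rcases hv.lt_or_eq with h | h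
  · exact monomial_mem_restrictTotalDegree (by rw [degree_add_single]; omega) _
  -- In top degree M the factor ∑ z_k∂_k - M annihilates the monomial.
  · simp [h]

theorem hamZ_mem (M : ℕ) (d : Fin n → ℕ) (c κ : ℝ) (ε : Fin n → ℝ) (j : Fin n)
    {F : MvPolynomial (Fin n) ℂ} (hF : F ∈ restrictTotalDegree (Fin n) ℂ M) :
    hamZ M d c κ ε j F ∈ restrictTotalDegree (Fin n) ℂ M := by
  refine mem_restrictTotalDegree_of_monomial (fun v hv a => ?_) hF
  have hm : ∀ b : ℂ, monomial v b ∈ restrictTotalDegree (Fin n) ℂ M :=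
    monomial_mem_restrictTotalDegree hv
  simp only [hamZ, exchangeZ, LinearMap.add_apply, LinearMap.smul_apply, LinearMap.comp_apply,
    LinearMap.sum_apply, numZ_monomial]
  refine add_mem (add_mem (lowerZ_monomial_mem d j j hv a).1 (raiseZ_monomial_mem c j hv a))
    (add_mem (Submodule.smul_mem _ _ (hm _)) (Submodule.sum_mem _ fun k _ =>
      Submodule.smul_mem _ _ (add_mem (add_mem (lowerZ_monomial_mem d j k hv a).2
        (lowerZ_monomial_mem d k j hv a).2) (add_mem (Submodule.smul_mem _ _ (hm _))
          (add_mem (Submodule.smul_mem _ _ (hm _)) (Submodule.smul_mem _ _ (hm _)))))))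

end

/-! ### Lagrange interpolation -/

/-- The residues of `∏ (t - b_l) / ∏ (t - a_l)` at the points `a_k`. -/
noncomputable def lagrangeRes {n : ℕ} (a b : Fin n → ℂ) (k : Fin n) : ℂ :=
  (∏ l, (a k - b l)) / ∏ l ∈ Finset.univ.erase k, (a k - a l)

/-- The difference of the two monic products has degree below n, hence equals its Lagrange
interpolant at the a_k, where the second product vanishes. -/
theorem prod_sub_eq_interpolation {n : ℕ} {a : Fin n → ℂ} (b : Fin n → ℂ)
    (ha : Function.Injective a) (t : ℂ) :
    ∏ l, (t - b l) = ∏ l, (t - a l) +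
      ∑ k, lagrangeRes a b k * ∏ l ∈ Finset.univ.erase k, (t - a l) := by
  set f : Polynomial ℂ := Lagrange.nodal Finset.univ b - Lagrange.nodal Finset.univ a with hf
  have hdeg : f.degree < (Finset.univ : Finset (Fin n)).card := by
    have h := Polynomial.degree_sub_lt_left
      (p := Lagrange.nodal Finset.univ b) (q := Lagrange.nodal Finset.univ a)
      (by rw [Lagrange.degree_nodal, Lagrange.degree_nodal]) Lagrange.nodal_ne_zero
      (by rw [Lagrange.nodal_monic.leadingCoeff, Lagrange.nodal_monic.leadingCoeff])
    rwa [Lagrange.degree_nodal] at h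
  have h := congrArg (Polynomial.eval t) (Lagrange.eq_interpolate (s := Finset.univ) (v := a)
    (fun i _ j _ h => ha h) hdeg)
  rw [Lagrange.interpolate_apply, Polynomial.eval_finsetSum, hf, Polynomial.eval_sub,
    Lagrange.eval_nodal, Lagrange.eval_nodal, sub_eq_iff_eq_add'] at h
  rw [h]
  congr 1
  refine Finset.sum_congr rfl fun k _ => ?_
  rw [Polynomial.eval_mul, Polynomial.eval_C, Polynomial.eval_sub, Lagrange.eval_nodal,
    Lagrange.eval_nodal_at_node (Finset.mem_univ k), sub_zero, Lagrange.basis,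
    Polynomial.eval_prod, lagrangeRes, div_mul_eq_mul_div, mul_div_assoc, ← Finset.prod_div_distrib]
  congr 1
  refine Finset.prod_congr rfl fun l _ => ?_
  simp [Lagrange.basisDivisor, div_eq_inv_mul]

/-- Dividing the interpolation formula by ∏(t - a_l) gives the partial fraction expansion of ∏(t -
b_l)/∏(t - a_l), which vanishes at t = b_l. It is used with the roles of λ and ε in both orders. -/
theorem one_add_sum_lagrangeRes {n : ℕ} {a : Fin n → ℂ} (b : Fin n → ℂ)
    (ha : Function.Injective a) {t : ℂ} (ht : ∀ k, t ≠ a k) {l : Fin n} (hl : t = b l) :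
    1 + ∑ k, lagrangeRes a b k / (t - a k) = 0 := by
  have h := prod_sub_eq_interpolation b ha t
  rw [Finset.prod_eq_zero (Finset.mem_univ l) (sub_eq_zero.2 hl)] at h
  have hne : ∏ l, (t - a l) ≠ 0 := Finset.prod_ne_zero_iff.2 fun k _ => sub_ne_zero.2 (ht k)
  refine (mul_eq_zero.1 ?_).resolve_left hne
  rw [h, mul_add, mul_one, Finset.mul_sum]
  congr 1
  refine Finset.sum_congr rfl fun k _ => ?_
  rw [← Finset.mul_prod_erase _ _ (Finset.mem_univ k)]
  have := sub_ne_zero.2 (ht k)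
  field_simp

/-! ### The algebraic identity behind the change of variables -/

section

variable {n : ℕ} {z ε lam v : Fin n → ℂ} {u : Fin n → Fin n → ℂ} {j : Fin n}

/-- Throughout, u_k(i) stands for 1/(λ_i - ε_k) and v_i for the residue of ∏(t - ε_l)/∏(t - λ_l) at
λ_i. The hypotheses `h1`–`h4` are the only relations used: the two vanishing conditions, partial
fractions, and λu = 1 + εu. Here partial fractions turn the sum into a difference of two sums equal
to 1. -/
theorem sum_mul_u_mul_u_of_ne (h2 : ∀ k, ∑ i, v i * u k i = 1)
    (h3 : ∀ k m, k ≠ m → ∀ i, u k i * u m i = (u k i - u m i) / (ε k - ε m)) {k m : Fin n}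
    (hkm : k ≠ m) : ∑ i, v i * (u k i * u m i) = 0 := by
  have e : ∀ i, v i * (u k i * u m i) = (v i * u k i - v i * u m i) * (ε k - ε m)⁻¹ := fun i => by
    rw [h3 k m hkm i, div_eq_mul_inv]
    ring
  rw [Finset.sum_congr rfl fun i _ => e i, ← Finset.sum_mul, Finset.sum_sub_distrib, h2, h2,
    sub_self, zero_mul]

/-- Multiply `h1` by v_i u_k(i) and sum over i: the cross terms vanish, leaving the square. -/
theorem z_mul_sum_u_sq (h1 : ∀ i, 1 + ∑ k, z k * u k i = 0)
    (h2 : ∀ k, ∑ i, v i * u k i = 1)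
    (h3 : ∀ k m, k ≠ m → ∀ i, u k i * u m i = (u k i - u m i) / (ε k - ε m)) (k : Fin n) :
    z k * ∑ i, v i * (u k i * u k i) = -1 := by
  have h : ∑ i, v i * u k i * (1 + ∑ m, z m * u m i) = 0 :=
    Finset.sum_eq_zero fun i _ => by rw [h1, mul_zero]
  simp only [mul_add, mul_one, Finset.sum_add_distrib, h2, Finset.mul_sum] at h
  rw [Finset.sum_comm, Finset.sum_eq_single k] at h
  · rw [Finset.mul_sum]
    rw [← eq_neg_iff_add_eq_zero.2 (by rw [add_comm]; exact h)]
    exact Finset.sum_congr rfl fun i _ => by ring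
  · intro m _ hm
    have := sum_mul_u_mul_u_of_ne h2 h3 hm.symm
    rw [← mul_zero (z m), ← this, Finset.mul_sum]
    exact Finset.sum_congr rfl fun i _ => by ring
  · simp

/-- The linear functional `X ↦ z_j ∑_i v_i u_j(i) X_i`. -/
noncomputable def weightSum (v w : Fin n → ℂ) (a : ℂ) : (Fin n → ℂ) →ₗ[ℂ] ℂ :=
  ∑ i, (a * (v i * w i)) • LinearMap.proj i

theorem weightSum_apply (v w : Fin n → ℂ) (a : ℂ) (X : Fin n → ℂ) :
    weightSum v w a X = a * ∑ i, v i * w i * X i := by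
  rw [weightSum, LinearMap.sum_apply, Finset.mul_sum]
  refine Finset.sum_congr rfl fun i _ => ?_
  rw [LinearMap.smul_apply, LinearMap.proj_apply, smul_eq_mul]
  ring

variable (h1 : ∀ i, 1 + ∑ k, z k * u k i = 0) (h2 : ∀ k, ∑ i, v i * u k i = 1)
  (h3 : ∀ k m, k ≠ m → ∀ i, u k i * u m i = (u k i - u m i) / (ε k - ε m))
  (h4 : ∀ k i, lam i * u k i = 1 + ε k * u k i)

include h2 in
theorem weightSum_one : weightSum v (u j) (z j) 1 = z j := by
  rw [weightSum_apply]
  simp [h2]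

include h1 h2 h3 in
theorem weightSum_y (k : Fin n) :
    weightSum v (u j) (z j) (z k • u k) = if k = j then -z j else 0 := by
  rw [weightSum_apply]
  have e : ∑ i, v i * u j i * (z k • u k) i = z k * ∑ i, v i * (u j i * u k i) := by
    rw [Finset.mul_sum]
    exact Finset.sum_congr rfl fun i _ => by
      rw [Pi.smul_apply, smul_eq_mul]
      ring
  rw [e]
  split_ifs with h
  · subst h
    rw [z_mul_sum_u_sq h1 h2 h3]
    ring
  · rw [sum_mul_u_mul_u_of_ne h2 h3 (Ne.symm h), mul_zero, mul_zero]

include h1 h2 h3 in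
theorem weightSum_y_mul_y_of_ne {k l : Fin n} (hkl : k ≠ l) :
    weightSum v (u j) (z j) ((z k • u k) * (z l • u l)) =
      (z l * (if k = j then -z j else 0) - z k * (if l = j then -z j else 0)) * (ε k - ε l)⁻¹ := by
  have e : (z k • u k) * (z l • u l) =
      (z l * (ε k - ε l)⁻¹) • (z k • u k) - (z k * (ε k - ε l)⁻¹) • (z l • u l) := by
    funext i
    simp only [Pi.mul_apply, Pi.smul_apply, Pi.sub_apply, smul_eq_mul]
    have := h3 k l hkl i
    rw [div_eq_mul_inv] at this
    linear_combination z k * z l * this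
  rw [e, map_sub, map_smul _ (z l * _), map_smul _ (z k * _), weightSum_y h1 h2 h3,
    weightSum_y h1 h2 h3, smul_eq_mul, smul_eq_mul]
  ring

include h1 in
-- The vectors y_l = z_l u_l sum to -1 by `h1`. Combined with the off-diagonal moments, which
-- partial fractions provide, this determines the moments of the squares y_k².
theorem sum_weightSum_y_mul_y (L : (Fin n → ℂ) →ₗ[ℂ] ℂ) (k : Fin n) :
    ∑ l, L ((z k • u k) * (z l • u l)) = -L (z k • u k) := by
  rw [← map_sum, ← Finset.mul_sum, ← map_neg]
  congr 1
  funext i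
  have : (∑ l, z l • u l) i = -1 := by
    rw [Finset.sum_apply]
    simp only [Pi.smul_apply, smul_eq_mul]
    linear_combination h1 i
  rw [Pi.mul_apply, this, Pi.neg_apply, mul_neg_one]

include h1 h2 h3 in
theorem weightSum_y_sq_of_ne {k : Fin n} (hk : k ≠ j) :
    weightSum v (u j) (z j) ((z k • u k) * (z k • u k)) = z j * z k * (ε j - ε k)⁻¹ := by
  have h := sum_weightSum_y_mul_y h1 (weightSum v (u j) (z j)) k
  rw [weightSum_y h1 h2 h3, if_neg hk, neg_zero, Finset.sum_eq_add k j hk] at h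
  · rw [weightSum_y_mul_y_of_ne h1 h2 h3 hk, if_neg hk, if_pos rfl] at h
    rw [← neg_sub (ε k), inv_neg]
    linear_combination h
  · intro l _ hl
    rw [weightSum_y_mul_y_of_ne h1 h2 h3 hl.1.symm, if_neg hk, if_neg hl.2]
    ring
  · simp
  · simp

include h1 h2 h3 in
theorem weightSum_y_sq_self :
    weightSum v (u j) (z j) ((z j • u j) * (z j • u j)) =
      z j + ∑ k ∈ Finset.univ.erase j, z j * z k * (ε j - ε k)⁻¹ := by
  have h := sum_weightSum_y_mul_y h1 (weightSum v (u j) (z j)) j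
  rw [weightSum_y h1 h2 h3, if_pos rfl, neg_neg,
    ← Finset.add_sum_erase _ _ (Finset.mem_univ j)] at h
  rw [eq_sub_iff_add_eq.2 h, sub_eq_add_neg, ← Finset.sum_neg_distrib]
  congr 1
  refine Finset.sum_congr rfl fun k hk => ?_
  have hk' := (Finset.mem_erase.1 hk).1
  rw [weightSum_y_mul_y_of_ne h1 h2 h3 hk'.symm, if_neg hk', if_pos rfl]
  ring

include h1 h2 h3 in
/-- The sum over `l` of the second moments against arbitrary coefficients, for `k ≠ j`. -/
theorem sum_mul_weightSum_of_ne (g : Fin n → ℂ) {k : Fin n} (hk : k ≠ j) :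
    ∑ l, g l * weightSum v (u j) (z j) ((z l • u l) * (z k • u k)) =
      (g k - g j) * (z j * z k * (ε j - ε k)⁻¹) := by
  rw [Finset.sum_eq_add k j hk]
  · rw [weightSum_y_sq_of_ne h1 h2 h3 hk, weightSum_y_mul_y_of_ne h1 h2 h3 hk.symm, if_neg hk,
      if_pos rfl]
    ring
  · intro l _ hl
    rw [weightSum_y_mul_y_of_ne h1 h2 h3 hl.1, if_neg hk, if_neg hl.2]
    ring
  · simp
  · simp

include h1 h2 h3 in
theorem sum_mul_weightSum_self (g : Fin n → ℂ) :
    ∑ l, g l * weightSum v (u j) (z j) ((z l • u l) * (z j • u j)) =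
      g j * z j + ∑ k ∈ Finset.univ.erase j, (g j - g k) * (z j * z k * (ε j - ε k)⁻¹) := by
  rw [← Finset.add_sum_erase _ _ (Finset.mem_univ j), weightSum_y_sq_self h1 h2 h3, mul_add,
    Finset.mul_sum, add_assoc, ← Finset.sum_add_distrib]
  congr 1
  refine Finset.sum_congr rfl fun k hk => ?_
  have hk' := (Finset.mem_erase.1 hk).1
  rw [weightSum_y_mul_y_of_ne h1 h2 h3 hk', if_neg hk', if_pos rfl, ← neg_sub (ε j), inv_neg]
  ring

include h1 h2 h3 h4 in
theorem weightSum_lam_mul_y (k : Fin n) :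
    weightSum v (u j) (z j) (lam * (z k • u k)) =
      z j * z k + if k = j then -(ε j * z j) else 0 := by
  have e : lam * (z k • u k) = z k • 1 + ε k • (z k • u k) := by
    funext i
    simp only [Pi.mul_apply, Pi.smul_apply, Pi.add_apply, Pi.one_apply, smul_eq_mul]
    linear_combination z k * h4 k i
  rw [e, map_add, map_smul, map_smul, weightSum_y h1 h2 h3, weightSum_one h2, smul_eq_mul,
    smul_eq_mul]
  split_ifs with h
  · rw [h]
    ring
  · ring

include h1 h2 h3 h4 in
-- Here y_k(i) = z_k u_k(i) plays the role of ∂z_k/∂λ_i, G and f of the second and first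
-- z-derivatives of the wave function, and D_l of d_l/z_l. The expression is then a combination of
-- 1, y_k, λy_k and y_k y_l, whose moments are all known.
theorem weightSum_hamiltonian (G : Fin n → Fin n → ℂ) (hG : ∀ k l, G k l = G l k)
    (f D : Fin n → ℂ) (c κ m : ℂ) :
    weightSum v (u j) (z j) (fun i =>
      ∑ k, (∑ l, G l k * (z l * u l i)) * (z k * u k i) +
        (c * lam i - κ - ∑ l, D l * (z l * u l i)) * ∑ k, f k * (z k * u k i) - m) =
      G j j * z j + ∑ k ∈ Finset.univ.erase j,
          (G j j - 2 * G j k + G k k) * (z j * z k * (ε j - ε k)⁻¹) +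
        (c * z j * ∑ k, z k * f k + (κ - c * ε j) * (z j * f j) - D j * z j * f j -
          ∑ k ∈ Finset.univ.erase j,
            (D j - D k) * (z j * z k * (ε j - ε k)⁻¹) * (f j - f k)) - m * z j := by
  set L := weightSum v (u j) (z j) with hL
  have e : (fun i => ∑ k, (∑ l, G l k * (z l * u l i)) * (z k * u k i) +
        (c * lam i - κ - ∑ l, D l * (z l * u l i)) * ∑ k, f k * (z k * u k i) - m) =
      ∑ k, ∑ l, G l k • ((z l • u l) * (z k • u k)) +
        ∑ k, f k • (c • (lam * (z k • u k)) - κ • (z k • u k) -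
          ∑ l, D l • ((z l • u l) * (z k • u k))) - m • (1 : Fin n → ℂ) := by
    funext i
    simp only [Pi.mul_apply, Pi.smul_apply, Pi.add_apply, Pi.sub_apply, Pi.one_apply, smul_eq_mul,
      Finset.sum_apply, mul_one, Finset.sum_mul, Finset.mul_sum]
    congr 2
    · exact Finset.sum_congr rfl fun k _ => Finset.sum_congr rfl fun l _ => by ring
    · refine Finset.sum_congr rfl fun k _ => ?_
      rw [mul_sub, Finset.mul_sum, sub_mul, Finset.sum_mul]
      congr 1
      · ring
      · exact Finset.sum_congr rfl fun l _ => by ring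
  rw [e]
  simp only [map_add, map_sub, map_sum, map_smul, smul_eq_mul]
  have hone : L 1 = z j := weightSum_one h2
  have hG2 : ∑ k, ∑ l, G l k * L ((z l • u l) * (z k • u k)) =
      G j j * z j + ∑ k ∈ Finset.univ.erase j,
          (G j j - 2 * G j k + G k k) * (z j * z k * (ε j - ε k)⁻¹) := by
    rw [← Finset.add_sum_erase _ _ (Finset.mem_univ j),
      sum_mul_weightSum_self h1 h2 h3 (fun l => G l j), add_assoc, ← Finset.sum_add_distrib]
    congr 1
    refine Finset.sum_congr rfl fun k hk => ?_
    rw [sum_mul_weightSum_of_ne h1 h2 h3 (fun l => G l k) (Finset.mem_erase.1 hk).1, hG k j]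
    ring
  have hf2 : ∑ k, f k * (c * L (lam * (z k • u k)) - κ * L (z k • u k) -
          ∑ l, D l * L ((z l • u l) * (z k • u k))) =
      c * z j * ∑ k, z k * f k + (κ - c * ε j) * (z j * f j) - D j * z j * f j -
          ∑ k ∈ Finset.univ.erase j,
            (D j - D k) * (z j * z k * (ε j - ε k)⁻¹) * (f j - f k) := by
    rw [← Finset.add_sum_erase _ _ (Finset.mem_univ j),
      ← Finset.add_sum_erase _ (fun k => z k * f k) (Finset.mem_univ j),
      weightSum_lam_mul_y h1 h2 h3 h4, weightSum_y h1 h2 h3, sum_mul_weightSum_self h1 h2 h3 D,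
      if_pos rfl, if_pos rfl]
    have : ∀ k ∈ Finset.univ.erase j, f k * (c * L (lam * (z k • u k)) - κ * L (z k • u k) -
          ∑ l, D l * L ((z l • u l) * (z k • u k))) =
        c * z j * (z k * f k) + (D j - D k) * (z j * z k * (ε j - ε k)⁻¹) * f k := by
      intro k hk
      have hk' := (Finset.mem_erase.1 hk).1
      rw [weightSum_lam_mul_y h1 h2 h3 h4, weightSum_y h1 h2 h3,
        sum_mul_weightSum_of_ne h1 h2 h3 D hk', if_neg hk', if_neg hk']
      ring
    rw [Finset.sum_congr rfl this, Finset.sum_add_distrib, ← Finset.mul_sum]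
    simp only [mul_sub (_ * _ : ℂ) (f j), Finset.sum_sub_distrib, ← Finset.sum_mul]
    ring
  have hsm : ∀ k, z k * L (u k) = L (z k • u k) := fun k => (map_smul L (z k) (u k)).symm
  simp only [hsm]
  rw [hG2, hf2, hone]

end

/-! ### The coordinates `z` -/

/-- The coordinates `z_k = ∏_l (ε_k - λ_l) / ∏_{l ≠ k} (ε_k - ε_l)`. -/
noncomputable def zVar {n : ℕ} (ε : Fin n → ℝ) (lam : Fin n → ℂ) : Fin n → ℂ :=
  lagrangeRes (fun k => (ε k : ℂ)) lam

/-- The derivative of `z_k` with respect to `λ_i`. -/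
noncomputable def zSlope {n : ℕ} (ε : Fin n → ℝ) (lam : Fin n → ℂ) (i k : Fin n) : ℂ :=
  -(∏ l ∈ Finset.univ.erase i, ((ε k : ℂ) - lam l)) /
    ∏ l ∈ Finset.univ.erase k, ((ε k : ℂ) - (ε l : ℂ))

section

variable {n : ℕ}

open MvPolynomial

/-- Each z_k is affine in each single λ_i, so its slope does not involve λ_i and second
λ_i-derivatives of z_k drop out. -/
theorem zSlope_update (ε : Fin n → ℝ) (lam : Fin n → ℂ) (i : Fin n) (t : ℂ) :
    zSlope ε (Function.update lam i t) i = zSlope ε lam i := by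
  funext k
  rw [zSlope, zSlope]
  congr 2
  refine Finset.prod_congr rfl fun l hl => ?_
  rw [Function.update_of_ne (Finset.mem_erase.1 hl).1]

theorem zVar_update (ε : Fin n → ℝ) (lam : Fin n → ℂ) (i k : Fin n) (t : ℂ) :
    zVar ε (Function.update lam i t) k = (t - ε k) * zSlope ε lam i k := by
  rw [zVar, lagrangeRes, zSlope, ← Finset.mul_prod_erase _ _ (Finset.mem_univ i),
    Function.update_self]
  have : ∏ l ∈ Finset.univ.erase i, ((ε k : ℂ) - Function.update lam i t l) =
      ∏ l ∈ Finset.univ.erase i, ((ε k : ℂ) - lam l) :=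
    Finset.prod_congr rfl fun l hl => by rw [Function.update_of_ne (Finset.mem_erase.1 hl).1]
  rw [this]
  ring

theorem zVar_eq (ε : Fin n → ℝ) (lam : Fin n → ℂ) (i k : Fin n) :
    zVar ε lam k = (lam i - ε k) * zSlope ε lam i k := by
  have := zVar_update ε lam i k (lam i)
  rwa [Function.update_eq_self] at this

theorem hasDerivAt_eval (F : MvPolynomial (Fin n) ℂ) {γ : ℂ → Fin n → ℂ} {γ' : Fin n → ℂ} {t : ℂ}
    (h : ∀ k, HasDerivAt (fun s => γ s k) (γ' k) t) :
    HasDerivAt (fun s => eval (γ s) F) (∑ k, eval (γ t) (pderiv k F) * γ' k) t := by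
  induction F using MvPolynomial.induction_on with
  | C a => simpa using hasDerivAt_const t a
  | add p q hp hq =>
    simp only [map_add, add_mul, Finset.sum_add_distrib]
    exact hp.add hq
  | mul_X p l hp =>
    simp only [map_mul, eval_X]
    refine (hp.mul (h l)).congr_deriv ?_
    have : ∀ k, eval (γ t) (pderiv k (p * X l)) * γ' k =
        eval (γ t) (pderiv k p) * γ' k * γ t l + (if k = l then eval (γ t) p * γ' k else 0) := by
      intro k
      rw [pderiv_mul, map_add, map_mul, map_mul, eval_X, pderiv_X, Pi.single_apply]
      by_cases hk : k = l
      · subst hk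
        simp
        ring
      · rw [if_neg hk, if_neg (Ne.symm hk), map_zero]
        ring
    rw [Finset.sum_congr rfl fun k _ => this k, Finset.sum_add_distrib, ← Finset.sum_mul]
    simp

theorem hasDerivAt_eval_zVar (F : MvPolynomial (Fin n) ℂ) (ε : Fin n → ℝ) (lam : Fin n → ℂ)
    (i : Fin n) :
    HasDerivAt (fun t => eval (zVar ε (Function.update lam i t)) F)
      (∑ k, eval (zVar ε lam) (pderiv k F) * zSlope ε lam i k) (lam i) := by
  have h := hasDerivAt_eval F (γ := fun t => zVar ε (Function.update lam i t))
    (γ' := zSlope ε lam i) (t := lam i) fun k => by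
      simp only [zVar_update]
      simpa using ((hasDerivAt_id (lam i)).sub_const (ε k : ℂ)).mul_const (zSlope ε lam i k)
  simpa only [Function.update_eq_self] using h

theorem pd_eval_zVar (F : MvPolynomial (Fin n) ℂ) (ε : Fin n → ℝ) (i : Fin n) :
    pd i (fun lam : Fin n → ℂ => eval (zVar ε lam) F) = fun lam =>
      ∑ k, eval (zVar ε lam) (pderiv k F) * zSlope ε lam i k :=
  funext fun lam => (hasDerivAt_eval_zVar F ε lam i).deriv

theorem pd_pd_eval_zVar (F : MvPolynomial (Fin n) ℂ) (ε : Fin n → ℝ) (i : Fin n) :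
    pd i (pd i (fun lam : Fin n → ℂ => eval (zVar ε lam) F)) = fun lam =>
      ∑ k, (∑ l, eval (zVar ε lam) (pderiv l (pderiv k F)) * zSlope ε lam i l) *
        zSlope ε lam i k := by
  rw [pd_eval_zVar]
  funext lam
  refine HasDerivAt.deriv ?_
  simp only [zSlope_update]
  exact HasDerivAt.fun_sum fun k _ => (hasDerivAt_eval_zVar (pderiv k F) ε lam i).mul_const _

theorem pderiv_comm (i j : Fin n) (F : MvPolynomial (Fin n) ℂ) :
    pderiv i (pderiv j F) = pderiv j (pderiv i F) := by
  have h : ⁅(pderiv i : Derivation ℂ (MvPolynomial (Fin n) ℂ) (MvPolynomial (Fin n) ℂ)),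
      (pderiv j : Derivation ℂ (MvPolynomial (Fin n) ℂ) (MvPolynomial (Fin n) ℂ))⁆ = 0 := by
    refine derivation_ext fun k => ?_
    rw [Derivation.commutator_apply, pderiv_X, pderiv_X, Pi.single_apply, Pi.single_apply]
    split_ifs <;> simp
  rw [← sub_eq_zero, ← Derivation.commutator_apply, h, Derivation.zero_apply]

theorem eval_hamZ (M : ℕ) (d : Fin n → ℕ) (c κ : ℝ) (ε : Fin n → ℝ) (j : Fin n)
    (F : MvPolynomial (Fin n) ℂ) (z : Fin n → ℂ) :
    eval z (hamZ M d c κ ε j F) =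
      z j * eval z (pderiv j (pderiv j F)) - d j * eval z (pderiv j F) +
        c * (z j * (∑ k, z k * eval z (pderiv k F) - M * eval z F)) +
      (κ * (z j * eval z (pderiv j F)) + ∑ k ∈ Finset.univ.erase j, ((ε j : ℂ) - ε k)⁻¹ *
        (z k * (z j * eval z (pderiv j (pderiv j F)) - d j * eval z (pderiv j F)) +
          z j * (z k * eval z (pderiv k (pderiv k F)) - d k * eval z (pderiv k F)) +
          (-2 * (z j * z k * eval z (pderiv j (pderiv k F))) +
            (d k * (z j * eval z (pderiv j F)) + d j * (z k * eval z (pderiv k F)))))) := by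
  simp only [hamZ, exchangeZ, lowerZ, raiseZ, numZ, LinearMap.add_apply, LinearMap.sub_apply,
    LinearMap.smul_apply, LinearMap.comp_apply, LinearMap.sum_apply, mulZ_apply, dZ_apply, map_add,
    map_sub, map_mul, map_sum, smul_eval, eval_X, LinearMap.id_apply]
  refine congrArg₂ _ (congrArg₂ _ rfl (by rw [← Finset.mul_sum, ← mul_sub]))
    (congrArg₂ _ rfl (Finset.sum_congr rfl fun k hk => ?_))
  rw [pderiv_mul, pderiv_X, Pi.single_eq_of_ne (Finset.mem_erase.1 hk).1]
  push_cast
  simp only [zero_mul, zero_add, map_mul, eval_X]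
  ring

theorem two_div_mul_aFun (d : Fin n → ℕ) {hb g : ℝ} (hhb : hb ≠ 0) (hg : g ≠ 0) (ω : ℝ)
    (ε : Fin n → ℝ) (t : ℂ) :
    2 / (hb : ℂ) * aFun d hb g ω ε t =
      4 / (hb * g ^ 2) * t - 2 * ω / (hb * g ^ 2) - ∑ l, (d l : ℂ) * (t - ε l)⁻¹ := by
  have h1 : (hb : ℂ) ≠ 0 := Complex.ofReal_ne_zero.2 hhb
  have h2 : (g : ℂ) ≠ 0 := Complex.ofReal_ne_zero.2 hg
  rw [aFun, mul_sub, Finset.mul_sum]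
  congr 1
  · field_simp
    ring
  · refine Finset.sum_congr rfl fun l _ => ?_
    rw [div_eq_mul_inv _ (t - _)]
    field_simp

/-- In the coordinates `z` the operator `H_j` is a polynomial differential operator. -/
theorem opH_eval_zVar (M : ℕ) (d : Fin n → ℕ) {hb g : ℝ} (hhb : hb ≠ 0) (hg : g ≠ 0) (ω : ℝ)
    (ε : Fin n → ℝ) (hε : Function.Injective ε) (j : Fin n)
    (F : MvPolynomial (Fin n) ℂ) {lam : Fin n → ℂ} (hlam : Function.Injective lam) (hne : ∀ i k, lam i ≠ ε k) :
    opH M d hb g ω ε j (fun lam => eval (zVar ε lam) F) lam =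
      eval (zVar ε lam) (hamZ M d (4 / (hb * g ^ 2))
        (2 * ω / (hb * g ^ 2) - 4 / (hb * g ^ 2) * ε j) ε j F) := by
  set z := zVar ε lam with hz
  set εc : Fin n → ℂ := fun k => (ε k : ℂ) with hεc
  have hεi : Function.Injective εc := fun a b h => hε (Complex.ofReal_injective h)
  set u : Fin n → Fin n → ℂ := fun k i => (lam i - ε k)⁻¹ with hu
  set v : Fin n → ℂ := lagrangeRes lam εc with hv
  have hsub : ∀ i k, lam i - ε k ≠ 0 := fun i k => sub_ne_zero.2 (hne i k)
  have h1 : ∀ i, 1 + ∑ k, z k * u k i = 0 := fun i => by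
    have := one_add_sum_lagrangeRes lam hεi (t := lam i) (fun k => hne i k) rfl
    simp only [div_eq_mul_inv] at this
    exact this
  have h2 : ∀ k, ∑ i, v i * u k i = 1 := fun k => by
    have := one_add_sum_lagrangeRes εc hlam (t := εc k) (fun i => (hne i k).symm) rfl
    rw [add_eq_zero_iff_eq_neg] at this
    rw [this, ← Finset.sum_neg_distrib]
    refine Finset.sum_congr rfl fun i _ => ?_
    rw [← neg_sub (lam i), div_neg, neg_neg, div_eq_mul_inv]
  have h3 : ∀ k m, k ≠ m → ∀ i, u k i * u m i = (u k i - u m i) / (εc k - εc m) := by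
    intro k m hkm i
    have e := sub_ne_zero.2 (hεi.ne hkm)
    have e1 := hsub i k
    have e2 := hsub i m
    simp only [hu, hεc] at e ⊢
    field_simp
    ring
  have h4 : ∀ k i, lam i * u k i = 1 + εc k * u k i := by
    intro k i
    have e1 := hsub i k
    simp only [hu, hεc]
    field_simp
    ring
  have hslope : ∀ i k, zSlope ε lam i k = z k * u k i := by
    intro i k
    have e1 := hsub i k
    rw [hz, zVar_eq ε lam i k]
    simp only [hu]
    field_simp
  have hz0 : ∀ k, z k ≠ 0 := by
    intro k
    rw [hz, zVar, lagrangeRes]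
    refine div_ne_zero (Finset.prod_ne_zero_iff.2 fun l _ => ?_)
      (Finset.prod_ne_zero_iff.2 fun l hl => ?_)
    · exact sub_ne_zero.2 (hne l k).symm
    · exact sub_ne_zero.2 (hεi.ne (Finset.mem_erase.1 hl).1.symm)
  -- The poles of a(λ_i) are written as (d_l/z_l) y_l, which puts the first-order part in the form
  -- required by `weightSum_hamiltonian`; z_l ≠ 0 because λ avoids the ε_k.
  have hopV : ∀ i, opV M d hb g ω ε i (fun lam => eval (zVar ε lam) F) lam =
      ∑ k, (∑ l, eval z (pderiv l (pderiv k F)) * (z l * u l i)) * (z k * u k i) +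
        (4 / (hb * g ^ 2) * lam i - 2 * ω / (hb * g ^ 2) -
          ∑ l, (d l / z l) * (z l * u l i)) * ∑ k, eval z (pderiv k F) * (z k * u k i) -
        4 / (hb * g ^ 2) * M * eval z F := by
    intro i
    rw [opV, pd_pd_eval_zVar, pd_eval_zVar, two_div_mul_aFun d hhb hg]
    simp only [hslope]
    congr 1
    · congr 3
      refine Finset.sum_congr rfl fun l _ => ?_
      have := hz0 l
      simp only [hu]
      field_simp
    · ring
  -- Extracting the factor λ_i - ε_j turns the coefficient of V_i into v_i u_j(i), and the prefactor
  -- is z_j.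
  have hH : opH M d hb g ω ε j (fun lam => eval (zVar ε lam) F) lam =
      weightSum v (u j) (z j) fun i =>
        opV M d hb g ω ε i (fun lam => eval (zVar ε lam) F) lam := by
    rw [weightSum_apply, opH]
    congr 1
    refine Finset.sum_congr rfl fun i _ => ?_
    congr 1
    rw [hv, lagrangeRes, ← Finset.mul_prod_erase _ _ (Finset.mem_univ j)]
    have := hsub i j
    simp only [hu, hεc]
    field_simp
  rw [hH, funext hopV, weightSum_hamiltonian h1 h2 h3 h4 _
    (fun k l => congrArg (eval z) (pderiv_comm k l F)), eval_hamZ]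
  have hS : ∑ k ∈ Finset.univ.erase j, ((ε j : ℂ) - ε k)⁻¹ *
        (z k * (z j * eval z (pderiv j (pderiv j F)) - d j * eval z (pderiv j F)) +
          z j * (z k * eval z (pderiv k (pderiv k F)) - d k * eval z (pderiv k F)) +
          (-2 * (z j * z k * eval z (pderiv j (pderiv k F))) +
            (d k * (z j * eval z (pderiv j F)) + d j * (z k * eval z (pderiv k F))))) =
      ∑ k ∈ Finset.univ.erase j, (eval z (pderiv j (pderiv j F)) -
          2 * eval z (pderiv j (pderiv k F)) + eval z (pderiv k (pderiv k F))) *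
            (z j * z k * (εc j - εc k)⁻¹) -
        ∑ k ∈ Finset.univ.erase j, (d j / z j - d k / z k) * (z j * z k * (εc j - εc k)⁻¹) *
          (eval z (pderiv j F) - eval z (pderiv k F)) := by
    rw [← Finset.sum_sub_distrib]
    refine Finset.sum_congr rfl fun k _ => ?_
    have ej : (d j : ℂ) / z j * z j = d j := div_mul_cancel₀ _ (hz0 j)
    have ek : (d k : ℂ) / z k * z k = d k := div_mul_cancel₀ _ (hz0 k)
    simp only [hεc]
    linear_combination ((ε j : ℂ) - ε k)⁻¹ * (eval z (pderiv j F) - eval z (pderiv k F)) *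
      (z k * ej - z j * ek)
  have ej : (d j : ℂ) / z j * z j = d j := div_mul_cancel₀ _ (hz0 j)
  rw [hS]
  push_cast
  linear_combination (-eval z (pderiv j F)) * ej

end

/-! ### Wave functions as polynomials in `z` -/

section

variable {n : ℕ}

open MvPolynomial

/-- The polynomial in `z` that represents `∏_i (λ_i - μ)`. -/
noncomputable def linearFactorZ (ε : Fin n → ℝ) (μ : ℂ) : MvPolynomial (Fin n) ℂ :=
  C ((-1) ^ n * ∏ l, (μ - ε l)) +
    ∑ k, C ((-1) ^ n * ∏ l ∈ Finset.univ.erase k, (μ - ε l)) * X k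

theorem totalDegree_linearFactorZ_le (ε : Fin n → ℝ) (μ : ℂ) :
    (linearFactorZ ε μ).totalDegree ≤ 1 := by
  refine (totalDegree_add _ _).trans (max_le ((totalDegree_C _).trans_le zero_le_one)
    (totalDegree_finsetSum_le fun k _ => ?_))
  refine (totalDegree_mul _ _).trans ?_
  rw [totalDegree_C, totalDegree_X]

/-- Interpolation expresses ∏(μ - λ_i) through its residues at the ε_k, which are the z_k. -/
theorem eval_linearFactorZ {ε : Fin n → ℝ} (hε : Function.Injective ε) (μ : ℂ)
    (lam : Fin n → ℂ) : eval (zVar ε lam) (linearFactorZ ε μ) = ∏ i, (lam i - μ) := by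
  have hεi : Function.Injective fun k => (ε k : ℂ) :=
    fun a b h => hε (Complex.ofReal_injective h)
  have h : ∏ i, (lam i - μ) = (-1) ^ n * ∏ i, (μ - lam i) := by
    have := Finset.prod_const (s := (Finset.univ : Finset (Fin n))) (-1 : ℂ)
    rw [Finset.card_univ, Fintype.card_fin] at this
    rw [← this, ← Finset.prod_mul_distrib]
    exact Finset.prod_congr rfl fun i _ => by ring
  rw [h, prod_sub_eq_interpolation lam hεi μ, linearFactorZ, map_add, eval_C, map_sum, mul_add,
    Finset.mul_sum]
  congr 1
  refine Finset.sum_congr rfl fun k _ => ?_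
  rw [map_mul, eval_C, eval_X, zVar]
  ring

/-- The wave functions are the polynomials in `z` of total degree at most `M`. -/
theorem exists_eval_zVar_of_mem_waveFunctions {M : ℕ} {ε : Fin n → ℝ}
    (hε : Function.Injective ε) {f : (Fin n → ℂ) → ℂ} (hf : f ∈ waveFunctions n M) :
    ∃ F ∈ restrictTotalDegree (Fin n) ℂ M, f = fun lam => eval (zVar ε lam) F := by
  induction hf using Submodule.span_induction with
  | mem f hf =>
    obtain ⟨ψ, hψ, rfl⟩ := hf
    -- Factor ψ over ℂ and exchange the products over i and over roots: each root contributes one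
    -- affine factor in z, so the degree is at most the number of roots.
    refine ⟨C (ψ.leadingCoeff ^ n) * (ψ.roots.map (linearFactorZ ε)).prod, ?_, ?_⟩
    · rw [mem_restrictTotalDegree]
      refine (totalDegree_mul _ _).trans ?_
      rw [totalDegree_C, zero_add]
      refine (totalDegree_multiset_prod _).trans ?_
      refine (Multiset.sum_le_card_nsmul _ 1 fun m hm => ?_).trans ?_
      · simp only [Multiset.map_map, Multiset.mem_map, Function.comp_apply] at hm
        obtain ⟨μ, -, rfl⟩ := hm
        exact totalDegree_linearFactorZ_le ε μ
      · simpa using (Polynomial.card_roots' ψ).trans hψ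
    · funext lam
      have h : ∀ t, ψ.eval t = ψ.leadingCoeff * (ψ.roots.map fun μ => t - μ).prod := fun t =>
        (IsAlgClosed.splits ψ).eval_eq_prod_roots t
      simp only [h, Finset.prod_mul_distrib, Finset.prod_const, Finset.card_univ,
        Fintype.card_fin, map_mul, eval_C]
      congr 1
      rw [← Multiset.prod_hom, Multiset.map_map, ← Multiset.prod_map_prod]
      refine congrArg Multiset.prod (Multiset.map_congr rfl fun μ _ => ?_)
      rw [Function.comp_apply, eval_linearFactorZ hε]
  | zero => exact ⟨0, Submodule.zero_mem _, by simp; rfl⟩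
  | add f h _ _ hf hh =>
    obtain ⟨F, hF, rfl⟩ := hf
    obtain ⟨H, hH, rfl⟩ := hh
    exact ⟨F + H, Submodule.add_mem _ hF hH, by simp; rfl⟩
  | smul a f _ hf =>
    obtain ⟨F, hF, rfl⟩ := hf
    exact ⟨a • F, Submodule.smul_mem _ a hF, by simp [smul_eval]; rfl⟩

end

/-! ### The Jacobian determinant of the coordinates `z` -/

section

variable {n : ℕ}

open Matrix in
theorem vandermonde_mul_coeff (v : Fin n → ℂ) (p : Fin n → Polynomial ℂ)
    (hp : ∀ i, (p i).natDegree < n) :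
    vandermonde v * of (fun q i : Fin n => (p i).coeff q) = of fun k i => (p i).eval (v k) := by
  ext k i
  rw [mul_apply, of_apply, Polynomial.eval_eq_sum_range' (hp i),
    ← Fin.sum_univ_eq_sum_range fun q => (p i).coeff q * v k ^ q]
  exact Finset.sum_congr rfl fun q _ => by rw [vandermonde_apply, of_apply, mul_comm]

theorem norm_det_vandermonde (v : Fin n → ℂ) :
    ‖(Matrix.vandermonde v).det‖ = ‖vandermondeW v‖ := by
  rw [Matrix.det_vandermonde, vandermondeW]
  simp only [norm_prod]
  exact Finset.prod_congr rfl fun i _ => Finset.prod_congr rfl fun j _ => norm_sub_rev _ _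

theorem vandermondeW_ne_zero {v : Fin n → ℂ} (hv : Function.Injective v) : vandermondeW v ≠ 0 :=
  Finset.prod_ne_zero_iff.2 fun _ _ => Finset.prod_ne_zero_iff.2 fun _ hj =>
    sub_ne_zero.2 (hv.ne (Finset.mem_Ioi.1 hj).ne)

theorem prod_norm_prod_erase_sub (v : Fin n → ℂ) :
    ∏ i, ‖∏ l ∈ Finset.univ.erase i, (v i - v l)‖ = ‖vandermondeW v‖ ^ 2 := by
  have h : ∀ i, ‖∏ l ∈ Finset.univ.erase i, (v i - v l)‖ =
      (∏ l ∈ Finset.Ioi i, ‖v i - v l‖) * ∏ l ∈ Finset.Iio i, ‖v i - v l‖ := by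
    intro i
    rw [norm_prod, ← Finset.prod_union (Finset.disjoint_left.2 fun l h1 h2 =>
      lt_asymm (Finset.mem_Ioi.1 h1) (Finset.mem_Iio.1 h2))]
    refine Finset.prod_congr ?_ fun _ _ => rfl
    ext l
    simp [ne_comm]
  rw [Finset.prod_congr rfl fun i _ => h i, Finset.prod_mul_distrib, sq, vandermondeW]
  simp only [norm_prod]
  congr 1
  rw [Finset.prod_comm' (t' := Finset.univ) (s' := fun i => Finset.Ioi i) (by simp)]
  exact Finset.prod_congr rfl fun i _ => Finset.prod_congr rfl fun j _ => norm_sub_rev _ _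

open Matrix in
-- The entries are values at a_k of p_i = ∏_{l≠i}(t - λ_l), so the matrix is Vandermonde(a) times a
-- coefficient matrix independent of a. Taking a = λ makes it diagonal and gives the coefficient
-- determinant modulus |W(λ)|.
theorem norm_det_prod_erase_sub (a : Fin n → ℂ) {lam : Fin n → ℂ}
    (hlam : Function.Injective lam) :
    ‖(of fun k i : Fin n => ∏ l ∈ Finset.univ.erase i, (a k - lam l)).det‖ =
      ‖vandermondeW a‖ * ‖vandermondeW lam‖ := by
  set p : Fin n → Polynomial ℂ := fun i =>
    ∏ l ∈ Finset.univ.erase i, (Polynomial.X - Polynomial.C (lam l)) with hp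
  have hdeg : ∀ i, (p i).natDegree < n := fun i => by
    rw [hp, Polynomial.natDegree_prod_of_monic _ _ fun l _ => Polynomial.monic_X_sub_C _]
    simp only [Polynomial.natDegree_X_sub_C, Finset.sum_const, smul_eq_mul, mul_one]
    exact (Finset.card_erase_lt_of_mem (Finset.mem_univ i)).trans_eq (by simp)
  have heval : ∀ b : Fin n → ℂ, (vandermonde b).det *
      (of fun q i : Fin n => (p i).coeff q).det =
      (of fun k i : Fin n => ∏ l ∈ Finset.univ.erase i, (b k - lam l)).det := fun b => by
    rw [← det_mul, vandermonde_mul_coeff b p hdeg]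
    simp [hp, Polynomial.eval_prod]
  have hdiag : (of fun k i : Fin n => ∏ l ∈ Finset.univ.erase i, (lam k - lam l)) =
      diagonal fun i => ∏ l ∈ Finset.univ.erase i, (lam i - lam l) := by
    ext k i
    rw [of_apply, diagonal_apply]
    split_ifs with h
    · rw [h]
    · exact Finset.prod_eq_zero (Finset.mem_erase.2 ⟨h, Finset.mem_univ k⟩) (sub_self _)
  have h1 := congrArg norm (heval lam)
  rw [hdiag, det_diagonal, norm_prod, prod_norm_prod_erase_sub, norm_mul, norm_det_vandermonde, sq]
    at h1
  have h2 := mul_left_cancel₀ (norm_ne_zero_iff.2 (vandermondeW_ne_zero hlam)) h1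
  rw [← heval a, norm_mul, norm_det_vandermonde, h2]

/-- The Jacobian matrix of the coordinates `z`. -/
noncomputable def zJacobian (ε : Fin n → ℝ) (lam : Fin n → ℂ) : Matrix (Fin n) (Fin n) ℂ :=
  Matrix.of fun k i => zSlope ε lam i k

theorem norm_det_zJacobian {ε : Fin n → ℝ} (hε : Function.Injective ε) {lam : Fin n → ℂ}
    (hlam : Function.Injective lam) :
    ‖(zJacobian ε lam).det‖ = ‖vandermondeW lam‖ / ‖vandermondeW fun k => (ε k : ℂ)‖ := by
  have hW : ‖vandermondeW fun k => (ε k : ℂ)‖ ≠ 0 :=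
    norm_ne_zero_iff.2 (vandermondeW_ne_zero fun a b h => hε (Complex.ofReal_injective h))
  have h : zJacobian ε lam =
      Matrix.diagonal (fun k => -(∏ l ∈ Finset.univ.erase k, ((ε k : ℂ) - (ε l : ℂ)))⁻¹) *
        Matrix.of fun k i : Fin n => ∏ l ∈ Finset.univ.erase i, ((ε k : ℂ) - lam l) := by
    ext k i
    rw [Matrix.diagonal_mul, zJacobian, Matrix.of_apply, Matrix.of_apply, zSlope, div_eq_mul_inv]
    ring
  rw [h, Matrix.det_mul, norm_mul, norm_det_prod_erase_sub _ hlam, Matrix.det_diagonal, norm_prod]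
  simp only [norm_neg, norm_inv, Finset.prod_inv_distrib]
  rw [prod_norm_prod_erase_sub fun k => (ε k : ℂ)]
  field_simp

/-- The derivative of the coordinates `z`. -/
noncomputable def zDeriv (ε : Fin n → ℝ) (lam : Fin n → ℂ) : (Fin n → ℂ) →L[ℂ] (Fin n → ℂ) :=
  LinearMap.toContinuousLinearMap (Matrix.toLin' (zJacobian ε lam))

theorem hasFDerivAt_zVar (ε : Fin n → ℝ) (lam : Fin n → ℂ) :
    HasFDerivAt (zVar ε) (zDeriv ε lam) lam := by
  rw [hasFDerivAt_pi']
  intro k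
  have h0 : ∀ l ∈ (Finset.univ : Finset (Fin n)),
      HasFDerivAt (fun lam : Fin n → ℂ => (ε k : ℂ) - lam l)
        (-ContinuousLinearMap.proj (R := ℂ) (φ := fun _ : Fin n => ℂ) l) lam := fun l _ =>
    (ContinuousLinearMap.proj (R := ℂ) (φ := fun _ : Fin n => ℂ) l).hasFDerivAt.const_sub (ε k : ℂ)
  have h := (HasFDerivAt.finsetProd h0).mul_const
    (∏ l ∈ Finset.univ.erase k, ((ε k : ℂ) - (ε l : ℂ)))⁻¹
  refine (h.congr_fderiv ?_).congr_of_eventuallyEq ?_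
  · ext v
    simp [zDeriv, zJacobian, Matrix.toLin'_apply, Matrix.mulVec, dotProduct, Finset.mul_sum, zSlope,
      div_eq_mul_inv]
    refine Finset.sum_congr rfl fun i _ => ?_
    ring
  · exact Filter.Eventually.of_forall fun lam => by simp only [zVar, lagrangeRes, div_eq_mul_inv]

/-- The real determinant of a complex linear map is the squared modulus of its complex determinant,
which is why the density |W|² appears. -/
theorem abs_det_zDeriv {ε : Fin n → ℝ} (hε : Function.Injective ε) {lam : Fin n → ℂ}
    (hlam : Function.Injective lam) :
    |((zDeriv ε lam).restrictScalars ℝ).det| =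
      ‖vandermondeW lam‖ ^ 2 / ‖vandermondeW fun k => (ε k : ℂ)‖ ^ 2 := by
  have h : ((zDeriv ε lam).restrictScalars ℝ).det = ‖(zJacobian ε lam).det‖ ^ 2 := by
    rw [ContinuousLinearMap.det]
    refine (LinearMap.det_restrictScalars (R := ℝ)
      (f := Matrix.toLin' (zJacobian ε lam))).trans ?_
    rw [LinearMap.det_toLin', Algebra.norm_complex_eq]
    exact Complex.normSq_eq_norm_sq _
  rw [h, norm_det_zJacobian hε hlam, abs_of_nonneg (sq_nonneg _), div_pow]

end

/-! ### The change of variables -/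

section

variable {n : ℕ}

theorem zVar_comp_perm (ε : Fin n → ℝ) (lam : Fin n → ℂ) (σ : Equiv.Perm (Fin n)) :
    zVar ε (lam ∘ σ) = zVar ε lam := by
  funext k
  rw [zVar, lagrangeRes, zVar, lagrangeRes]
  congr 1
  exact Equiv.prod_comp σ fun l => (ε k : ℂ) - lam l

theorem norm_vandermondeW_comp_perm (lam : Fin n → ℂ) (σ : Equiv.Perm (Fin n)) :
    ‖vandermondeW (lam ∘ σ)‖ = ‖vandermondeW lam‖ := by
  have h : Matrix.vandermonde (lam ∘ σ) = (Matrix.vandermonde lam).submatrix σ id := rfl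
  rw [← norm_det_vandermonde, h, Matrix.det_permute, norm_mul, norm_det_vandermonde]
  rcases Int.units_eq_one_or (Equiv.Perm.sign σ) with h | h <;> simp [h]

theorem exists_map_univ_eq (m : Multiset ℂ) (hm : m.card = n) :
    ∃ lam : Fin n → ℂ, Finset.univ.val.map lam = m := by
  obtain ⟨l, rfl⟩ := Quot.exists_rep m
  change l.length = n at hm
  subst hm
  exact ⟨l.get, by rw [Fin.univ_val_map, List.ofFn_get]; rfl⟩

/-- Given z, take for λ the roots of the monic polynomial ∏(X - ε_l) + ∑ z_k ∏_{l≠k}(X - ε_l) and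
read off its values at the ε_k. -/
theorem zVar_surjective {ε : Fin n → ℝ} (hε : Function.Injective ε) :
    Function.Surjective (zVar ε) := by
  classical
  intro z
  set q : Fin n → Polynomial ℂ := fun k =>
    ∏ l ∈ Finset.univ.erase k, (Polynomial.X - Polynomial.C (ε l : ℂ)) with hq
  set R : Polynomial ℂ := ∑ k, Polynomial.C (z k) * q k with hR
  set P : Polynomial ℂ := ∏ l, (Polynomial.X - Polynomial.C (ε l : ℂ)) + R with hP
  have hd : (∏ l, (Polynomial.X - Polynomial.C (ε l : ℂ)) : Polynomial ℂ).degree = n := by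
    rw [Polynomial.degree_prod]
    simp
  have hmon : (∏ l, (Polynomial.X - Polynomial.C (ε l : ℂ)) : Polynomial ℂ).Monic :=
    Polynomial.monic_prod_of_monic _ _ fun l _ => Polynomial.monic_X_sub_C _
  have hRd : R.degree < (∏ l, (Polynomial.X - Polynomial.C (ε l : ℂ)) : Polynomial ℂ).degree := by
    rw [hd]
    refine (Polynomial.degree_sum_le _ _).trans_lt ((Finset.sup_lt_iff (WithBot.bot_lt_coe _)).2
      fun k _ => (Polynomial.degree_mul_le _ _).trans_lt ?_)
    refine (add_le_add Polynomial.degree_C_le le_rfl).trans_lt ?_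
    rw [zero_add, hq, Polynomial.degree_prod]
    simp only [Polynomial.degree_X_sub_C, Finset.sum_const, Finset.card_erase_of_mem
      (Finset.mem_univ k), Finset.card_univ, Fintype.card_fin, nsmul_eq_mul, mul_one]
    exact_mod_cast Nat.sub_lt (Nat.pos_of_ne_zero fun h => by subst h; exact k.elim0) one_pos
  have hPm : P.Monic := hmon.add_of_left hRd
  have hPd : P.natDegree = n :=
    Polynomial.natDegree_eq_of_degree_eq_some
      ((Polynomial.degree_add_eq_left_of_degree_lt hRd).trans hd)
  obtain ⟨lam, hlam⟩ := exists_map_univ_eq (n := n) P.roots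
    ((IsAlgClosed.splits P).natDegree_eq_card_roots.symm.trans hPd)
  refine ⟨lam, funext fun k => ?_⟩
  have h1 : P.eval (ε k : ℂ) = ∏ l, ((ε k : ℂ) - lam l) := by
    rw [(IsAlgClosed.splits P).eval_eq_prod_roots, hPm.leadingCoeff, one_mul, ← hlam,
      Multiset.map_map]
    rfl
  have h2 : P.eval (ε k : ℂ) = z k * ∏ l ∈ Finset.univ.erase k, ((ε k : ℂ) - ε l) := by
    rw [hP, hR, Polynomial.eval_add, Polynomial.eval_prod,
      Finset.prod_eq_zero (Finset.mem_univ k) (by simp), zero_add, Polynomial.eval_finsetSum,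
      Finset.sum_eq_single k]
    · simp [hq, Polynomial.eval_prod]
    · intro l _ hl
      rw [Polynomial.eval_mul, hq, Polynomial.eval_prod,
        Finset.prod_eq_zero (Finset.mem_erase.2 ⟨hl.symm, Finset.mem_univ k⟩) (by simp), mul_zero]
    · simp
  rw [zVar, lagrangeRes, ← h1, h2, mul_div_assoc, div_self, mul_one]
  exact Finset.prod_ne_zero_iff.2 fun l hl =>
    sub_ne_zero.2 fun h => (Finset.mem_erase.1 hl).1 (hε (Complex.ofReal_injective h)).symm

/-- The points whose coordinates are ordered by their real parts. -/
def orderedRe (n : ℕ) : Set (Fin n → ℂ) :=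
  {lam | StrictMono fun i => (lam i).re}

theorem measurableSet_orderedRe : MeasurableSet (orderedRe n) := by
  simp only [orderedRe, StrictMono, Set.ofPred_forall]
  refine MeasurableSet.iInter fun i => MeasurableSet.iInter fun j => MeasurableSet.iInter fun _ =>
    measurableSet_lt ?_ ?_ <;> fun_prop

theorem injective_of_mem_orderedRe {lam : Fin n → ℂ} (h : lam ∈ orderedRe n) :
    Function.Injective lam :=
  fun _ _ hij => StrictMono.injective h (congrArg Complex.re hij)

/-- The strictly increasing enumeration of a finite set of reals is unique. Points with distinct
real parts, ordered this way, form a fundamental domain for permutations up to a null set. -/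
theorem eq_of_mem_orderedRe {lam mu : Fin n → ℂ} (hl : lam ∈ orderedRe n) (hm : mu ∈ orderedRe n)
    (h : Set.range lam = Set.range mu) : lam = mu := by
  have hr : ∀ v : Fin n → ℂ, Set.range (fun i => (v i).re) = Complex.re '' Set.range v :=
    fun v => Set.range_comp Complex.re v
  have hre : (fun i => (lam i).re) = fun i => (mu i).re :=
    (StrictMono.range_inj hl hm).1 (by rw [hr, hr, h])
  funext i
  obtain ⟨j, hj⟩ : lam i ∈ Set.range mu := h ▸ Set.mem_range_self i
  have : j = i := by
    refine StrictMono.injective hm ?_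
    rw [← congrFun hre i]
    exact congrArg Complex.re hj
  rw [← hj, this]

/-- The z_k determine the polynomial ∏(t - λ_l), hence its roots. -/
theorem range_subset_of_zVar_eq {ε : Fin n → ℝ} (hε : Function.Injective ε)
    {lam mu : Fin n → ℂ} (h : zVar ε lam = zVar ε mu) : Set.range lam ⊆ Set.range mu := by
  have hεi : Function.Injective fun k => (ε k : ℂ) :=
    fun a b h => hε (Complex.ofReal_injective h)
  rintro _ ⟨i, rfl⟩
  have h1 : ∏ l, (lam i - mu l) = ∏ l, (lam i - lam l) := by
    rw [prod_sub_eq_interpolation lam hεi, prod_sub_eq_interpolation mu hεi]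
    exact congrArg _ (Finset.sum_congr rfl fun k _ => by rw [← zVar, ← zVar, h])
  rw [Finset.prod_eq_zero (f := fun l => lam i - lam l) (Finset.mem_univ i)
    (sub_self (lam i))] at h1
  obtain ⟨l, -, hl⟩ := Finset.prod_eq_zero_iff.1 h1
  exact ⟨l, (sub_eq_zero.1 hl).symm⟩

theorem injOn_zVar {ε : Fin n → ℝ} (hε : Function.Injective ε) :
    Set.InjOn (zVar ε) (orderedRe n) := fun _ hl _ hm h =>
  eq_of_mem_orderedRe hl hm
    ((range_subset_of_zVar_eq hε h).antisymm (range_subset_of_zVar_eq hε h.symm))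

theorem exists_comp_perm_mem_orderedRe {lam : Fin n → ℂ}
    (h : Function.Injective fun i => (lam i).re) :
    ∃ σ : Equiv.Perm (Fin n), lam ∘ σ ∈ orderedRe n :=
  ⟨Tuple.sort fun i => (lam i).re,
    (Tuple.monotone_sort fun i => (lam i).re).strictMono_of_injective
      (h.comp (Tuple.sort _).injective)⟩

theorem volume_re_not_injective :
    volume {lam : Fin n → ℂ | ¬ Function.Injective fun i => (lam i).re} = 0 := by
  have hsub : {lam : Fin n → ℂ | ¬ Function.Injective fun i => (lam i).re} ⊆
      ⋃ p : {p : Fin n × Fin n // p.1 ≠ p.2},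
        {lam : Fin n → ℂ | (lam p.1.1).re = (lam p.1.2).re} := by
    intro lam h
    simp only [Set.mem_ofPred_eq, Function.Injective, not_forall] at h
    obtain ⟨i, j, hij, hne⟩ := h
    exact Set.mem_iUnion.2 ⟨⟨(i, j), hne⟩, hij⟩
  refine measure_mono_null hsub (measure_iUnion_null fun p => ?_)
  let L : (Fin n → ℂ) →ₗ[ℝ] ℝ :=
    Complex.reLm ∘ₗ
      (LinearMap.proj (R := ℝ) (φ := fun _ : Fin n => ℂ) p.1.1 - LinearMap.proj p.1.2)
  have hL : {lam : Fin n → ℂ | (lam p.1.1).re = (lam p.1.2).re} = (LinearMap.ker L : Set _) := by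
    ext lam
    simp [L, sub_eq_zero]
  rw [hL]
  refine Measure.addHaar_submodule _ _ fun h => ?_
  -- The hyperplane of equal real parts is proper: the functional does not vanish on the coordinate
  -- vector e_i.
  have := LinearMap.congr_fun (LinearMap.ker_eq_top.1 h) (Pi.single p.1.1 1)
  simp [L, Pi.single_eq_of_ne p.2.symm] at this

theorem ae_re_injective :
    ∀ᵐ lam : Fin n → ℂ, Function.Injective fun i => (lam i).re :=
  volume_re_not_injective

/-- By surjectivity and symmetry, a missed point is the image of some λ with coinciding real parts;
a differentiable map sends that null set to a null set. -/
theorem image_zVar_orderedRe_ae_eq {ε : Fin n → ℝ} (hε : Function.Injective ε) :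
    zVar ε '' orderedRe n =ᵐ[volume] (Set.univ : Set (Fin n → ℂ)) := by
  rw [ae_eq_univ]
  refine measure_mono_null ?_ (addHaar_image_eq_zero_of_differentiableOn_of_addHaar_eq_zero volume
    (f := zVar ε) (fun lam _ => ((hasFDerivAt_zVar ε lam).restrictScalars
      ℝ).differentiableAt.differentiableWithinAt) volume_re_not_injective)
  intro z hz
  obtain ⟨lam, rfl⟩ := zVar_surjective hε z
  refine ⟨lam, fun h => hz ?_, rfl⟩
  obtain ⟨σ, hσ⟩ := exists_comp_perm_mem_orderedRe h
  exact ⟨_, hσ, zVar_comp_perm ε lam σ⟩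

/-- The change of variables on the points ordered by their real parts. -/
theorem setIntegral_comp_zVar {ε : Fin n → ℝ} (hε : Function.Injective ε) {Φ : (Fin n → ℂ) → ℂ}
    (hΦ : Integrable Φ) :
    IntegrableOn (fun lam => ((‖vandermondeW lam‖ ^ 2 : ℝ) : ℂ) * Φ (zVar ε lam)) (orderedRe n) ∧
      ∫ lam in orderedRe n, ((‖vandermondeW lam‖ ^ 2 : ℝ) : ℂ) * Φ (zVar ε lam) =
        ((‖vandermondeW fun k => (ε k : ℂ)‖ ^ 2 : ℝ) : ℂ) * ∫ z, Φ z := by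
  have hW : ((‖vandermondeW fun k => (ε k : ℂ)‖ ^ 2 : ℝ) : ℂ) ≠ 0 :=
    Complex.ofReal_ne_zero.2 (pow_ne_zero 2 (norm_ne_zero_iff.2
      (vandermondeW_ne_zero fun a b h => hε (Complex.ofReal_injective h))))
  have hd : ∀ lam ∈ orderedRe n, HasFDerivWithinAt (zVar ε)
      ((zDeriv ε lam).restrictScalars ℝ) (orderedRe n) lam := fun lam _ =>
    ((hasFDerivAt_zVar ε lam).restrictScalars ℝ).hasFDerivWithinAt
  have hcongr : Set.EqOn (fun lam => ((‖vandermondeW lam‖ ^ 2 : ℝ) : ℂ) * Φ (zVar ε lam))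
      (fun lam => ((‖vandermondeW fun k => (ε k : ℂ)‖ ^ 2 : ℝ) : ℂ) *
        (|((zDeriv ε lam).restrictScalars ℝ).det| • Φ (zVar ε lam))) (orderedRe n) := by
    intro lam hlam
    simp only
    rw [abs_det_zDeriv hε (injective_of_mem_orderedRe hlam), Complex.real_smul, ← mul_assoc,
      Complex.ofReal_div, mul_div_cancel₀ _ hW]
  constructor
  · refine IntegrableOn.congr_fun ?_ hcongr.symm measurableSet_orderedRe
    exact ((integrableOn_image_iff_integrableOn_abs_det_fderiv_smul volume measurableSet_orderedRe
      hd (injOn_zVar hε) Φ).1 hΦ.integrableOn).const_mul _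
  · rw [setIntegral_congr_fun measurableSet_orderedRe hcongr, integral_const_mul,
      ← integral_image_eq_integral_abs_det_fderiv_smul volume measurableSet_orderedRe
        hd (injOn_zVar hε) Φ, setIntegral_congr_set (image_zVar_orderedRe_ae_eq hε),
      setIntegral_univ]

/-- Integrals of symmetric functions reduce to the points ordered by their real parts. -/
theorem integral_of_symmetric {G : (Fin n → ℂ) → ℂ}
    (hsymm : ∀ (σ : Equiv.Perm (Fin n)) lam, G (lam ∘ σ) = G lam)
    (hG : IntegrableOn G (orderedRe n)) :
    Integrable G ∧ ∫ lam, G lam = (n.factorial : ℂ) * ∫ lam in orderedRe n, G lam := by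
  set e : Equiv.Perm (Fin n) → (Fin n → ℂ) ≃ᵐ (Fin n → ℂ) := fun σ =>
    MeasurableEquiv.piCongrLeft (fun _ => ℂ) σ with he
  have hmp : ∀ σ, MeasurePreserving (e σ) volume volume := fun σ =>
    volume_measurePreserving_piCongrLeft (fun _ => ℂ) σ
  have hap : ∀ σ lam, e σ lam = lam ∘ σ.symm := by
    intro σ lam
    funext i
    obtain ⟨a, rfl⟩ := σ.surjective i
    rw [Function.comp_apply, Equiv.symm_apply_apply]
    exact Equiv.piCongrLeft_apply_apply (fun _ => ℂ) σ lam a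
  have hGe : ∀ σ, G ∘ e σ = G := fun σ => funext fun lam => by
    rw [Function.comp_apply, hap, hsymm]
  have hmeas : ∀ σ, MeasurableSet (e σ ⁻¹' orderedRe n) := fun σ =>
    (e σ).measurable measurableSet_orderedRe
  have hint : ∀ σ, IntegrableOn G (e σ ⁻¹' orderedRe n) := fun σ => by
    have := (hmp σ).integrableOn_comp_preimage (e σ).measurableEmbedding (f := G)
      (s := orderedRe n)
    rw [hGe] at this
    exact this.2 hG
  have hval : ∀ σ, ∫ lam in e σ ⁻¹' orderedRe n, G lam = ∫ lam in orderedRe n, G lam :=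
    fun σ => (congrArg (fun F => ∫ lam in e σ ⁻¹' orderedRe n, F lam) (hGe σ).symm).trans
      ((hmp σ).setIntegral_preimage_emb (e σ).measurableEmbedding G (orderedRe n))
  -- Two orderings of the same λ coincide, and its entries are distinct, so the two permutations are
  -- equal.
  have hdisj : Pairwise (Function.onFun Disjoint fun σ => e σ ⁻¹' orderedRe n) := by
    intro σ τ hne
    refine Set.disjoint_left.2 fun lam h1 h2 => hne ?_
    rw [Set.mem_preimage, hap] at h1 h2
    have h3 := eq_of_mem_orderedRe h1 h2 (by
      rw [σ.symm.surjective.range_comp, τ.symm.surjective.range_comp])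
    have hinj : Function.Injective lam := by
      have := (injective_of_mem_orderedRe h1).comp σ.injective
      rwa [Function.comp_assoc, Equiv.symm_comp_self, Function.comp_id] at this
    have h4 : σ.symm = τ.symm := Equiv.ext fun i => hinj (congrFun h3 i)
    exact Equiv.symm_bijective.injective h4
  have hU : (⋃ σ, e σ ⁻¹' orderedRe n) =ᵐ[volume] (Set.univ : Set (Fin n → ℂ)) := by
    rw [ae_eq_univ]
    refine measure_mono_null ?_ (volume_re_not_injective (n := n))
    intro lam h hl
    obtain ⟨σ, hσ⟩ := exists_comp_perm_mem_orderedRe hl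
    refine h (Set.mem_iUnion.2 ⟨σ.symm, ?_⟩)
    rwa [Set.mem_preimage, hap, Equiv.symm_symm]
  constructor
  · rw [← integrableOn_univ]
    exact (integrableOn_finite_iUnion.2 hint).congr_set_ae hU.symm
  · rw [← setIntegral_univ, ← setIntegral_congr_set hU, integral_iUnion_fintype hmeas hdisj hint,
      Finset.sum_congr rfl fun σ _ => hval σ, Finset.sum_const, Finset.card_univ,
      Fintype.card_perm, Fintype.card_fin, nsmul_eq_mul]

/-- The constant of the change of variables from `λ` to `z`. -/
noncomputable def jacobianConst (ε : Fin n → ℝ) : ℂ :=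
  n.factorial * ((‖vandermondeW fun k => (ε k : ℂ)‖ ^ 2 : ℝ) : ℂ)

theorem integral_comp_zVar {ε : Fin n → ℝ} (hε : Function.Injective ε) {Φ : (Fin n → ℂ) → ℂ}
    (hΦ : Integrable Φ) :
    Integrable (fun lam => ((‖vandermondeW lam‖ ^ 2 : ℝ) : ℂ) * Φ (zVar ε lam)) ∧
      ∫ lam, ((‖vandermondeW lam‖ ^ 2 : ℝ) : ℂ) * Φ (zVar ε lam) =
        jacobianConst ε * ∫ z, Φ z := by
  obtain ⟨h1, h2⟩ := setIntegral_comp_zVar hε hΦ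
  obtain ⟨h3, h4⟩ := integral_of_symmetric
    (G := fun lam => ((‖vandermondeW lam‖ ^ 2 : ℝ) : ℂ) * Φ (zVar ε lam))
    (fun σ lam => by simp only [norm_vandermondeW_comp_perm, zVar_comp_perm]) h1
  exact ⟨h3, by rw [h4, h2, jacobianConst, mul_assoc]⟩

end

/-! ### The scalar product in the coordinates `z` -/

section

variable {n : ℕ}

theorem xVar_eq (hb g : ℝ) (ε : Fin n → ℝ) (lam : Fin n → ℂ) (i : Fin n) :
    xVar hb g ε lam i = 4 / (hb * g ^ 2) * ‖zVar ε lam i‖ ^ 2 := by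
  rw [xVar, zVar, lagrangeRes, norm_div, div_pow, norm_prod, norm_prod,
    ← Finset.prod_pow, ← Finset.prod_pow]
  congr 2
  refine Finset.prod_congr rfl fun k _ => ?_
  rw [← Complex.ofReal_sub, Complex.norm_real, Real.norm_eq_abs, sq_abs]

theorem ae_ne_ofReal (ε : Fin n → ℝ) : ∀ᵐ lam : Fin n → ℂ, ∀ i k, lam i ≠ ε k :=
  ae_all_iff.2 fun i => ae_all_iff.2 fun k => by
    rw [ae_iff]
    simp only [not_not]
    exact Measure.pi_hyperplane (fun _ : Fin n => (volume : Measure ℂ)) i (ε k : ℂ)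

theorem zVar_ne_zero {ε : Fin n → ℝ} (hε : Function.Injective ε) {lam : Fin n → ℂ}
    (h : ∀ i k, lam i ≠ ε k) (k : Fin n) : zVar ε lam k ≠ 0 :=
  div_ne_zero (Finset.prod_ne_zero_iff.2 fun l _ => sub_ne_zero.2 (h l k).symm)
    (Finset.prod_ne_zero_iff.2 fun _ hl => sub_ne_zero.2 fun h =>
      (Finset.mem_erase.1 hl).1 (hε (Complex.ofReal_injective h)).symm)

/-- Equality holds off the null set where some λ_i equals some ε_k; elsewhere every x_i is positive
and the Bessel form of the density applies. -/
theorem innerIntegrand_ae_eq (M : ℕ) (d : Fin n → ℕ) {hb g : ℝ} (hhb : 0 < hb) (hg : g ≠ 0)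
    {ε : Fin n → ℝ} (hε : Function.Injective ε) {f h : (Fin n → ℂ) → ℂ}
    {F H : MvPolynomial (Fin n) ℂ} (hf : ∀ᵐ lam, f lam = F.eval (zVar ε lam))
    (hh : ∀ᵐ lam, h lam = H.eval (zVar ε lam)) (δ : ℝ) :
    (fun lam => (Real.exp (-δ * ∑ i, xVar hb g ε lam i) : ℂ) *
      innerIntegrand M d hb g ε f h lam) =ᵐ[volume]
    fun lam => ((‖vandermondeW lam‖ ^ 2 : ℝ) : ℂ) *
      zIntegrand (M + n) (fun i => d i + 1) (4 / (hb * g ^ 2)) δ (fun z => F.eval z)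
        (fun z => H.eval z) (zVar ε lam) := by
  have hc : 0 < 4 / (hb * g ^ 2) := by positivity
  filter_upwards [hf, hh, ae_ne_ofReal ε] with lam h1 h2 h3
  have hx : ∀ i, 0 < xVar hb g ε lam i := fun i => by
    rw [xVar_eq]
    exact mul_pos hc (pow_pos (norm_pos_iff.2 (zVar_ne_zero hε h3 i)) 2)
  have hρ : rho M d (xVar hb g ε lam) =
      besselIntegral (M + n) (fun i => d i + 1) fun i => 4 / (hb * g ^ 2) * ‖zVar ε lam i‖ ^ 2 := by
    rw [rho_eq M d hx, funext (xVar_eq hb g ε lam), besselIntegral]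
  rw [innerIntegrand, hρ, zIntegrand, h1, h2, Finset.sum_congr rfl fun i _ => xVar_eq hb g ε lam i,
    Complex.ofReal_mul]
  ring

theorem hasScalarProduct_of_ae_eq (M : ℕ) (d : Fin n → ℕ) {hb g : ℝ} (hhb : 0 < hb) (hg : g ≠ 0)
    {ε : Fin n → ℝ} (hε : Function.Injective ε) {f h : (Fin n → ℂ) → ℂ}
    {F H : MvPolynomial (Fin n) ℂ} (hF : F ∈ MvPolynomial.restrictTotalDegree (Fin n) ℂ M)
    (hH : H ∈ MvPolynomial.restrictTotalDegree (Fin n) ℂ M)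
    (hf : ∀ᵐ lam, f lam = F.eval (zVar ε lam)) (hh : ∀ᵐ lam, h lam = H.eval (zVar ε lam)) :
    HasScalarProduct M d hb g ε f h (jacobianConst ε *
      polyInner M (monomialWeight M (fun i => d i + 1) (4 / (hb * g ^ 2))) F H) := by
  have hc : 0 < 4 / (hb * g ^ 2) := by positivity
  have hi := fun {δ : ℝ} (hδ : 0 < δ) => integral_comp_zVar hε
    (integrable_zIntegrand_eval (M + n) (fun i => d i + 1) hc hδ hF hH)
  have hae := innerIntegrand_ae_eq M d hhb hg hε hf hh
  refine ⟨fun δ hδ => (hi hδ).1.congr (hae δ).symm, ?_⟩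
  refine ((tendsto_integral_zIntegrand_eval (fun i => d i + 1) hc hF hH).const_mul
    (jacobianConst ε)).congr' ?_
  filter_upwards [self_mem_nhdsWithin] with δ hδ
  rw [integral_congr_ae (hae δ), (hi hδ).2]

/-- The coefficients of H_j are singular on a null set, so the polynomial form is only claimed
almost everywhere; integrals do not see the difference. -/
theorem opH_ae_eq (M : ℕ) (d : Fin n → ℕ) {hb g : ℝ} (hhb : 0 < hb) (hg : g ≠ 0) (ω : ℝ)
    {ε : Fin n → ℝ} (hε : Function.Injective ε) (j : Fin n) (F : MvPolynomial (Fin n) ℂ) :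
    ∀ᵐ lam, opH M d hb g ω ε j (fun lam => F.eval (zVar ε lam)) lam =
      (hamZ M d (4 / (hb * g ^ 2)) (2 * ω / (hb * g ^ 2) - 4 / (hb * g ^ 2) * ε j) ε j F).eval
        (zVar ε lam) := by
  filter_upwards [ae_re_injective (n := n), ae_ne_ofReal ε] with lam h1 h2
  exact opH_eval_zVar M d hhb.ne' hg ω ε hε j F
    (fun a b h => h1 (congrArg Complex.re h)) h2

theorem exists_hasScalarProduct_opH (M : ℕ) (d : Fin n → ℕ) {hb g : ℝ} (hhb : 0 < hb) (hg : g ≠ 0)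
    (ω : ℝ) {ε : Fin n → ℝ} (hε : Function.Injective ε) (j : Fin n) {f h : (Fin n → ℂ) → ℂ}
    (hf : f ∈ waveFunctions n M) (hh : h ∈ waveFunctions n M) :
    ∃ c : ℂ, HasScalarProduct M d hb g ε f (opH M d hb g ω ε j h) c ∧
      HasScalarProduct M d hb g ε (opH M d hb g ω ε j f) h c := by
  obtain ⟨F, hF, rfl⟩ := exists_eval_zVar_of_mem_waveFunctions hε hf
  obtain ⟨H, hH, rfl⟩ := exists_eval_zVar_of_mem_waveFunctions hε hh
  have hc : 4 / (hb * g ^ 2) ≠ 0 := by positivity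
  have h1 := hasScalarProduct_of_ae_eq M d hhb hg hε hF
    (hamZ_mem M d (4 / (hb * g ^ 2)) (2 * ω / (hb * g ^ 2) - 4 / (hb * g ^ 2) * ε j) ε j hH)
    (Eventually.of_forall fun _ => rfl) (opH_ae_eq M d hhb hg ω hε j H)
  have h2 := hasScalarProduct_of_ae_eq M d hhb hg hε
    (hamZ_mem M d (4 / (hb * g ^ 2)) (2 * ω / (hb * g ^ 2) - 4 / (hb * g ^ 2) * ε j) ε j hF) hH
    (opH_ae_eq M d hhb hg ω hε j F) (Eventually.of_forall fun _ => rfl)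
  -- Both limits are the same constant times `polyInner`, so symmetry of `hamZ` identifies them.
  rw [← isAdj_hamZ M d hc _ ε j F hF H hH] at h2
  exact ⟨_, h1, h2⟩

/-- When the integrand is Lebesgue integrable the scalar product is the Lebesgue integral. -/
theorem HasScalarProduct.eq_integral {M : ℕ} {d : Fin n → ℕ} {hb g : ℝ} (hhb : 0 < hb)
    {ε : Fin n → ℝ} {f h : (Fin n → ℂ) → ℂ} {c : ℂ} (hc : HasScalarProduct M d hb g ε f h c)
    (hi : Integrable (innerIntegrand M d hb g ε f h)) :
    ∫ lam, innerIntegrand M d hb g ε f h lam = c := by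
  refine tendsto_nhds_unique (tendsto_integral_filter_of_dominated_convergence
    (fun lam => ‖innerIntegrand M d hb g ε f h lam‖) ?_ ?_ hi.norm ?_) hc.2
  · filter_upwards [self_mem_nhdsWithin] with δ hδ
    exact (hc.1 δ hδ).aestronglyMeasurable
  · filter_upwards [self_mem_nhdsWithin] with δ hδ
    refine Eventually.of_forall fun lam => ?_
    rw [norm_mul, Complex.norm_real, Real.norm_eq_abs, abs_of_pos (Real.exp_pos _)]
    refine mul_le_of_le_one_left (norm_nonneg _) (Real.exp_le_one_iff.2 ?_)
    refine mul_nonpos_of_nonpos_of_nonneg (neg_nonpos.2 (le_of_lt hδ))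
      (Finset.sum_nonneg fun i _ => ?_)
    rw [xVar_eq]
    positivity
  · refine Eventually.of_forall fun lam => ?_
    have h1 : Continuous fun δ : ℝ => (Real.exp (-δ * ∑ i, xVar hb g ε lam i) : ℂ) *
        innerIntegrand M d hb g ε f h lam := by fun_prop
    refine tendsto_nhdsWithin_of_tendsto_nhds ?_
    simpa using h1.tendsto 0

end

end JCG

/-! ### The main theorem -/

theorem mainTheorem2 (n M : ℕ) (d : Fin n → ℕ) (hb g ω : ℝ) (ε : Fin n → ℝ)
    (h_hb : 0 < hb) (h_g : g ≠ 0) (h_ε : Function.Injective ε) :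
    -- the scalar product is defined on the wave functions
    (∀ f ∈ JCG.waveFunctions n M, ∀ h ∈ JCG.waveFunctions n M,
      ∃ c : ℂ, JCG.HasScalarProduct M d hb g ε f h c) ∧
    -- the Hamiltonians are Hermitian
    (∀ j : Fin n, ∀ f ∈ JCG.waveFunctions n M, ∀ h ∈ JCG.waveFunctions n M,
      ∃ c : ℂ, JCG.HasScalarProduct M d hb g ε f (JCG.opH M d hb g ω ε j h) c ∧
        JCG.HasScalarProduct M d hb g ε (JCG.opH M d hb g ω ε j f) h c) ∧
    -- the same with Lebesgue integrals, whenever these converge absolutely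
    (∀ j : Fin n, ∀ f ∈ JCG.waveFunctions n M, ∀ h ∈ JCG.waveFunctions n M,
      Integrable (JCG.innerIntegrand M d hb g ε f (JCG.opH M d hb g ω ε j h)) →
      Integrable (JCG.innerIntegrand M d hb g ε (JCG.opH M d hb g ω ε j f) h) →
      ∫ lam, JCG.innerIntegrand M d hb g ε f (JCG.opH M d hb g ω ε j h) lam =
        ∫ lam, JCG.innerIntegrand M d hb g ε (JCG.opH M d hb g ω ε j f) h lam) ∧
    -- the integral formula and the power series agree up to the constant factor `(M + n)!`
    (∀ x : Fin n → ℝ, Summable (JCG.rhoTerm M d x)) ∧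
    (∀ x : Fin n → ℝ, (∀ i, 0 < x i) →
      IntegrableOn (JCG.rhoIntegrand M d x) (Set.Ioi 0) ∧
        JCG.rho M d x = ((M + n).factorial : ℝ) * JCG.rhoSeries M d x) ∧
    -- the power series solves the system of partial differential equations
    ContDiff ℝ (⊤ : ℕ∞) (JCG.rhoSeries (n := n) M d) ∧
    (∀ (x : Fin n → ℝ) (i k : Fin n),
      JCG.opD d i (JCG.rhoSeries M d) x = JCG.opD d k (JCG.rhoSeries M d) x) ∧
    (∀ (x : Fin n → ℝ) (i : Fin n),
      JCG.opD d i (JCG.rhoSeries M d) x + JCG.opD0 M (JCG.rhoSeries M d) x = 0) ∧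
    -- the case of one spin `s = r / 2` with `2 s ≤ M`
    (∀ r : ℕ, r ≤ M →
      (JCG.laguerre (r + 1) (M - r)).natDegree = M - r ∧
      ∀ x : ℝ, 0 < x →
        JCG.rho M (fun _ : Fin 1 => r) (fun _ => x) =
            (-1 : ℝ) ^ (r + 1) *
              iteratedDeriv (M + 1) (fun t : ℝ => Real.exp (-t) * t ^ (M - r)) x ∧
        JCG.rho M (fun _ : Fin 1 => r) (fun _ => x) =
            ((M - r).factorial : ℝ) *
              (Real.exp (-x) * (JCG.laguerre (r + 1) (M - r)).eval x)) := by
  refine ⟨fun f hf h hh => ?_, fun j f hf h hh =>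
    JCG.exists_hasScalarProduct_opH M d h_hb h_g ω h_ε j hf hh, fun j f hf h hh h1 h2 => ?_,
    fun x => (JCG.hasSum_rhoTerm M d x).summable, fun x hx =>
      ⟨JCG.integrableOn_rhoIntegrand M d hx, JCG.rho_eq_rhoSeries M d hx⟩, ?_,
    fun x i k => ?_, fun x i => ?_, fun r hr => ⟨JCG.natDegree_laguerre _ _, fun x hx => ?_⟩⟩
  · obtain ⟨F, hF, rfl⟩ := JCG.exists_eval_zVar_of_mem_waveFunctions h_ε hf
    obtain ⟨H, hH, rfl⟩ := JCG.exists_eval_zVar_of_mem_waveFunctions h_ε hh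
    exact ⟨_, JCG.hasScalarProduct_of_ae_eq M d h_hb h_g h_ε hF hH
      (Eventually.of_forall fun _ => rfl) (Eventually.of_forall fun _ => rfl)⟩
  · obtain ⟨c, hc1, hc2⟩ := JCG.exists_hasScalarProduct_opH M d h_hb h_g ω h_ε j hf hh
    rw [hc1.eq_integral h_hb h1, hc2.eq_integral h_hb h2]
  · rw [JCG.rhoSeries_eq M d]
    exact JCG.contDiff_mSum ((JCG.mEntire_laplaceCoeff _ _).const_mul _)
  · rw [JCG.opD_rhoSeries, JCG.opD_rhoSeries]
  · rw [JCG.opD_rhoSeries, neg_add_cancel]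
  · have h := JCG.rho_one_eq_iteratedDeriv hr hx
    exact ⟨h, h.trans (JCG.iteratedDeriv_exp_mul_pow hr x)⟩
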